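/- **Time complexity of M4.** Let $n,d\ge 1$, let $f=\frac1n\sum_{i=1}^n f_i$ with $f_i:\mathbb R^d\to\mathbb R$ differentiable and $\|\nabla f_i(x)-\nabla f_i(y)\|\le L_i\|x-y\|$, let $f\ge f^*$, and let $\Delta=f(x^0)-f^*$. Suppose that, for some $L_A,L_B\ge0$ and all $x,u_1,\dots,u_n\in\mathbb R^d$, $$\Big\|\frac1n\sum_{i=1}^n(\nabla f_i(x+u_i)-\nabla f_i(x))\Big\|^2\le L_A^2\,\frac1n\sum_{i=1}^n\|u_i\|^2+L_B^2\,\Big\|\frac1n\sum_{i=1}^n u_i\Big\|^2 ,$$ and let $L_{\max}=\max\{\max_iL_i,L_A,L_B\}$. Worker $i$ has stochastic gradients $\nabla f_i(x;\xi)$ with mean $\nabla f_i(x)$ and $\mathbb E\|\nabla f_i(x;\xi)-\nabla f_i(x)\|^2\le\sigma^2$ for all $x$, where $\sigma>0$. Let $\varepsilon>0$ and assume that $x^0$ is not already $\varepsilon$-stationary: $\|\nabla f(x^0)\|^2\ge\varepsilon$. *Method.* For $1\le K\le d$, Rand$K$ maps $x$ to $\frac dK\sum_{j\in S}x_je_j$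 with $S$ a uniformly random $K$-element subset of $\{1,\dots,d\}$. M4 starts with $w_i^0=x_i^0=x^0$, $v_i^0=\frac1{b_{\rm init}}\sum_{r=1}^{b_{\rm init}}\nabla f_i(x^0;\xi^0_{ir})$, $g^0=\frac1n\sum_iv_i^0$, and iterates, for $k=0,1,\dots$ and all $i$, $$\begin{aligned}x^{k+1}&=x^k-\gamma g^k,\\ w_i^{k+1}&=x^{k+1}\text{ with probability }p_s,\text{ otherwise } w_i^k+\mathcal C^k_{s,i}(x^{k+1}-x^k),\\ x_i^{k+1}&=(1-\mu)x_i^k+\mu w_i^{k+1},\\ v_i^{k+1}&=(1-\nu)v_i^k+\frac\nu b\sum_{r=1}^b\nabla f_i(x_i^{k+1};\xi_{ir}^{k+1}),\\ g^{k+1}&=\frac1n\sum_iv_i^{k+1}\text{ with probability }p,\text{ otherwise } g^k+\frac1n\sum_i\mathcal C_i^k(v_i^{k+1}-v_i^k).\end{aligned}$$ Each of the two coins of an iteration is common to all workers; all coins, compressors and samples are independent. *Time.* Each worker needs at most $h$ seconds for a stochastic gradient; a coordinate takes at most $\kappa$ seconds from the server to a worker and at most $\tau$ seconds from a worker to the server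 ($h,\tau,\kappa>0$). Workers operate in parallel. In an iteration every worker receives $d$ coordinates or the coordinates kept by the server's compressor, computes $b$ stochastic gradients, and sends $d$ coordinates or those kept by its own compressor; the server waits for all workers. The total time of $K$ iterations is the time of computing the initial minibatches of size $b_{\rm init}$ plus the time of the $K$ iterations (the initial transmission of the vectors $v_i^0$ is not counted). *Parameters.* Let $t=\max\{h,\tau,\kappa,(d^2\tau^2h\sigma^2/(n\varepsilon))^{1/3}\}$ and $b=\lfloor t/h\rfloor$. The workers use Rand$K$ with $K=\min\{\lfloor t/\tau\rfloor,d\}$ and the server uses Rand$K$ with $K=\min\{\lfloor t/\kappa\rfloor,d\}$; let $\omega$, respectively $\omega_s$, be the corresponding value of $d/K-1$. Let $p_s=\frac1{\omega_s+1}$, $p=\frac1{\omega+1}$, and $$\nu=\mu=\eta=\min\Big\{\tfrac16\sqrt{\tfrac{bn\varepsilon}{\omega(\omega+1)\sigma^2}},\ \tfrac{bn\varepsilon}{6\sigma^2},\ \big(\tfrac{n}{\omega(\omega+1)\omega_s}\big)^{1/3},\ 1\Big\},$$ where entries with denominator $0$ are $+\infty$. Put $$B=\sqrt{\tfrac b\nu\big(1+\tfrac{\sigma^2}{n\varepsilon}\big)},\qquad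 \Lambda=\sqrt{\omega_s(\omega_s+1)L_A^2+\tfrac{\omega_s}n(\omega_s+1)L_B^2+\big(\tfrac{\omega(\omega+1)}n+\tfrac1{\eta^2}\big)L_{\max}^2}.$$ *Claim.* There are absolute constants $c_\gamma,c_b>0$ such that for all $a_\gamma,a_b>0$ there is a constant $C>0$, depending only on $a_\gamma$ and $a_b$, with the following property. Whenever $a_\gamma\le\gamma\Lambda\le c_\gamma$ and $c_bB\le b_{\rm init}\le a_bB$ (so that $\gamma=\Theta(\Lambda)^{-1}$ and $b_{\rm init}=\Theta(B)$), there is a number $K\ge1$ of iterations, depending only on the numerical parameters $n,d,h,\tau,\kappa,\sigma,\varepsilon,\Delta,(L_i)_i,L_A,L_B,\gamma,b_{\rm init}$ and not on the particular functions or distributions, such that the output $\bar x$, drawn uniformly from $x^0,\dots,x^{K-1}$, is an $\varepsilon$-stationary point, $\mathbb E\|\nabla f(\bar x)\|^2\le\varepsilon$, and the expected total time of the $K$ iterations, including the computation of the initial minibatches, is at most $$C\left(\max\Big\{h,\tau,\kappa,\frac{d\kappa}{\sqrt n},\frac{d\tau}{\sqrt n},\Big(\frac{d^3\tau^2\kappa}n\Big)^{1/3},\Big(\frac{d^2\tau^2h\sigma^2}{n\varepsilon}\Big)^{1/3},\frac{\sigma^2h}{n\varepsilon}\Big\}\frac{L_{\max}\Delta}\varepsilon+\frac{d\kappa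 L_A\Delta}\varepsilon\right).$$ -/

import Mathlib

open MeasureTheory ProbabilityTheory
open scoped Gradient

noncomputable section

namespace M4

/-- `ℝ^d` with the Euclidean norm. -/
abbrev Vec (d : ℕ) : Type := EuclideanSpace ℝ (Fin d)

/-- The average `(1/n) ∑ i, u i` over the `n` workers. -/
def mean {n : ℕ} {V : Type*} [AddCommGroup V] [Module ℝ V] (u : Fin n → V) : V :=
  (n : ℝ)⁻¹ • ∑ i, u i

/-! ### The optimization problem -/

/-- `f` is differentiable with `L`-Lipschitz gradient. -/
def IsSmooth {d : ℕ} (f : Vec d → ℝ) (L : ℝ) : Prop :=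
  Differentiable ℝ f ∧ ∀ x y, ‖∇ f x - ∇ f y‖ ≤ L * ‖x - y‖

/-- The objective `f = (1/n) ∑ i, f i`. -/
def objective {n d : ℕ} (f : Fin n → Vec d → ℝ) (x : Vec d) : ℝ :=
  mean fun i => f i x

/-- Functional `(LA, LB)` similarity of `f 1, …, f n`. -/
def Similarity {n d : ℕ} (f : Fin n → Vec d → ℝ) (LA LB : ℝ) : Prop :=
  0 ≤ LA ∧ 0 ≤ LB ∧ ∀ (x : Vec d) (u : Fin n → Vec d),
    ‖mean fun i => ∇ (f i) (x + u i) - ∇ (f i) x‖ ^ 2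
      ≤ LA ^ 2 * (mean fun i => ‖u i‖ ^ 2) + LB ^ 2 * ‖mean u‖ ^ 2

/-- `Lmax = max {max_i L_i, LA, LB}`. -/
def Lmax {n : ℕ} (Ls : Fin n → ℝ) (LA LB : ℝ) : ℝ := max (⨆ i, Ls i) (max LA LB)

/-- The stochastic gradient `G i x ξ` of `f i`, with `ξ` distributed as `D i`, is unbiased with
variance at most `σ ^ 2`, at every point. -/
structure StochasticGradients {n d : ℕ} {Ξ : Type*} [MeasurableSpace Ξ] (f : Fin n → Vec d → ℝ)
    (D : Fin n → Measure Ξ) (G : Fin n → Vec d → Ξ → Vec d) (σ : ℝ) : Prop where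
  prob : ∀ i, IsProbabilityMeasure (D i)
  measurable : ∀ i, Measurable fun q : Vec d × Ξ => G i q.1 q.2
  integrable : ∀ i x, Integrable (G i x) (D i)
  unbiased : ∀ i x, ∫ ξ, G i x ξ ∂(D i) = ∇ (f i) x
  sq_integrable : ∀ i x, Integrable (fun ξ => ‖G i x ξ - ∇ (f i) x‖ ^ 2) (D i)
  variance_le : ∀ i x, ∫ ξ, ‖G i x ξ - ∇ (f i) x‖ ^ 2 ∂(D i) ≤ σ ^ 2

/-- The random point `X` is an `ε`-stationary point of `f`: `𝔼 ‖∇ f X‖² ≤ ε`. -/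
def IsStationaryPoint {d : ℕ} {Ω : Type*} [MeasurableSpace Ω] (f : Vec d → ℝ) (ε : ℝ)
    (P : Measure Ω) (X : Ω → Vec d) : Prop :=
  AEMeasurable X P ∧ Integrable (fun a => ‖∇ f (X a)‖ ^ 2) P ∧ ∫ a, ‖∇ f (X a)‖ ^ 2 ∂P ≤ ε

/-! ### The method -/

/-- The Rand`K` sparsifier with selected coordinate set `S`: `(d/K) ∑ j ∈ S, x j • e j`. -/
def randK {d : ℕ} (K : ℕ) (S : Finset (Fin d)) (x : Vec d) : Vec d :=
  ((d : ℝ) / K) • ∑ j ∈ S, EuclideanSpace.single j (x j)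

/-- Parameters of M4: step size, the probabilities `pDown` (`p_s`) and `pUp` (`p`) of
sending uncompressed vectors from and to the server, momenta, batch sizes, and the numbers of
coordinates kept by the Rand`K` compressors of the server (`kDown`) and of the workers (`kUp`). -/
structure Params where
  γ : ℝ
  pDown : ℝ
  pUp : ℝ
  μ : ℝ
  ν : ℝ
  b : ℕ
  bInit : ℕ
  kDown : ℕ
  kUp : ℕ

/-- The variables `x`, `w i`, `x_i` (called `y i` here), `v i`, `g` of M4. -/
structure State (n d : ℕ) where
  x : Vec d
  w : Fin n → Vec d
  y : Fin n → Vec d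
  v : Fin n → Vec d
  g : Vec d

/-- Average of `m` stochastic gradients `G x (ξ 0), …, G x (ξ (m - 1))`. -/
def miniBatch {d : ℕ} {Ξ : Type*} (G : Vec d → Ξ → Vec d) (m : ℕ) (x : Vec d) (ξ : ℕ → Ξ) :
    Vec d :=
  (m : ℝ)⁻¹ • ∑ r ∈ Finset.range m, G x (ξ r)

/-- Initialization: `w i = x_i = x⁰`, `v i` a minibatch of size `bInit` at `x⁰`, `g` their mean. -/
def init {n d : ℕ} {Ξ : Type*} (G : Fin n → Vec d → Ξ → Vec d) (θ : Params) (x₀ : Vec d)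
    (ξ : Fin n → ℕ → Ξ) : State n d where
  x := x₀
  w := fun _ => x₀
  y := fun _ => x₀
  v := fun i => miniBatch (G i) θ.bInit x₀ (ξ i)
  g := mean fun i => miniBatch (G i) θ.bInit x₀ (ξ i)

/-- One iteration of M4, given the outcomes of the two coins, of the coordinate sets of the
compressors, and of the fresh samples. -/
def step {n d : ℕ} {Ξ : Type*} (G : Fin n → Vec d → Ξ → Vec d) (θ : Params)
    (cDown cUp : Bool) (sDown sUp : Fin n → Finset (Fin d)) (ξ : Fin n → ℕ → Ξ)
    (s : State n d) : State n d :=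
  let x' : Vec d := s.x - θ.γ • s.g
  let w' : Fin n → Vec d := fun i =>
    if cDown then x' else s.w i + randK θ.kDown (sDown i) (x' - s.x)
  let y' : Fin n → Vec d := fun i => (1 - θ.μ) • s.y i + θ.μ • w' i
  let v' : Fin n → Vec d := fun i =>
    (1 - θ.ν) • s.v i + θ.ν • miniBatch (G i) θ.b (y' i) (ξ i)
  let g' : Vec d :=
    if cUp then mean v' else s.g + mean fun i => randK θ.kUp (sUp i) (v' i - s.v i)
  { x := x', w := w', y := y', v := v', g := g' }

/-- All random draws of a run. `sample k i r` is the `r`-th sample of worker `i` in round `k`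
(round `0` is the initialization and round `k + 1` is iteration `k`); `downSet k i` and
`upSet k i` are the coordinate sets of the server's and of worker `i`'s compressor in iteration
`k`; the two coins of iteration `k` are common to all workers. -/
structure Draws (Ω Ξ : Type*) (n d : ℕ) where
  sample : ℕ → Fin n → ℕ → Ω → Ξ
  downSet : ℕ → Fin n → Ω → Finset (Fin d)
  upSet : ℕ → Fin n → Ω → Finset (Fin d)
  downCoin : ℕ → Ω → Bool
  upCoin : ℕ → Ω → Bool

/-- Names of the individual draws. -/
inductive DrawIndex (n : ℕ) : Type
  | sample (k : ℕ) (i : Fin n) (r : ℕ)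
  | downSet (k : ℕ) (i : Fin n)
  | upSet (k : ℕ) (i : Fin n)
  | downCoin (k : ℕ)
  | upCoin (k : ℕ)

/-- The σ-algebra generated by an individual draw. -/
@[reducible]
def Draws.sigma {Ω Ξ : Type*} [MeasurableSpace Ξ] {n d : ℕ} (R : Draws Ω Ξ n d) :
    DrawIndex n → MeasurableSpace Ω
  | .sample k i r => MeasurableSpace.comap (R.sample k i r) inferInstance
  | .downSet k i => MeasurableSpace.comap (R.downSet k i) ⊤
  | .upSet k i => MeasurableSpace.comap (R.upSet k i) ⊤
  | .downCoin k => MeasurableSpace.comap (R.downCoin k) ⊤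
  | .upCoin k => MeasurableSpace.comap (R.upCoin k) ⊤

/-- `S` is a uniformly distributed random subset of `Fin d` with `K` elements. -/
def IsUniformSubset {Ω : Type*} [MeasurableSpace Ω] {d : ℕ} (P : Measure Ω) (K : ℕ)
    (S : Ω → Finset (Fin d)) : Prop :=
  ∀ A : Finset (Fin d), MeasurableSet {a | S a = A} ∧
    P.real {a | S a = A} = if A.card = K then ((d.choose K : ℕ) : ℝ)⁻¹ else 0

/-- `c` is a Bernoulli variable that is `true` with probability `p`. -/
def IsCoin {Ω : Type*} [MeasurableSpace Ω] (P : Measure Ω) (p : ℝ) (c : Ω → Bool) : Prop :=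
  Measurable c ∧ P.real {a | c a = true} = p

/-- The draws have the prescribed laws and are mutually independent. -/
structure Draws.IsAdmissible {Ω Ξ : Type*} [MeasurableSpace Ω] [MeasurableSpace Ξ] {n d : ℕ}
    (R : Draws Ω Ξ n d) (P : Measure Ω) (D : Fin n → Measure Ξ) (θ : Params) : Prop where
  sample_measurable : ∀ k i r, Measurable (R.sample k i r)
  sample_law : ∀ k i r, P.map (R.sample k i r) = D i
  downSet_law : ∀ k i, IsUniformSubset P θ.kDown (R.downSet k i)
  upSet_law : ∀ k i, IsUniformSubset P θ.kUp (R.upSet k i)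
  downCoin_law : ∀ k, IsCoin P θ.pDown (R.downCoin k)
  upCoin_law : ∀ k, IsCoin P θ.pUp (R.upCoin k)
  indep : iIndep R.sigma P

/-- The state of M4 before iteration `k`, started at `x₀`. -/
def run {n d : ℕ} {Ω Ξ : Type*} (G : Fin n → Vec d → Ξ → Vec d) (θ : Params) (x₀ : Vec d)
    (R : Draws Ω Ξ n d) : ℕ → Ω → State n d
  | 0, a => init G θ x₀ fun i r => R.sample 0 i r a
  | k + 1, a =>
      step G θ (R.downCoin k a) (R.upCoin k a) (fun i => R.downSet k i a)
        (fun i => R.upSet k i a) (fun i r => R.sample (k + 1) i r a) (run G θ x₀ R k a)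

/-- The output of `K` iterations: on the product of the probability space of the run with a
uniform index in `{0, …, K - 1}`, the iterate `x^index`. -/
def output {n d : ℕ} {Ω Ξ : Type*} (G : Fin n → Vec d → Ξ → Vec d) (θ : Params) (x₀ : Vec d)
    (R : Draws Ω Ξ n d) : Ω × ℕ → Vec d :=
  fun q => (run G θ x₀ R q.2 q.1).x

/-! ### The time model -/

/-- Durations in seconds of the elementary operations: `comp k i r` for worker `i` computing its
`r`-th stochastic gradient of round `k` (rounds as in `Draws`), `down k i j` and `up k i j` for the
transmission of the `j`-th coordinate that is sent to, respectively by, worker `i` in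
iteration `k`. -/
structure Durations (Ω : Type*) (n : ℕ) where
  comp : ℕ → Fin n → ℕ → Ω → ℝ
  down : ℕ → Fin n → ℕ → Ω → ℝ
  up : ℕ → Fin n → ℕ → Ω → ℝ

/-- `X` is a random duration of at most `c` seconds. -/
def IsDuration {Ω : Type*} [MeasurableSpace Ω] (X : Ω → ℝ) (c : ℝ) : Prop :=
  Measurable X ∧ ∀ a, 0 ≤ X a ∧ X a ≤ c

/-- A stochastic gradient takes at most `h` seconds, a coordinate at most `κ` seconds from the
server to a worker and at most `τ` seconds from a worker to the server. -/
def Durations.Bounded {Ω : Type*} [MeasurableSpace Ω] {n : ℕ} (T : Durations Ω n)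
    (h τ κ : ℝ) : Prop :=
  ∀ k i j, IsDuration (T.comp k i j) h ∧ IsDuration (T.down k i j) κ ∧
    IsDuration (T.up k i j) τ

/-- Number of coordinates in a message: all `d` of them if the coin shows `true`, else `K`. -/
def coordsSent (d K : ℕ) (c : Bool) : ℕ := if c then d else K

/-- Time of the initial minibatches, which the workers compute in parallel. -/
def initTime {Ω : Type*} {n : ℕ} (θ : Params) (T : Durations Ω n) (a : Ω) : ℝ :=
  ⨆ i, ∑ r ∈ Finset.range θ.bInit, T.comp 0 i r a

/-- Time of iteration `k`: every worker receives its message, computes `b` stochastic gradients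
and sends its message; the workers operate in parallel and the server waits for the last one. -/
def iterTime {Ω Ξ : Type*} {n d : ℕ} (θ : Params) (R : Draws Ω Ξ n d) (T : Durations Ω n)
    (k : ℕ) (a : Ω) : ℝ :=
  ⨆ i, (∑ j ∈ Finset.range (coordsSent d θ.kDown (R.downCoin k a)), T.down k i j a
    + ∑ r ∈ Finset.range θ.b, T.comp (k + 1) i r a
    + ∑ j ∈ Finset.range (coordsSent d θ.kUp (R.upCoin k a)), T.up k i j a)

/-- Time of the initial minibatches and of the first `K` iterations. -/
def totalTime {Ω Ξ : Type*} {n d : ℕ} (θ : Params) (R : Draws Ω Ξ n d) (T : Durations Ω n)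
    (K : ℕ) (a : Ω) : ℝ :=
  initTime θ T a + ∑ k ∈ Finset.range K, iterTime θ R T k a

/-! ### The choice of the parameters -/

/-- The time budget `t = max {h, τ, κ, (d² τ² h σ² / (n ε))^(1/3)}`. -/
def budget (n d : ℕ) (h τ κ σ ε : ℝ) : ℝ :=
  max (max h (max τ κ)) (((d : ℝ) ^ 2 * τ ^ 2 * h * σ ^ 2 / (n * ε)) ^ (1 / 3 : ℝ))

/-- Number of coordinates kept by Rand`K` if one coordinate takes `c` seconds and the budget is
`t`. Rand`K` keeps at most all `d` coordinates. -/
def coords (d : ℕ) (t c : ℝ) : ℕ := min ⌊t / c⌋₊ d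

/-- The variance parameter `ω = d/K - 1` of Rand`K`. -/
def omega (d K : ℕ) : ℝ := (d : ℝ) / K - 1

/-- The momentum
`η = min {(1/6) √(b n ε / (ω (ω+1) σ²)), b n ε / (6 σ²), (n / (ω (ω+1) ω_s))^(1/3), 1}`,
written as the inverse of the maximum of the reciprocals, so that an entry with denominator `0`
counts as `+∞`. -/
def momentum (n b : ℕ) (σ ε ω ωs : ℝ) : ℝ :=
  (max (max (6 * √(ω * (ω + 1) * σ ^ 2 / (b * n * ε))) (6 * σ ^ 2 / (b * n * ε)))
    (max ((ω * (ω + 1) * ωs / n) ^ (1 / 3 : ℝ)) 1))⁻¹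

/-- The parameters of M4 with Rand`K` compressors, for step size `γ` and initial batch size
`bInit`. -/
def tuned (n d : ℕ) (h τ κ σ ε γ : ℝ) (bInit : ℕ) : Params :=
  let t := budget n d h τ κ σ ε
  let ω := omega d (coords d t τ)
  let ωs := omega d (coords d t κ)
  let η := momentum n ⌊t / h⌋₊ σ ε ω ωs
  { γ := γ
    pDown := 1 / (ωs + 1)
    pUp := 1 / (ω + 1)
    μ := η
    ν := η
    b := ⌊t / h⌋₊
    bInit := bInit
    kDown := coords d t κ
    kUp := coords d t τ }

/-- `√((b/ν) (1 + σ² / (n ε)))`, the order of the initial batch size. -/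
def initBatchScale (n : ℕ) (σ ε : ℝ) (θ : Params) : ℝ :=
  √((θ.b : ℝ) / θ.ν * (1 + σ ^ 2 / (n * ε)))

/-- The order of `1 / γ`, namely
`√(ω_s (ω_s+1) LA² + (ω_s/n) (ω_s+1) LB² + (ω (ω+1) / n + 1/η²) Lmax²)`. -/
def invStepScale (n d : ℕ) (LA LB LM : ℝ) (θ : Params) : ℝ :=
  let ω := omega d θ.kUp
  let ωs := omega d θ.kDown
  √(ωs * (ωs + 1) * LA ^ 2 + ωs / n * (ωs + 1) * LB ^ 2
    + (ω * (ω + 1) / n + 1 / θ.ν ^ 2) * LM ^ 2)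

/-- The claimed time complexity, without the constant. -/
def timeBound (n d : ℕ) (h τ κ σ ε Δ LA LM : ℝ) : ℝ :=
  max (max (max h τ) (max κ (d * κ / √n)))
      (max (max (d * τ / √n) (((d : ℝ) ^ 3 * τ ^ 2 * κ / n) ^ (1 / 3 : ℝ)))
        (max (((d : ℝ) ^ 2 * τ ^ 2 * h * σ ^ 2 / (n * ε)) ^ (1 / 3 : ℝ)) (σ ^ 2 * h / (n * ε))))
    * (LM * Δ / ε)
  + d * κ * LA * Δ / ε

end M4

end

namespace M4

/-! ### Scalar recursions -/

/-! The descent lemma with step `γ` bounds f(x^{k+1}) by f(x^k) − (γ/2)‖∇f(x^k)‖² − (1/(2γ) −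
L/2)‖x^{k+1} − x^k‖² plus γ times two errors: `G`, the distance of g from the mean of the v_i, and
`e`, the distance of that mean from ∇f(x^k). It suffices to bound the sums of the expected `G` and
`e` over the run by noise plus a multiple of Λ² times the sum of X_k = 𝔼‖x^{k+1} − x^k‖². Once γΛ ≤
1/20 the negative X term absorbs this multiple, and Σ 𝔼‖∇f(x^k)‖² ≤ 2Δ/γ + noise remains
(`EnergyRecursion.sum_N_le`).

No Lyapunov function is needed. Every auxiliary energy contracts geometrically and is driven by X,
by sampling noise and by energies already controlled, so the recursions can be summed over k and
chained. The lag `W` of the w_i behind x forgets at rate 1/(ω_s+1), and the local iterates follow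
the w_i at rate η. In `e` the lag of the local iterates enters through the similarity inequality, so
the server's compression is paid for in L_A and L_B and not in L_max. The error `G` is driven by the
change `V` of the v_i, hence by `Q`, the distance from the new w_i to the old local iterate. The
conditional mean drift of this distance contributes only the order of X after summation, and ω_s
enters only through fluctuations; thus ΣQ ≲ (1/η² + ω_s/η) ΣX, and the cube root entry of η makes
the ω_s/η part harmless.

The recursions come from integrating out the draws of one iteration in the order of their use,
conditionally on the past (`integrable_and_integral_le_of_indepFun` and the stage lemmas of
`Setting`).

For the time, let t be the budget and M the maximum in the claim. The roundings lose factors of 2,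
and the coin probabilities make the expected message at most twice a compressed one, so an iteration
costs at most 5t in expectation. There are about Δ/(γε), hence about ΛΔ/ε iterations, and tΛ ≤
2dκL_A + 33 M L_max (`budget_mul_invStepScale_le`). The one-off costs are of order M; they are
absorbed because a point that is not ε-stationary has ε ≤ 2L_maxΔ. -/

theorem sum_le_of_contraction {a r : ℕ → ℝ} {ρ : ℝ}
    (h : ∀ k, a (k + 1) ≤ (1 - ρ) * a k + r k) (K : ℕ) :
    ρ * ∑ k ∈ Finset.range K, a k + a K ≤ a 0 + ∑ k ∈ Finset.range K, r k := by
  induction K with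
  | zero => simp
  | succ K ih =>
    rw [Finset.sum_range_succ, Finset.sum_range_succ]
    linarith [h K]

theorem sum_succ_le_of_contraction {a r : ℕ → ℝ} {ρ : ℝ} (hρ : 0 ≤ ρ) (hρ' : ρ ≤ 1)
    (ha : ∀ k, 0 ≤ a k) (h : ∀ k, a (k + 1) ≤ (1 - ρ) * a k + r k) (K : ℕ) :
    ρ * ∑ k ∈ Finset.range K, a (k + 1) ≤ a 0 + ∑ k ∈ Finset.range K, r k := by
  have h1 := sum_le_of_contraction h K
  have h2 : ∑ k ∈ Finset.range K, a (k + 1) = ∑ k ∈ Finset.range K, a k + a K - a 0 := by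
    rw [← Finset.sum_range_succ, Finset.sum_range_succ']
    ring
  rw [h2]
  nlinarith [ha K, ha 0]

/-- The extremal solution started at 0. Comparison with it separates the effect of the driving terms
from that of the initial value. -/
theorem exists_contraction {r : ℕ → ℝ} {ρ : ℝ} (hρ : ρ ≤ 1) (hr : ∀ k, 0 ≤ r k) :
    ∃ a : ℕ → ℝ, a 0 = 0 ∧ ∀ k, 0 ≤ a k ∧ a (k + 1) = (1 - ρ) * a k + r k := by
  refine ⟨fun k => Nat.rec 0 (fun k a => (1 - ρ) * a + r k) k, rfl, fun k => ⟨?_, rfl⟩⟩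
  induction k with
  | zero => exact le_rfl
  | succ k ih => exact add_nonneg (mul_nonneg (sub_nonneg.2 hρ) ih) (hr k)

/-- The recursive inequalities between the expected energies of the iterates of M4. Here `ς` is
the variance of a minibatch of a single worker. -/
structure EnergyRecursion (n ω ωs η γ L LA LB ς : ℝ)
    (X N F W Wb Y Yb Q Z e E V G : ℕ → ℝ) : Prop where
  X_nonneg : ∀ k, 0 ≤ X k
  W_nonneg : ∀ k, 0 ≤ W k
  Wb_nonneg : ∀ k, 0 ≤ Wb k
  Y_nonneg : ∀ k, 0 ≤ Y k
  Yb_nonneg : ∀ k, 0 ≤ Yb k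
  Z_nonneg : ∀ k, 0 ≤ Z k
  Q_nonneg : ∀ k, 0 ≤ Q k
  e_nonneg : ∀ k, 0 ≤ e k
  E_nonneg : ∀ k, 0 ≤ E k
  F_nonneg : ∀ k, 0 ≤ F k
  W_zero : W 0 = 0
  Wb_zero : Wb 0 = 0
  Y_zero : Y 0 = 0
  Yb_zero : Yb 0 = 0
  Z_zero : Z 0 = 0
  G_zero : G 0 = 0
  W_succ : ∀ k, W (k + 1) ≤ (1 - 1 / (ωs + 1)) * (W k + ωs * X k)
  Wb_succ : ∀ k, Wb (k + 1) ≤ (1 - 1 / (ωs + 1)) * (Wb k + ωs / n * X k)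
  Y_succ : ∀ k, Y (k + 1) ≤ (1 - η / 2) * Y k + (3 / η * X k + η * W (k + 1))
  Yb_succ : ∀ k, Yb (k + 1) ≤ (1 - η / 2) * Yb k + (3 / η * X k + η * Wb (k + 1))
  Q_le : ∀ k, Q k ≤ (1 + η) * Z k + ((1 + 1 / η) * (2 * X k + 2 * (1 / (ωs + 1)) ^ 2 * W k)
    + 1 / (ωs + 1) * W k + ωs * X k)
  Z_succ : ∀ k, Z (k + 1) ≤ (1 - η) ^ 2 * Q k
  e_succ : ∀ k, e (k + 1) ≤ (1 - η) * e k + (2 / η * L ^ 2 * X k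
    + 4 * η * (LA ^ 2 * Y (k + 1) + LB ^ 2 * Yb (k + 1)) + η ^ 2 * ς / n)
  E_succ : ∀ k, E (k + 1) ≤ (1 - η) * E k + (η * L ^ 2 * Q k + η ^ 2 * ς)
  V_le : ∀ k, V k ≤ η ^ 2 * ς + 2 * η ^ 2 * E k + 2 * η ^ 4 * L ^ 2 * Q k
  G_succ : ∀ k, G (k + 1) ≤ (1 - 1 / (ω + 1)) * (G k + ω / n * V k)
  F_succ : ∀ k, F (k + 1) + γ / 2 * N k + (1 / (2 * γ) - L / 2) * X k
    ≤ F k + γ * (G k + e k)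

/-! ### Summed energy bounds -/

namespace EnergyRecursion

variable {n ω ωs η γ L LA LB ς : ℝ} {X N F W Wb Y Yb Q Z e E V G : ℕ → ℝ}

/-- An error that is reset with probability 1/(ω_s+1) lives for about ω_s+1 iterations, so each
contribution c X_k is counted that often. Used with c = ω_s for `W` and c = ω_s/n for `Wb`; the
shifted sum is the one that drives the local iterates. -/
theorem sum_memory_le {c : ℝ} {U : ℕ → ℝ} (hωs : 0 ≤ ωs) (hc : 0 ≤ c) (hX : ∀ k, 0 ≤ X k)
    (hU : ∀ k, 0 ≤ U k) (h0 : U 0 = 0)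
    (h : ∀ k, U (k + 1) ≤ (1 - 1 / (ωs + 1)) * (U k + c * X k)) (K : ℕ) :
    ∑ k ∈ Finset.range K, U k ≤ c * (ωs + 1) * ∑ k ∈ Finset.range K, X k ∧
    ∑ k ∈ Finset.range K, U (k + 1) ≤ c * (ωs + 1) * ∑ k ∈ Finset.range K, X k := by
  have hp : (0 : ℝ) < ωs + 1 := by linarith
  have hp1 : 1 / (ωs + 1) ≤ 1 := by rw [div_le_one hp]; linarith
  have hp0 : 0 ≤ 1 / (ωs + 1) := by positivity
  have h' : ∀ k, U (k + 1) ≤ (1 - 1 / (ωs + 1)) * U k + c * X k := fun k => by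
    have := mul_nonneg hp0 (mul_nonneg hc (hX k))
    linarith [h k]
  have h1 := sum_le_of_contraction h' K
  have h2 := sum_succ_le_of_contraction hp0 hp1 hU h' K
  rw [h0, zero_add, ← Finset.mul_sum] at h1 h2
  constructor
  · have h3 : 1 / (ωs + 1) * ∑ k ∈ Finset.range K, U k ≤ c * ∑ k ∈ Finset.range K, X k := by
      linarith [hU K]
    rw [div_mul_eq_mul_div, one_mul, div_le_iff₀ hp] at h3
    linarith
  · rw [div_mul_eq_mul_div, one_mul, div_le_iff₀ hp] at h2
    linarith

/-- Following at rate η/2 multiplies a driving term by 2/η: a move of x costs 3/η · 2/η = 6/η², and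
the lag of the target costs η · 2/η = 2. -/
theorem sum_local_le {U T : ℕ → ℝ} {c : ℝ} (hη : 0 < η) (hη1 : η ≤ 1)
    (hU : ∀ k, 0 ≤ U k) (h0 : U 0 = 0)
    (h : ∀ k, U (k + 1) ≤ (1 - η / 2) * U k + (3 / η * X k + η * T k)) (K : ℕ)
    (hT : ∑ k ∈ Finset.range K, T k ≤ c * ∑ k ∈ Finset.range K, X k) :
    ∑ k ∈ Finset.range K, U (k + 1) ≤ (6 / η ^ 2 + 2 * c) * ∑ k ∈ Finset.range K, X k := by
  have h2 := sum_succ_le_of_contraction (by linarith) (by linarith) hU h K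
  rw [h0, zero_add, Finset.sum_add_distrib, ← Finset.mul_sum, ← Finset.mul_sum] at h2
  have h3 : η / 2 * ∑ k ∈ Finset.range K, U (k + 1)
      ≤ η / 2 * ((6 / η ^ 2 + 2 * c) * ∑ k ∈ Finset.range K, X k) := by
    have e1 : η / 2 * ((6 / η ^ 2 + 2 * c) * ∑ k ∈ Finset.range K, X k)
        = 3 / η * ∑ k ∈ Finset.range K, X k + η * (c * ∑ k ∈ Finset.range K, X k) := by
      field_simp
      ring
    rw [e1]
    have := mul_le_mul_of_nonneg_left hT hη.le
    linarith
  exact le_of_mul_le_mul_left h3 (by positivity)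

/-- By the bound on ΣW, the terms p_s W and p_s² W sum to at most ω_s ΣX and ΣX respectively. Only
the drift p_s² W carries the factor 1/η of Young's inequality before summation, which keeps ω_s² out
of the result. -/
theorem sum_Q_le (H : EnergyRecursion n ω ωs η γ L LA LB ς X N F W Wb Y Yb Q Z e E V G)
    (hωs : 0 ≤ ωs) (hη : 0 < η) (hη1 : η ≤ 1) (K : ℕ) :
    ∑ k ∈ Finset.range K, Q k ≤ (16 / η ^ 2 + 6 * ωs / η) * ∑ k ∈ Finset.range K, X k := by
  have hW := (sum_memory_le hωs hωs H.X_nonneg H.W_nonneg H.W_zero H.W_succ K).1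
  have hp : (0 : ℝ) < ωs + 1 := by linarith
  set SX := ∑ k ∈ Finset.range K, X k with hSX
  set SW := ∑ k ∈ Finset.range K, W k with hSW
  set SZ := ∑ k ∈ Finset.range K, Z k with hSZ
  have hSX0 : 0 ≤ SX := Finset.sum_nonneg fun k _ => H.X_nonneg k
  have hSZ0 : 0 ≤ SZ := Finset.sum_nonneg fun k _ => H.Z_nonneg k
  have hpW : 1 / (ωs + 1) * SW ≤ ωs * SX := by
    rw [div_mul_eq_mul_div, one_mul, div_le_iff₀ hp]
    linarith
  have hppW : (1 / (ωs + 1)) ^ 2 * SW ≤ SX := by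
    rw [div_pow, one_pow, div_mul_eq_mul_div, one_mul, div_le_iff₀ (by positivity)]
    nlinarith
  have hr : (1 + 1 / η) * (2 * SX + 2 * (1 / (ωs + 1)) ^ 2 * SW)
      + 1 / (ωs + 1) * SW + ωs * SX ≤ (8 / η + 2 * ωs) * SX := by
    have h1 : 1 + 1 / η ≤ 2 / η := by
      rw [le_div_iff₀ hη, add_mul, div_mul_cancel₀ _ hη.ne']
      linarith
    have h2 : 2 * SX + 2 * (1 / (ωs + 1)) ^ 2 * SW ≤ 4 * SX := by linarith
    have h3 : (1 + 1 / η) * (2 * SX + 2 * (1 / (ωs + 1)) ^ 2 * SW) ≤ 2 / η * (4 * SX) := by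
      apply mul_le_mul h1 h2 _ (by positivity)
      have : 0 ≤ SW := Finset.sum_nonneg fun k _ => H.W_nonneg k
      positivity
    have h4 : 2 / η * (4 * SX) = 8 / η * SX := by ring
    linarith
  have hsum : ∑ k ∈ Finset.range K, ((1 + 1 / η) * (2 * X k + 2 * (1 / (ωs + 1)) ^ 2 * W k)
      + 1 / (ωs + 1) * W k + ωs * X k) = (1 + 1 / η) * (2 * SX + 2 * (1 / (ωs + 1)) ^ 2 * SW)
      + 1 / (ωs + 1) * SW + ωs * SX := by
    simp only [Finset.sum_add_distrib, ← Finset.mul_sum, hSX, hSW]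
  have hQ : ∑ k ∈ Finset.range K, Q k ≤ (1 + η) * SZ + (8 / η + 2 * ωs) * SX := by
    have := Finset.sum_le_sum fun k (_ : k ∈ Finset.range K) => H.Q_le k
    rw [Finset.sum_add_distrib, ← Finset.mul_sum, hsum] at this
    linarith
  -- Elimination of `Q`: the factor (1 − η)² from the local update pays for the 1 + η of Young's
  -- inequality and leaves the contraction 1 − η.
  have hZ : ∀ k, Z (k + 1) ≤ (1 - η) * Z k + (1 - η) ^ 2 *
      ((1 + 1 / η) * (2 * X k + 2 * (1 / (ωs + 1)) ^ 2 * W k)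
        + 1 / (ωs + 1) * W k + ωs * X k) := fun k => by
    have h1 := mul_le_mul_of_nonneg_left (H.Q_le k) (sq_nonneg (1 - η))
    have h2 : (1 - η) ^ 2 * ((1 + η) * Z k) ≤ (1 - η) * Z k := by
      have : (1 - η) ^ 2 * (1 + η) ≤ 1 - η := by nlinarith [mul_nonneg hη.le (sub_nonneg.2 hη1)]
      have := mul_le_mul_of_nonneg_right this (H.Z_nonneg k)
      linarith
    linarith [H.Z_succ k]
  have h1 := sum_le_of_contraction hZ K
  rw [H.Z_zero, zero_add, ← Finset.mul_sum, hsum] at h1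
  have h2 : η * SZ ≤ (4 / η + 2 * ωs) * SX := by
    have h3 : (1 - η) ^ 2 * (1 + 1 / η) ≤ 1 / η := by
      rw [le_div_iff₀ hη, mul_assoc, add_mul, div_mul_cancel₀ _ hη.ne']
      nlinarith [mul_nonneg hη.le (sub_nonneg.2 hη1)]
    have h4 : (1 - η) ^ 2 ≤ 1 := by nlinarith
    have h5 : (1 - η) ^ 2 * ((1 + 1 / η) * (2 * SX + 2 * (1 / (ωs + 1)) ^ 2 * SW)
        + 1 / (ωs + 1) * SW + ωs * SX) ≤ 1 / η * (4 * SX) + 1 * (2 * ωs * SX) := by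
      have hSW0 : 0 ≤ SW := Finset.sum_nonneg fun k _ => H.W_nonneg k
      have a1 : (1 - η) ^ 2 * (1 + 1 / η) * (2 * SX + 2 * (1 / (ωs + 1)) ^ 2 * SW)
          ≤ 1 / η * (4 * SX) := by
        apply mul_le_mul h3 (by linarith) (by positivity) (by positivity)
      have a2 : (1 - η) ^ 2 * (1 / (ωs + 1) * SW + ωs * SX) ≤ 1 * (2 * ωs * SX) := by
        apply mul_le_mul h4 (by linarith) (by positivity) (by positivity)
      linarith
    have h6 : 1 / η * (4 * SX) = 4 / η * SX := by ring
    linarith [H.Z_nonneg K]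
  have h3 : η * ((16 / η ^ 2 + 6 * ωs / η) * SX)
      = 2 * ((4 / η + 2 * ωs) * SX) + (8 / η + 2 * ωs) * SX := by
    field_simp
    ring
  refine hQ.trans (le_of_mul_le_mul_left ?_ hη)
  rw [h3]
  have h4 : η * ((1 + η) * SZ) ≤ 2 * (η * SZ) := by nlinarith [mul_nonneg hη.le hSZ0]
  have h5 : 0 ≤ (8 / η + 2 * ωs) * SX := by positivity
  have h6 : η * ((8 / η + 2 * ωs) * SX) ≤ (8 / η + 2 * ωs) * SX := by nlinarith
  linarith

/-- The lag of the local iterates has a part 6/η² that is due to motion, where L_A and L_B may be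
replaced by L, and a part due to server compression, where they are kept. The constants are 50 = 2 +
4·(6 + 6) and 8 = 4·2. -/
theorem sum_e_le (H : EnergyRecursion n ω ωs η γ L LA LB ς X N F W Wb Y Yb Q Z e E V G)
    (hn : 0 < n) (hωs : 0 ≤ ωs) (hη : 0 < η) (hη1 : η ≤ 1) (hA0 : 0 ≤ LA) (hB0 : 0 ≤ LB)
    (hA : LA ≤ L) (hB : LB ≤ L) (K : ℕ) :
    ∑ k ∈ Finset.range K, e k ≤ e 0 / η + K * (η * ς / n)
      + (50 / η ^ 2 * L ^ 2 + 8 * (ωs * (ωs + 1) * LA ^ 2 + ωs / n * (ωs + 1) * LB ^ 2))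
        * ∑ k ∈ Finset.range K, X k := by
  have hW := (sum_memory_le hωs hωs H.X_nonneg H.W_nonneg H.W_zero H.W_succ K).2
  have hWb := (sum_memory_le hωs (div_nonneg hωs hn.le) H.X_nonneg H.Wb_nonneg H.Wb_zero
    H.Wb_succ K).2
  have hY := sum_local_le hη hη1 H.Y_nonneg H.Y_zero H.Y_succ K hW
  have hYb := sum_local_le hη hη1 H.Yb_nonneg H.Yb_zero H.Yb_succ K hWb
  have h1 := sum_le_of_contraction H.e_succ K
  simp only [Finset.sum_add_distrib, ← Finset.mul_sum, Finset.sum_const, Finset.card_range,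
    nsmul_eq_mul] at h1
  set SX := ∑ k ∈ Finset.range K, X k with hSX
  have hSX0 : 0 ≤ SX := Finset.sum_nonneg fun k _ => H.X_nonneg k
  have hLA : LA ^ 2 ≤ L ^ 2 := by nlinarith
  have hLB : LB ^ 2 ≤ L ^ 2 := by nlinarith
  have h2 := mul_le_mul_of_nonneg_left hY (sq_nonneg LA)
  have h3 := mul_le_mul_of_nonneg_left hYb (sq_nonneg LB)
  have h4 : 6 / η ^ 2 * SX * LA ^ 2 ≤ 6 / η ^ 2 * SX * L ^ 2 :=
    mul_le_mul_of_nonneg_left hLA (by positivity)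
  have h5 : 6 / η ^ 2 * SX * LB ^ 2 ≤ 6 / η ^ 2 * SX * L ^ 2 :=
    mul_le_mul_of_nonneg_left hLB (by positivity)
  have h6 : LA ^ 2 * ∑ k ∈ Finset.range K, Y (k + 1) + LB ^ 2 * ∑ k ∈ Finset.range K, Yb (k + 1)
      ≤ 12 / η ^ 2 * L ^ 2 * SX
        + 2 * (ωs * (ωs + 1) * LA ^ 2 + ωs / n * (ωs + 1) * LB ^ 2) * SX := by
    have : 12 / η ^ 2 * L ^ 2 * SX = 6 / η ^ 2 * SX * L ^ 2 + 6 / η ^ 2 * SX * L ^ 2 := by ring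
    linarith
  have h7 := mul_le_mul_of_nonneg_left h6 (show 0 ≤ 4 * η by positivity)
  refine le_of_mul_le_mul_left (a := η) ?_ hη
  have h8 : η * (e 0 / η + K * (η * ς / n)
      + (50 / η ^ 2 * L ^ 2 + 8 * (ωs * (ωs + 1) * LA ^ 2 + ωs / n * (ωs + 1) * LB ^ 2)) * SX)
      = e 0 + 2 / η * L ^ 2 * SX + 4 * η * (12 / η ^ 2 * L ^ 2 * SX
        + 2 * (ωs * (ωs + 1) * LA ^ 2 + ωs / n * (ωs + 1) * LB ^ 2) * SX)
        + K * (η ^ 2 * ς / n) := by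
    field_simp
    ring
  rw [h8]
  linarith [H.e_nonneg K]

/-- The initial noise `E 0` of the workers is treated apart from the rest. Its effect on `G` is
bounded uniformly in k, without the contraction of `G`, so that it costs ω per iteration and no
factor ω(ω+1); the lower bound on the initial batch size suffices for this term. -/
theorem sum_G_le (H : EnergyRecursion n ω ωs η γ L LA LB ς X N F W Wb Y Yb Q Z e E V G)
    (hn : 0 < n) (hω : 0 ≤ ω) (hωs : 0 ≤ ωs) (hη : 0 < η) (hη1 : η ≤ 1) (hς : 0 ≤ ς)
    (hcube : ω * (ω + 1) * ωs / n * η ^ 3 ≤ 1) (K : ℕ) :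
    ∑ k ∈ Finset.range K, G k ≤ K * (2 * ω / n * η * E 0)
      + K * (ω * (ω + 1) / n * (3 * η ^ 2 * ς))
      + (64 * (ω * (ω + 1) / n) + 24 / η ^ 2) * L ^ 2 * ∑ k ∈ Finset.range K, X k := by
  have hp : (0 : ℝ) < ω + 1 := by linarith
  have hp0 : 0 ≤ 1 / (ω + 1) := by positivity
  have hp1 : 1 / (ω + 1) ≤ 1 := by rw [div_le_one hp]; linarith
  have hQ := H.sum_Q_le hωs hη hη1 K
  have hωn : 0 ≤ ω / n := by positivity
  have hr : ∀ k, 0 ≤ η * L ^ 2 * Q k + η ^ 2 * ς := fun k => by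
    have := H.Q_nonneg k
    positivity
  obtain ⟨E', hE'0, hE'⟩ := exists_contraction hη1 hr
  have hEE' : ∀ k, E k ≤ E' k + (1 - η) ^ k * E 0 := fun k => by
    induction k with
    | zero => simp [hE'0]
    | succ k ih =>
      rw [(hE' k).2, pow_succ (1 - η) k]
      have := mul_le_mul_of_nonneg_left ih (sub_nonneg.2 hη1)
      linarith [H.E_succ k]
  set T : ℕ → ℝ := fun k => ω / n * (η ^ 2 * ς + 2 * η ^ 2 * E' k + 2 * η ^ 4 * L ^ 2 * Q k)
    with hT
  have hT0 : ∀ k, 0 ≤ T k := fun k => by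
    have := H.Q_nonneg k
    have := (hE' k).1
    positivity
  obtain ⟨G', hG'0, hG'⟩ := exists_contraction hp1 hT0
  -- The accumulated effect of `E 0` on `G`. The geometric series contributes 1/η, which turns η²
  -- into η.
  set D : ℕ → ℝ := fun k => ω / n * (2 * η ^ 2 * E 0) * ∑ j ∈ Finset.range k, (1 - η) ^ j with hD
  have hD0 : ∀ k, 0 ≤ D k := fun k => by
    have : 0 ≤ ∑ j ∈ Finset.range k, (1 - η) ^ j :=
      Finset.sum_nonneg fun j _ => pow_nonneg (by linarith) j
    have := H.E_nonneg 0
    positivity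
  have hDle : ∀ k, D k ≤ 2 * ω / n * η * E 0 := fun k => by
    have h0 := H.E_nonneg 0
    have h1 : D k = 2 * ω / n * η * E 0 * (η * ∑ j ∈ Finset.range k, (1 - η) ^ j) := by
      simp only [hD]; ring
    rw [h1]
    refine mul_le_of_le_one_right (by positivity) ?_
    have h2 := geom_sum_mul (1 - η) k
    have h3 : 0 ≤ (1 - η) ^ k := pow_nonneg (by linarith) k
    linarith
  have hGG' : ∀ k, G k ≤ G' k + D k := fun k => by
    induction k with
    | zero => simp [hG'0, H.G_zero, hD]
    | succ k ih =>
      have h1 : D (k + 1) = D k + ω / n * (2 * η ^ 2 * ((1 - η) ^ k * E 0)) := by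
        simp only [hD, Finset.sum_range_succ]; ring
      have h0 : 0 ≤ D k + ω / n * (2 * η ^ 2 * ((1 - η) ^ k * E 0)) := h1 ▸ hD0 (k + 1)
      have h2 : ω / n * V k ≤ T k + ω / n * (2 * η ^ 2 * ((1 - η) ^ k * E 0)) := by
        have h3 : V k ≤ η ^ 2 * ς + 2 * η ^ 2 * (E' k + (1 - η) ^ k * E 0)
            + 2 * η ^ 4 * L ^ 2 * Q k := by
          have := mul_le_mul_of_nonneg_left (hEE' k) (show 0 ≤ 2 * η ^ 2 by positivity)
          linarith [H.V_le k]
        have := mul_le_mul_of_nonneg_left h3 hωn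
        simp only [hT]
        linarith
      have h3 : G (k + 1) ≤ (1 - 1 / (ω + 1)) * (G' k + T k + (D k
          + ω / n * (2 * η ^ 2 * ((1 - η) ^ k * E 0)))) :=
        (H.G_succ k).trans (mul_le_mul_of_nonneg_left (by linarith) (by linarith))
      have h4 := mul_nonneg hp0 h0
      have h5 := mul_nonneg hp0 (hT0 k)
      rw [(hG' k).2, h1]
      linarith
  have h1 := sum_le_of_contraction (fun k => (hG' k).2.le) K
  have h2 := sum_le_of_contraction (fun k => (hE' k).2.le) K
  rw [hG'0, zero_add] at h1
  rw [hE'0, zero_add] at h2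
  simp only [hT, Finset.sum_add_distrib, ← Finset.mul_sum, Finset.sum_const,
    Finset.card_range, nsmul_eq_mul] at h1 h2
  have h3 : ∑ k ∈ Finset.range K, G k ≤ ∑ k ∈ Finset.range K, G' k
      + K * (2 * ω / n * η * E 0) := by
    calc ∑ k ∈ Finset.range K, G k
        ≤ ∑ k ∈ Finset.range K, (G' k + 2 * ω / n * η * E 0) :=
          Finset.sum_le_sum fun k _ => (hGG' k).trans (by linarith [hDle k])
      _ = _ := by simp [Finset.sum_add_distrib]
  set SX := ∑ k ∈ Finset.range K, X k
  set SQ := ∑ k ∈ Finset.range K, Q k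
  set SG := ∑ k ∈ Finset.range K, G' k
  set SE := ∑ k ∈ Finset.range K, E' k
  have hSX0 : 0 ≤ SX := Finset.sum_nonneg fun k _ => H.X_nonneg k
  have hSQ0 : 0 ≤ SQ := Finset.sum_nonneg fun k _ => H.Q_nonneg k
  have h4 : SE ≤ L ^ 2 * SQ + K * (η * ς) := by
    refine le_of_mul_le_mul_left (a := η) ?_ hη
    have : η * (L ^ 2 * SQ + K * (η * ς)) = η * L ^ 2 * SQ + K * (η ^ 2 * ς) := by ring
    linarith [(hE' K).1]
  have hη3 : η ^ 3 ≤ η ^ 2 := pow_le_pow_of_le_one hη.le hη1 (by norm_num)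
  have hη4 : η ^ 4 ≤ η ^ 2 := pow_le_pow_of_le_one hη.le hη1 (by norm_num)
  have h5 : K * (η ^ 2 * ς) + 2 * η ^ 2 * SE + 2 * η ^ 4 * L ^ 2 * SQ
      ≤ K * (3 * η ^ 2 * ς) + 4 * η ^ 2 * L ^ 2 * SQ := by
    have a1 := mul_le_mul_of_nonneg_left h4 (show 0 ≤ 2 * η ^ 2 by positivity)
    have a2 := mul_le_mul_of_nonneg_right hη4 (show 0 ≤ 2 * (L ^ 2 * SQ) by positivity)
    have a3 := mul_le_mul_of_nonneg_right hη3 (show 0 ≤ 2 * (K * ς) by positivity)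
    linarith
  have h6 : SG ≤ ω * (ω + 1) / n * (K * (3 * η ^ 2 * ς) + 4 * η ^ 2 * L ^ 2 * SQ) := by
    have a1 := mul_le_mul_of_nonneg_left h5 hωn
    have a2 : 1 / (ω + 1) * SG
        ≤ ω / n * (K * (3 * η ^ 2 * ς) + 4 * η ^ 2 * L ^ 2 * SQ) := by
      linarith [(hG' K).1]
    rw [div_mul_eq_mul_div, one_mul, div_le_iff₀ hp] at a2
    refine a2.trans (le_of_eq ?_)
    ring
  have h7 : 4 * η ^ 2 * L ^ 2 * SQ ≤ 4 * η ^ 2 * L ^ 2 * ((16 / η ^ 2 + 6 * ωs / η) * SX) :=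
    mul_le_mul_of_nonneg_left hQ (by positivity)
  have h8 : 4 * η ^ 2 * L ^ 2 * ((16 / η ^ 2 + 6 * ωs / η) * SX)
      = 64 * L ^ 2 * SX + 24 * ωs * η * L ^ 2 * SX := by
    field_simp
    ring
  -- The only use of the cube condition on η: it trades the ω_s/η part of ΣQ for the 1/η² that is
  -- present in Λ² anyway.
  have h9 : ω * (ω + 1) / n * (24 * ωs * η * L ^ 2 * SX) ≤ 24 / η ^ 2 * L ^ 2 * SX := by
    have a1 : ω * (ω + 1) / n * (24 * ωs * η * L ^ 2 * SX)
        = (ω * (ω + 1) * ωs / n * η ^ 3) * (24 / η ^ 2 * L ^ 2 * SX) := by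
      field_simp
    rw [a1]
    exact mul_le_of_le_one_left (by positivity) hcube
  have h10 := mul_le_mul_of_nonneg_left (h7.trans_eq h8)
    (show 0 ≤ ω * (ω + 1) / n by positivity)
  linarith

/-- The average squared gradient norm along the iterates. -/
theorem sum_N_le (H : EnergyRecursion n ω ωs η γ L LA LB ς X N F W Wb Y Yb Q Z e E V G)
    (hn : 0 < n) (hω : 0 ≤ ω) (hωs : 0 ≤ ωs) (hη : 0 < η) (hη1 : η ≤ 1) (hς : 0 ≤ ς)
    (hγ : 0 < γ) (hA0 : 0 ≤ LA) (hB0 : 0 ≤ LB) (hA : LA ≤ L) (hB : LB ≤ L)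
    (hcube : ω * (ω + 1) * ωs / n * η ^ 3 ≤ 1)
    (hstep : γ * √(ωs * (ωs + 1) * LA ^ 2 + ωs / n * (ωs + 1) * LB ^ 2
      + (ω * (ω + 1) / n + 1 / η ^ 2) * L ^ 2) ≤ 1 / 20) (K : ℕ) :
    ∑ k ∈ Finset.range K, N k ≤ 2 * F 0 / γ
      + 2 * (e 0 / η + K * (η * ς / n) + K * (2 * ω / n * η * E 0)
        + K * (ω * (ω + 1) / n * (3 * η ^ 2 * ς))) := by
  have he := H.sum_e_le hn hωs hη hη1 hA0 hB0 hA hB K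
  have hG := H.sum_G_le hn hω hωs hη hη1 hς hcube K
  have hF : F K + γ / 2 * ∑ k ∈ Finset.range K, N k
      + (1 / (2 * γ) - L / 2) * ∑ k ∈ Finset.range K, X k
      ≤ F 0 + γ * (∑ k ∈ Finset.range K, G k + ∑ k ∈ Finset.range K, e k) := by
    induction K with
    | zero => simp
    | succ K ih =>
      simp only [Finset.sum_range_succ]
      have ih' := ih (H.sum_e_le hn hωs hη hη1 hA0 hB0 hA hB K)
        (H.sum_G_le hn hω hωs hη hη1 hς hcube K)
      linarith [H.F_succ K]
  set SX := ∑ k ∈ Finset.range K, X k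
  have hSX0 : 0 ≤ SX := Finset.sum_nonneg fun k _ => H.X_nonneg k
  have hL0 : 0 ≤ L := hA0.trans hA
  set R := ωs * (ωs + 1) * LA ^ 2 + ωs / n * (ωs + 1) * LB ^ 2
    + (ω * (ω + 1) / n + 1 / η ^ 2) * L ^ 2 with hR
  have hR0 : 0 ≤ R := by positivity
  have hsq : √R ^ 2 = R := Real.sq_sqrt hR0
  have hLR : L ≤ √R := by
    apply Real.le_sqrt_of_sq_le
    have h1 : 1 ≤ 1 / η ^ 2 := by
      rw [le_div_iff₀ (by positivity), one_mul]
      exact pow_le_one₀ hη.le hη1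
    have h2 : 0 ≤ ωs * (ωs + 1) * LA ^ 2 + ωs / n * (ωs + 1) * LB ^ 2
      + ω * (ω + 1) / n * L ^ 2 := by positivity
    have h3 := mul_le_mul_of_nonneg_right h1 (sq_nonneg L)
    rw [hR]
    linarith
  -- With γ√R ≤ 1/20 and L ≤ √R the left side is at most 114/400 + 1/40. The number 114 = 50 + 64
  -- exceeds all three coefficients 8, 64 and 50 + 24 that occur in `sum_e_le` and `sum_G_le`.
  have hc : 114 * γ ^ 2 * R + γ * L / 2 ≤ 1 / 2 := by
    have h1 : γ * L ≤ γ * √R := mul_le_mul_of_nonneg_left hLR hγ.le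
    have h2 : (γ * √R) ^ 2 ≤ (1 / 20) ^ 2 := pow_le_pow_left₀ (by positivity) hstep 2
    rw [mul_pow, hsq] at h2
    linarith
  have hsum : ∑ k ∈ Finset.range K, G k + ∑ k ∈ Finset.range K, e k
      ≤ (e 0 / η + K * (η * ς / n) + K * (2 * ω / n * η * E 0)
        + K * (ω * (ω + 1) / n * (3 * η ^ 2 * ς))) + 114 * R * SX := by
    have h1 : 50 / η ^ 2 * L ^ 2 + 8 * (ωs * (ωs + 1) * LA ^ 2 + ωs / n * (ωs + 1) * LB ^ 2)
        + (64 * (ω * (ω + 1) / n) + 24 / η ^ 2) * L ^ 2 ≤ 114 * R := by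
      have h2 : 0 ≤ ωs * (ωs + 1) * LA ^ 2 + ωs / n * (ωs + 1) * LB ^ 2 := by positivity
      have h3 : 0 ≤ ω * (ω + 1) / n * L ^ 2 := by positivity
      have h4 : 0 ≤ 1 / η ^ 2 * L ^ 2 := by positivity
      have h5 : 50 / η ^ 2 * L ^ 2 = 50 * (1 / η ^ 2 * L ^ 2) := by ring
      have h6 : 24 / η ^ 2 * L ^ 2 = 24 * (1 / η ^ 2 * L ^ 2) := by ring
      rw [hR]
      linarith
    have h2 := mul_le_mul_of_nonneg_right h1 hSX0
    linarith
  set B := e 0 / η + K * (η * ς / n) + K * (2 * ω / n * η * E 0)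
        + K * (ω * (ω + 1) / n * (3 * η ^ 2 * ς))
  have h1 : γ * (114 * R * SX) ≤ (1 / (2 * γ) - L / 2) * SX := by
    have h2 : γ * (114 * R) ≤ 1 / (2 * γ) - L / 2 := by
      refine le_of_mul_le_mul_left (a := γ) ?_ hγ
      have : γ * (1 / (2 * γ) - L / 2) = 1 / 2 - γ * L / 2 := by
        field_simp
      rw [this]
      linarith
    have h3 := mul_le_mul_of_nonneg_right h2 hSX0
    linarith
  have h2 := mul_le_mul_of_nonneg_left hsum hγ.le
  refine le_of_mul_le_mul_left (a := γ / 2) ?_ (by positivity)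
  have h3 : γ / 2 * (2 * F 0 / γ + 2 * B) = F 0 + γ * B := by
    field_simp
  rw [h3]
  linarith [H.F_nonneg K]

end EnergyRecursion
/-! ### Probabilistic tools -/

section Tools

variable {Ω : Type*} [MeasurableSpace Ω] {P : Measure Ω}

/-- Integrating out a fresh variable `U` that is independent of the past `X`. -/
theorem integrable_and_integral_le_of_indepFun [IsProbabilityMeasure P] {α β : Type*} [MeasurableSpace α]
    [MeasurableSpace β] {X : Ω → α} {U : Ω → β} (hX : Measurable X) (hU : Measurable U)
    (hXU : IndepFun X U P) {Φ : α → β → ℝ} {φ : α → ℝ} (hΦ : Measurable (Function.uncurry Φ))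
    (h0 : ∀ x u, 0 ≤ Φ x u) (hint : ∀ x, Integrable (fun a => Φ x (U a)) P)
    (hle : ∀ x, ∫ a, Φ x (U a) ∂P ≤ φ x) (hφ : Integrable (fun a => φ (X a)) P) :
    Integrable (fun a => Φ (X a) (U a)) P ∧
      ∫ a, Φ (X a) (U a) ∂P ≤ ∫ a, φ (X a) ∂P := by
  have hφ0 : ∀ x, 0 ≤ φ x := fun x => (integral_nonneg fun a => h0 x (U a)).trans (hle x)
  have hmeas : Measurable fun q : α × β => ENNReal.ofReal (Φ q.1 q.2) := hΦ.ennreal_ofReal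
  have hmap := (indepFun_iff_map_prod_eq_prod_map_map hX.aemeasurable hU.aemeasurable).1 hXU
  -- Lower integrals allow Tonelli before integrability is known; the finite bound then yields
  -- integrability.
  have hlin : ∫⁻ a, ENNReal.ofReal (Φ (X a) (U a)) ∂P ≤ ENNReal.ofReal (∫ a, φ (X a) ∂P) := by
    calc ∫⁻ a, ENNReal.ofReal (Φ (X a) (U a)) ∂P
        = ∫⁻ q, ENNReal.ofReal (Φ q.1 q.2) ∂(P.map fun a => (X a, U a)) :=
          (lintegral_map hmeas (hX.prodMk hU)).symm
      _ = ∫⁻ x, ∫⁻ u, ENNReal.ofReal (Φ x u) ∂(P.map U) ∂(P.map X) := by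
          have : IsProbabilityMeasure (P.map U) := Measure.isProbabilityMeasure_map hU.aemeasurable
          rw [hmap, lintegral_prod _ hmeas.aemeasurable]
      _ ≤ ∫⁻ x, ENNReal.ofReal (φ x) ∂(P.map X) := by
          refine lintegral_mono fun x => ?_
          have hx : Measurable fun u => ENNReal.ofReal (Φ x u) :=
            hmeas.comp measurable_prodMk_left
          rw [lintegral_map hx hU, ← ofReal_integral_eq_lintegral_ofReal (hint x)
            (Filter.Eventually.of_forall fun a => h0 x (U a))]
          exact ENNReal.ofReal_le_ofReal (hle x)
      -- For this direction of the change of variables `φ` need not be measurable.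
      _ ≤ ∫⁻ a, ENNReal.ofReal (φ (X a)) ∂P := lintegral_map_le _ _
      _ = ENNReal.ofReal (∫ a, φ (X a) ∂P) :=
          (ofReal_integral_eq_lintegral_ofReal hφ
            (Filter.Eventually.of_forall fun a => hφ0 (X a))).symm
  have hm : Measurable fun a => Φ (X a) (U a) := hΦ.comp (hX.prodMk hU)
  refine ⟨⟨hm.aestronglyMeasurable, ?_⟩, ?_⟩
  · rw [hasFiniteIntegral_iff_ofReal (Filter.Eventually.of_forall fun a => h0 (X a) (U a))]
    exact hlin.trans_lt ENNReal.ofReal_lt_top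
  · rw [integral_eq_lintegral_of_nonneg_ae
      (Filter.Eventually.of_forall fun a => h0 (X a) (U a)) hm.aestronglyMeasurable]
    exact ENNReal.toReal_le_of_le_ofReal (integral_nonneg fun a => hφ0 (X a)) hlin

variable {d : ℕ}

/-- The second moment of a vector perturbed by independent centred noises. -/
theorem integral_norm_add_sum_sq [IsProbabilityMeasure P] {ι : Type*} (s : Finset ι) (x : Vec d) {ζ : ι → Ω → Vec d}
    (h2 : ∀ i ∈ s, MemLp (ζ i) 2 P) (hmean : ∀ i ∈ s, ∫ a, ζ i a ∂P = 0)
    (hind : ∀ i ∈ s, ∀ j ∈ s, i ≠ j → IndepFun (ζ i) (ζ j) P) :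
    Integrable (fun a => ‖x + ∑ i ∈ s, ζ i a‖ ^ 2) P ∧
      ∫ a, ‖x + ∑ i ∈ s, ζ i a‖ ^ 2 ∂P = ‖x‖ ^ 2 + ∑ i ∈ s, ∫ a, ‖ζ i a‖ ^ 2 ∂P := by
  classical
  have hint : ∀ i ∈ s, Integrable (ζ i) P := fun i hi => (h2 i hi).integrable (by norm_num)
  have hpair : ∀ i ∈ s, ∀ j ∈ s, Integrable (fun a => inner ℝ (ζ i a) (ζ j a)) P ∧
      ∫ a, inner ℝ (ζ i a) (ζ j a) ∂P = if i = j then ∫ a, ‖ζ i a‖ ^ 2 ∂P else 0 := by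
    intro i hi j hj
    by_cases hij : i = j
    · subst hij
      simp only [real_inner_self_eq_norm_sq, if_true, and_true]
      exact (memLp_two_iff_integrable_sq_norm (h2 i hi).1).1 (h2 i hi)
    · have h := hind i hi j hj hij
      refine ⟨h.integrable_bilin (hint i hi) (hint j hj) (innerSL ℝ), ?_⟩
      have h3 := h.integral_bilin (hint i hi) (hint j hj) (innerSL ℝ)
      rw [hmean i hi, map_zero] at h3
      rw [if_neg hij]
      exact h3
  have hexp : ∀ a, ‖x + ∑ i ∈ s, ζ i a‖ ^ 2 = ‖x‖ ^ 2 + 2 * ∑ i ∈ s, inner ℝ x (ζ i a)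
      + ∑ i ∈ s, ∑ j ∈ s, inner ℝ (ζ i a) (ζ j a) := fun a => by
    rw [norm_add_sq_real, inner_sum, ← real_inner_self_eq_norm_sq (∑ i ∈ s, ζ i a), sum_inner]
    simp_rw [inner_sum]
  have i1 : Integrable (fun a => 2 * ∑ i ∈ s, inner ℝ x (ζ i a)) P :=
    (integrable_finsetSum s fun i hi => (hint i hi).const_inner x).const_mul 2
  have i2 : Integrable (fun a => ∑ i ∈ s, ∑ j ∈ s, inner ℝ (ζ i a) (ζ j a)) P :=
    integrable_finsetSum s fun i hi => integrable_finsetSum s fun j hj => (hpair i hi j hj).1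
  simp_rw [hexp]
  have i3 : Integrable (fun a => ‖x‖ ^ 2 + 2 * ∑ i ∈ s, inner ℝ x (ζ i a)) P :=
    (integrable_const _).add i1
  refine ⟨i3.add i2, ?_⟩
  rw [integral_add i3 i2, integral_add (integrable_const _) i1,
    integral_const_mul, integral_finsetSum s fun i hi => (hint i hi).const_inner x,
    integral_finsetSum s fun i hi => integrable_finsetSum s fun j hj => (hpair i hi j hj).1]
  have e1 : ∑ i ∈ s, ∫ a, inner ℝ x (ζ i a) ∂P = 0 :=
    Finset.sum_eq_zero fun i hi => by
      rw [integral_inner (hint i hi), hmean i hi, inner_zero_right]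
  have e2 : ∀ i ∈ s, ∫ a, ∑ j ∈ s, inner ℝ (ζ i a) (ζ j a) ∂P = ∫ a, ‖ζ i a‖ ^ 2 ∂P :=
    fun i hi => by
      rw [integral_finsetSum s fun j hj => (hpair i hi j hj).1,
        Finset.sum_congr rfl fun j hj => (hpair i hi j hj).2, Finset.sum_ite_eq, if_pos hi]
  rw [e1, Finset.sum_congr rfl e2]
  simp

/-- Integration against a coin. -/
theorem IsCoin.integral_ite [IsProbabilityMeasure P] {c : Ω → Bool} {p : ℝ} (hc : IsCoin P p c) (u v : ℝ) :
    Integrable (fun a => if c a then u else v) P ∧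
      ∫ a, (if c a then u else v) ∂P = p * u + (1 - p) * v := by
  have hm : MeasurableSet {a | c a = true} := hc.1 (measurableSet_singleton true)
  have he : (fun a => if c a then u else v)
      = fun a => v + {a | c a = true}.indicator (fun _ => u - v) a := by
    funext a
    by_cases h : c a = true <;> simp [h]
  rw [he]
  have hi : Integrable (fun a => {a | c a = true}.indicator (fun _ => u - v) a) P :=
    (integrable_const _).indicator hm
  refine ⟨(integrable_const v).add hi, ?_⟩
  rw [integral_add (integrable_const v) hi, integral_indicator_const _ hm, hc.2]
  simp
  ring

/-- Coordinate sets carry the discrete σ-algebra. -/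
instance instMeasurableSpaceFinset : MeasurableSpace (Finset (Fin d)) := ⊤

instance instDiscreteMeasurableSpaceFinset : DiscreteMeasurableSpace (Finset (Fin d)) where
  forall_measurableSet _ := trivial

/-! ### Moments of the Rand`K` compressor -/

namespace IsUniformSubset

variable {K : ℕ} {S : Ω → Finset (Fin d)}

theorem measurable (hS : IsUniformSubset P K S) : Measurable S :=
  measurable_to_countable' fun A => (hS A).1

theorem integrable_mem [IsProbabilityMeasure P] (hS : IsUniformSubset P K S) (j : Fin d) :
    Integrable (fun a => if j ∈ S a then (1 : ℝ) else 0) P :=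
  Integrable.of_bound ((measurable_from_top (f := fun A : Finset (Fin d) =>
    if j ∈ A then (1 : ℝ) else 0)).comp hS.measurable).aestronglyMeasurable 1
    (Filter.Eventually.of_forall fun a => by split_ifs <;> simp)

/-- Of the equally likely K-subsets, C(d−1, K−1) contain j, and C(d−1, K−1)/C(d, K) = K/d. The mean
and the variance of Rand`K` need nothing else about the law. -/
theorem integral_mem [IsProbabilityMeasure P] (hS : IsUniformSubset P K S) (hK : 0 < K) (hKd : K ≤ d) (j : Fin d) :
    ∫ a, (if j ∈ S a then (1 : ℝ) else 0) ∂P = (K : ℝ) / d := by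
  classical
  have he : (fun a => if j ∈ S a then (1 : ℝ) else 0)
      = fun a => ∑ A : Finset (Fin d),
        {a | S a = A}.indicator (fun _ => if j ∈ A then (1 : ℝ) else 0) a := by
    funext a
    rw [Finset.sum_eq_single (S a)]
    · simp
    · intro A _ hA
      rw [Set.indicator_of_notMem]
      exact fun h => hA (Eq.symm h)
    · simp
  rw [he, integral_finsetSum _ fun A _ => (integrable_const _).indicator (hS A).1]
  have hA : ∀ A, ∫ a, {a | S a = A}.indicator (fun _ => if j ∈ A then (1 : ℝ) else 0) a ∂P
      = (if A.card = K then ((d.choose K : ℕ) : ℝ)⁻¹ else 0) * (if j ∈ A then (1 : ℝ) else 0) :=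
    fun A => by rw [integral_indicator_const _ (hS A).1, (hS A).2, smul_eq_mul]
  rw [Finset.sum_congr rfl fun A _ => hA A]
  have hcard := Finset.card_filter_powersetCard_subset {j} (Finset.univ : Finset (Fin d)) K
    (Finset.subset_univ _) (by rw [Finset.card_singleton]; exact hK)
  simp only [Finset.card_univ, Fintype.card_fin, Finset.card_singleton,
    Finset.singleton_subset_iff] at hcard
  have hsum : ∑ A : Finset (Fin d), (if A.card = K then ((d.choose K : ℕ) : ℝ)⁻¹ else 0)
      * (if j ∈ A then (1 : ℝ) else 0)
      = ((d - 1).choose (K - 1) : ℝ) * ((d.choose K : ℕ) : ℝ)⁻¹ := by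
    rw [← hcard, ← nsmul_eq_mul, ← Finset.sum_const, Finset.sum_filter]
    rw [Finset.powersetCard_eq_filter, Finset.sum_filter, Finset.powerset_univ]
    refine Finset.sum_congr rfl fun A _ => ?_
    split_ifs <;> simp
  rw [hsum]
  obtain ⟨K, rfl⟩ := Nat.exists_eq_succ_of_ne_zero hK.ne'
  obtain ⟨d, rfl⟩ := Nat.exists_eq_succ_of_ne_zero (hK.trans_le hKd).ne'
  have h1 := Nat.add_one_mul_choose_eq d K
  have h2 : ((d + 1).choose (K + 1) : ℝ) ≠ 0 := by
    exact_mod_cast (Nat.choose_pos hKd).ne'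
  have h3 : ((d : ℝ) + 1) * d.choose K = (d + 1).choose (K + 1) * ((K : ℝ) + 1) := by
    exact_mod_cast h1
  simp only [Nat.succ_eq_add_one, Nat.add_sub_cancel]
  push_cast
  rw [← div_eq_mul_inv, div_eq_div_iff h2 (by positivity)]
  linarith

theorem memLp_randK_sub [IsProbabilityMeasure P] (hS : IsUniformSubset P K S) (x : Vec d) :
    MemLp (fun a => randK K (S a) x - x) 2 P := by
  have hm : Measurable fun a => randK K (S a) x - x :=
    (measurable_from_top (f := fun A : Finset (Fin d) => randK K A x - x)).comp hS.measurable
  obtain ⟨C, hC⟩ := (Set.finite_range fun A : Finset (Fin d) => ‖randK K A x - x‖).bddAbove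
  exact MemLp.of_bound hm.aestronglyMeasurable C
    (Filter.Eventually.of_forall fun a => hC ⟨S a, rfl⟩)

theorem randK_apply (A : Finset (Fin d)) (x : Vec d) (j : Fin d) :
    randK K A x j = x j * ((d : ℝ) / K * if j ∈ A then 1 else 0) := by
  classical
  simp only [randK, PiLp.smul_apply, smul_eq_mul]
  have : (∑ i ∈ A, EuclideanSpace.single i (x i)) j = if j ∈ A then x j else 0 := by
    rw [WithLp.ofLp_sum, Finset.sum_apply]
    simp
  rw [this]
  split_ifs <;> ring

theorem integral_randK_sub [IsProbabilityMeasure P] (hS : IsUniformSubset P K S) (hK : 0 < K) (hKd : K ≤ d) (x : Vec d) :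
    ∫ a, (randK K (S a) x - x) ∂P = 0 := by
  have hi : Integrable (fun a => randK K (S a) x - x) P :=
    (hS.memLp_randK_sub x).integrable (by norm_num)
  ext j
  have h1 := (EuclideanSpace.proj (𝕜 := ℝ) j).integral_comp_comm hi
  have h2 : (∫ a, (randK K (S a) x - x) ∂P) j
      = ∫ a, (x j * ((d : ℝ) / K * if j ∈ S a then 1 else 0) - x j) ∂P := by
    refine h1.symm.trans (integral_congr_ae (Filter.Eventually.of_forall fun a => ?_))
    change (randK K (S a) x - x) j = _
    rw [PiLp.sub_apply, randK_apply]
  rw [h2, integral_sub (((hS.integrable_mem j).const_mul _).const_mul _) (integrable_const _), integral_const_mul,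
    integral_const_mul, hS.integral_mem hK hKd]
  have : (0 : ℝ) < K := by exact_mod_cast hK
  have : (0 : ℝ) < d := by exact_mod_cast hK.trans_le hKd
  simp
  field_simp
  ring

/-- The squared error splits over coordinates, and each square is affine in the indicator of j ∈ S
because an indicator equals its square. Correlations between coordinates therefore play no role. -/
theorem integral_norm_randK_sub_sq [IsProbabilityMeasure P] (hS : IsUniformSubset P K S) (hK : 0 < K) (hKd : K ≤ d)
    (x : Vec d) : ∫ a, ‖randK K (S a) x - x‖ ^ 2 ∂P = omega d K * ‖x‖ ^ 2 := by
  have he : ∀ a, ‖randK K (S a) x - x‖ ^ 2 = ∑ j, (x j ^ 2 + x j ^ 2 * (((d : ℝ) / K) ^ 2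
      - 2 * ((d : ℝ) / K)) * if j ∈ S a then 1 else 0) := fun a => by
    rw [EuclideanSpace.real_norm_sq_eq]
    refine Finset.sum_congr rfl fun j _ => ?_
    rw [PiLp.sub_apply, randK_apply]
    split_ifs <;> ring
  simp_rw [he]
  have hi : ∀ j, Integrable (fun a => x j ^ 2 * (((d : ℝ) / K) ^ 2 - 2 * ((d : ℝ) / K))
      * if j ∈ S a then 1 else 0) P := fun j => (hS.integrable_mem j).const_mul _
  have hi' : ∀ j, Integrable (fun a => x j ^ 2 + x j ^ 2 * (((d : ℝ) / K) ^ 2 - 2 * ((d : ℝ) / K))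
      * if j ∈ S a then 1 else 0) P := fun j => (integrable_const _).add (hi j)
  rw [integral_finsetSum _ fun j _ => hi' j, EuclideanSpace.real_norm_sq_eq, Finset.mul_sum]
  refine Finset.sum_congr rfl fun j _ => ?_
  rw [integral_add (integrable_const _) (hi j), integral_const_mul, hS.integral_mem hK hKd]
  have : (0 : ℝ) < K := by exact_mod_cast hK
  have : (0 : ℝ) < d := by exact_mod_cast hK.trans_le hKd
  simp [omega]
  field_simp
  ring

end IsUniformSubset

end Tools

/-! ### Averages over the workers -/

section Mean

variable {n : ℕ} {V : Type*} [AddCommGroup V] [Module ℝ V]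

theorem mean_add (u v : Fin n → V) : mean (fun i => u i + v i) = mean u + mean v := by
  simp [mean, Finset.sum_add_distrib]

theorem mean_sub (u v : Fin n → V) : mean (fun i => u i - v i) = mean u - mean v := by
  simp [mean, Finset.sum_sub_distrib, smul_sub]

theorem mean_smul (c : ℝ) (u : Fin n → V) : mean (fun i => c • u i) = c • mean u := by
  simp [mean, ← Finset.smul_sum, smul_comm c]

theorem mean_mul (c : ℝ) (u : Fin n → ℝ) : mean (fun i => c * u i) = c * mean u := by
  simpa using mean_smul c u

theorem mean_const (hn : 0 < n) (v : V) : mean (fun _ : Fin n => v) = v := by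
  have : (n : ℝ) ≠ 0 := by exact_mod_cast hn.ne'
  rw [mean, Finset.sum_const, Finset.card_univ, Fintype.card_fin, ← Nat.cast_smul_eq_nsmul ℝ,
    smul_smul, inv_mul_cancel₀ this, one_smul]

theorem mean_mono {u v : Fin n → ℝ} (h : ∀ i, u i ≤ v i) : mean u ≤ mean v :=
  mul_le_mul_of_nonneg_left (Finset.sum_le_sum fun i _ => h i) (by positivity)

theorem mean_nonneg {u : Fin n → ℝ} (h : ∀ i, 0 ≤ u i) : 0 ≤ mean u :=
  mul_nonneg (by positivity) (Finset.sum_nonneg fun i _ => h i)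

variable {Ω : Type*} [MeasurableSpace Ω] {P : Measure Ω}

theorem integrable_mean {u : Fin n → Ω → ℝ} (h : ∀ i, Integrable (u i) P) :
    Integrable (fun a => mean fun i => u i a) P :=
  (integrable_finsetSum _ fun i _ => h i).const_mul _

theorem integral_mean {u : Fin n → Ω → ℝ} (h : ∀ i, Integrable (u i) P) :
    ∫ a, mean (fun i => u i a) ∂P = mean fun i => ∫ a, u i a ∂P := by
  simp only [mean, smul_eq_mul]
  rw [integral_const_mul, integral_finsetSum _ fun i _ => h i]

theorem measurable_mean {α E : Type*} [MeasurableSpace α] [NormedAddCommGroup E]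
    [NormedSpace ℝ E] [MeasurableSpace E] [BorelSpace E] [SecondCountableTopology E]
    {u : Fin n → α → E} (h : ∀ i, Measurable (u i)) : Measurable fun a => mean fun i => u i a := by
  unfold mean
  exact (Finset.measurable_fun_sum _ fun i _ => h i).const_smul _

end Mean

/-! ### One compression -/

section Compression

variable {Ω : Type*} [MeasurableSpace Ω] {P : Measure Ω} [IsProbabilityMeasure P] {n d K : ℕ}
  {S : Fin n → Ω → Finset (Fin d)}

/-- The squares are taken worker by worker, so only the law of each compressor matters and no factor
1/n appears. -/
theorem integral_mean_norm_add_randK_sq (hS : ∀ i, IsUniformSubset P K (S i)) (hK : 0 < K)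
    (hKd : K ≤ d) (hn : 0 < n) (u : Fin n → Vec d) (δ : Vec d) :
    Integrable (fun a => mean fun i => ‖u i + (randK K (S i a) δ - δ)‖ ^ 2) P ∧
      ∫ a, mean (fun i => ‖u i + (randK K (S i a) δ - δ)‖ ^ 2) ∂P
        = mean (fun i => ‖u i‖ ^ 2) + omega d K * ‖δ‖ ^ 2 := by
  have h : ∀ i, Integrable (fun a => ‖u i + (randK K (S i a) δ - δ)‖ ^ 2) P ∧
      ∫ a, ‖u i + (randK K (S i a) δ - δ)‖ ^ 2 ∂P = ‖u i‖ ^ 2 + omega d K * ‖δ‖ ^ 2 := fun i => by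
    have := integral_norm_add_sum_sq (P := P) {()} (u i)
      (ζ := fun _ a => randK K (S i a) δ - δ) (fun _ _ => (hS i).memLp_randK_sub δ)
      (fun _ _ => (hS i).integral_randK_sub hK hKd δ) (fun _ _ _ _ h => (h rfl).elim)
    simpa only [Finset.sum_singleton, (hS i).integral_norm_randK_sub_sq hK hKd δ] using this
  refine ⟨integrable_mean fun i => (h i).1, ?_⟩
  rw [integral_mean fun i => (h i).1]
  simp_rw [fun i => (h i).2]
  rw [mean_add, mean_const hn]

/-- Here the average is inside the square: independence between workers removes the cross terms,
which gains the factor 1/n. -/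
theorem integral_norm_add_mean_randK_sq (hS : ∀ i, IsUniformSubset P K (S i))
    (hind : ∀ i j, i ≠ j → IndepFun (S i) (S j) P) (hK : 0 < K)
    (hKd : K ≤ d) (u : Vec d) (δ : Fin n → Vec d) :
    Integrable (fun a => ‖u + mean fun i => randK K (S i a) (δ i) - δ i‖ ^ 2) P ∧
      ∫ a, ‖u + mean fun i => randK K (S i a) (δ i) - δ i‖ ^ 2 ∂P
        = ‖u‖ ^ 2 + omega d K / n * mean (fun i => ‖δ i‖ ^ 2) := by
  have hm : ∀ i, Measurable fun A : Finset (Fin d) =>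
    (n : ℝ)⁻¹ • (randK K A (δ i) - δ i) := fun i => measurable_from_top
  have := integral_norm_add_sum_sq (P := P) Finset.univ u
      (ζ := fun i a => (n : ℝ)⁻¹ • (randK K (S i a) (δ i) - δ i))
      (fun i _ => ((hS i).memLp_randK_sub (δ i)).const_smul (n : ℝ)⁻¹)
      (fun i _ => by rw [integral_smul, (hS i).integral_randK_sub hK hKd, smul_zero])
      (fun i _ j _ h => (hind i j h).comp (hm i) (hm j))
  simp only [norm_smul, mul_pow, integral_const_mul,
    fun i => (hS i).integral_norm_randK_sub_sq hK hKd (δ i), ← Finset.smul_sum] at this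
  refine ⟨this.1, this.2.trans ?_⟩
  simp only [mean, smul_eq_mul, norm_inv, Real.norm_natCast, ← Finset.mul_sum]
  ring

end Compression

/-! ### Minibatches -/

section MiniBatch

variable {Ω Ξ : Type*} [MeasurableSpace Ω] [MeasurableSpace Ξ] {P : Measure Ω} {n d : ℕ}
  {f : Fin n → Vec d → ℝ} {D : Fin n → Measure Ξ} {G : Fin n → Vec d → Ξ → Vec d} {σ : ℝ}
  {ξ : Fin n → ℕ → Ω → Ξ}

theorem StochasticGradients.measurable_noise (hG : StochasticGradients f D G σ) (i : Fin n)
    (y : Vec d) : Measurable fun z => G i y z - ∇ (f i) y :=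
  ((hG.measurable i).comp measurable_prodMk_left).sub_const _

/-- The deviation of a stochastic gradient from the gradient. -/
theorem StochasticGradients.noise (hG : StochasticGradients f D G σ)
    {X : Ω → Ξ} {i : Fin n} (hX : Measurable X) (hlaw : P.map X = D i) (y : Vec d) :
    MemLp (fun a => G i y (X a) - ∇ (f i) y) 2 P ∧ ∫ a, (G i y (X a) - ∇ (f i) y) ∂P = 0 ∧
      ∫ a, ‖G i y (X a) - ∇ (f i) y‖ ^ 2 ∂P ≤ σ ^ 2 := by
  have := hG.prob i
  have hm' : AEStronglyMeasurable (fun z => G i y z - ∇ (f i) y) (P.map X) :=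
    (hG.measurable_noise i y).aestronglyMeasurable
  have hL : MemLp (fun z => G i y z - ∇ (f i) y) 2 (P.map X) := by
    rw [memLp_two_iff_integrable_sq_norm hm', hlaw]
    exact hG.sq_integrable i y
  refine ⟨hL.comp_of_map hX.aemeasurable, ?_, ?_⟩
  · rw [← integral_map hX.aemeasurable hm', hlaw, integral_sub (hG.integrable i y)
      (integrable_const _), hG.unbiased i y]
    simp
  · rw [← integral_map (f := fun z => ‖G i y z - ∇ (f i) y‖ ^ 2) hX.aemeasurable
      ((hG.measurable_noise i y).norm.pow_const 2).aestronglyMeasurable, hlaw]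
    exact hG.variance_le i y

theorem miniBatch_sub {Ξ : Type*} {m : ℕ} (hm : 0 < m) (H : Vec d → Ξ → Vec d) (y g : Vec d) (z : ℕ → Ξ) :
    miniBatch H m y z - g = (m : ℝ)⁻¹ • ∑ r ∈ Finset.range m, (H y (z r) - g) := by
  have : (m : ℝ) ≠ 0 := by exact_mod_cast hm.ne'
  rw [miniBatch, Finset.sum_sub_distrib, smul_sub, Finset.sum_const, Finset.card_range,
    ← Nat.cast_smul_eq_nsmul ℝ, smul_smul, inv_mul_cancel₀ this, one_smul]

/-- The vectors `u` and `y` are frozen; later they are functions of the past, from which the samples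
are independent. Workers are treated separately, so the variance is that of one minibatch. -/
theorem integral_mean_norm_add_miniBatch_sq [IsProbabilityMeasure P] (hG : StochasticGradients f D G σ)
    (hξ : ∀ i r, Measurable (ξ i r)) (hlaw : ∀ i r, P.map (ξ i r) = D i)
    (hind : ∀ i j r t, (i, r) ≠ (j, t) → IndepFun (ξ i r) (ξ j t) P) {m : ℕ} (hm : 0 < m)
    (hn : 0 < n) (u y : Fin n → Vec d) (c : ℝ) :
    Integrable (fun a => mean fun i =>
        ‖u i + c • (miniBatch (G i) m (y i) (fun r => ξ i r a) - ∇ (f i) (y i))‖ ^ 2) P ∧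
      ∫ a, mean (fun i =>
        ‖u i + c • (miniBatch (G i) m (y i) (fun r => ξ i r a) - ∇ (f i) (y i))‖ ^ 2) ∂P
        ≤ mean (fun i => ‖u i‖ ^ 2) + c ^ 2 * (σ ^ 2 / m) := by
  have hm' : (0 : ℝ) < m := by exact_mod_cast hm
  have hmeas : ∀ i, Measurable fun z => (c * (m : ℝ)⁻¹) • (G i (y i) z - ∇ (f i) (y i)) := fun i =>
    (hG.measurable_noise i (y i)).const_smul (c * (m : ℝ)⁻¹)
  have h : ∀ i, Integrable (fun a =>
        ‖u i + c • (miniBatch (G i) m (y i) (fun r => ξ i r a) - ∇ (f i) (y i))‖ ^ 2) P ∧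
      ∫ a, ‖u i + c • (miniBatch (G i) m (y i) (fun r => ξ i r a) - ∇ (f i) (y i))‖ ^ 2 ∂P
        ≤ ‖u i‖ ^ 2 + c ^ 2 * (σ ^ 2 / m) := fun i => by
    have h1 := integral_norm_add_sum_sq (P := P) (Finset.range m) (u i)
      (ζ := fun r a => (c * (m : ℝ)⁻¹) • (G i (y i) (ξ i r a) - ∇ (f i) (y i)))
      (fun r _ => (hG.noise (hξ i r) (hlaw i r) (y i)).1.const_smul (c * (m : ℝ)⁻¹))
      (fun r _ => by
        rw [integral_smul, (hG.noise (hξ i r) (hlaw i r) (y i)).2.1, smul_zero])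
      (fun r _ t _ h => (hind i i r t (by simpa using h)).comp (hmeas i) (hmeas i))
    simp only [norm_smul, mul_pow, integral_const_mul, ← Finset.smul_sum] at h1
    simp only [miniBatch_sub hm, smul_smul]
    refine ⟨h1.1, h1.2.le.trans (add_le_add le_rfl ?_)⟩
    calc _ ≤ ∑ r ∈ Finset.range m, ‖c * (m : ℝ)⁻¹‖ ^ 2 * σ ^ 2 :=
          Finset.sum_le_sum fun r _ => mul_le_mul_of_nonneg_left
            (hG.noise (hξ i r) (hlaw i r) (y i)).2.2 (by positivity)
      _ = _ := by
          rw [Finset.sum_const, Finset.card_range, nsmul_eq_mul, Real.norm_eq_abs, sq_abs]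
          field_simp
  refine ⟨integrable_mean fun i => (h i).1, ?_⟩
  rw [integral_mean fun i => (h i).1]
  refine (mean_mono fun i => (h i).2).trans ?_
  rw [mean_add, mean_const hn]

/-- All n·m samples form one family of independent centred noises, whence the additional 1/n. -/
theorem integral_norm_add_mean_miniBatch_sq [IsProbabilityMeasure P] (hG : StochasticGradients f D G σ)
    (hξ : ∀ i r, Measurable (ξ i r)) (hlaw : ∀ i r, P.map (ξ i r) = D i)
    (hind : ∀ i j r t, (i, r) ≠ (j, t) → IndepFun (ξ i r) (ξ j t) P) {m : ℕ} (hm : 0 < m)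
    (hn : 0 < n) (u : Vec d) (y : Fin n → Vec d) (c : ℝ) :
    Integrable (fun a => ‖u + c • mean fun i =>
        miniBatch (G i) m (y i) (fun r => ξ i r a) - ∇ (f i) (y i)‖ ^ 2) P ∧
      ∫ a, ‖u + c • mean fun i =>
        miniBatch (G i) m (y i) (fun r => ξ i r a) - ∇ (f i) (y i)‖ ^ 2 ∂P
        ≤ ‖u‖ ^ 2 + c ^ 2 * (σ ^ 2 / m) / n := by
  have hm' : (0 : ℝ) < m := by exact_mod_cast hm
  have hn' : (0 : ℝ) < n := by exact_mod_cast hn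
  have hmeas : ∀ i, Measurable fun z =>
      (c * (n : ℝ)⁻¹ * (m : ℝ)⁻¹) • (G i (y i) z - ∇ (f i) (y i)) := fun i =>
    (hG.measurable_noise i (y i)).const_smul (c * (n : ℝ)⁻¹ * (m : ℝ)⁻¹)
  have h1 := integral_norm_add_sum_sq (P := P)
      ((Finset.univ : Finset (Fin n)) ×ˢ Finset.range m) u
      (ζ := fun q a => (c * (n : ℝ)⁻¹ * (m : ℝ)⁻¹) •
        (G q.1 (y q.1) (ξ q.1 q.2 a) - ∇ (f q.1) (y q.1)))
      (fun q _ => (hG.noise (hξ q.1 q.2) (hlaw q.1 q.2) (y q.1)).1.const_smul (c * (n : ℝ)⁻¹ * (m : ℝ)⁻¹))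
      (fun q _ => by
        rw [integral_smul, (hG.noise (hξ q.1 q.2) (hlaw q.1 q.2) (y q.1)).2.1, smul_zero])
      (fun q _ t _ h => (hind q.1 t.1 q.2 t.2 h).comp (hmeas q.1) (hmeas t.1))
  simp only [norm_smul, mul_pow, integral_const_mul] at h1
  have he : ∀ a, c • mean (fun i =>
        miniBatch (G i) m (y i) (fun r => ξ i r a) - ∇ (f i) (y i))
      = ∑ q ∈ (Finset.univ : Finset (Fin n)) ×ˢ Finset.range m, (c * (n : ℝ)⁻¹ * (m : ℝ)⁻¹) •
        (G q.1 (y q.1) (ξ q.1 q.2 a) - ∇ (f q.1) (y q.1)) := fun a => by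
    simp only [miniBatch_sub hm, mean, Finset.sum_product, ← Finset.smul_sum, smul_smul]
    rw [mul_assoc]
  simp only [he]
  refine ⟨h1.1, h1.2.le.trans (add_le_add le_rfl ?_)⟩
  calc _ ≤ ∑ q ∈ (Finset.univ : Finset (Fin n)) ×ˢ Finset.range m,
          ‖c‖ ^ 2 * ‖(n : ℝ)⁻¹‖ ^ 2 * ‖(m : ℝ)⁻¹‖ ^ 2 * σ ^ 2 :=
        Finset.sum_le_sum fun q _ => by
          rw [norm_mul, norm_mul, mul_pow, mul_pow]
          exact mul_le_mul_of_nonneg_left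
            (hG.noise (hξ q.1 q.2) (hlaw q.1 q.2) (y q.1)).2.2 (by positivity)
    _ = _ := by
        rw [Finset.sum_const, Finset.card_product, Finset.card_range, Finset.card_univ,
          Fintype.card_fin, nsmul_eq_mul]
        simp only [Real.norm_eq_abs, sq_abs]
        push_cast
        field_simp

end MiniBatch

/-! ### Vector inequalities -/

section Vectors

variable {E : Type*} [NormedAddCommGroup E]

theorem norm_add_sq_le_young {t : ℝ} (ht : 0 < t) (x y : E) :
    ‖x + y‖ ^ 2 ≤ (1 + t) * ‖x‖ ^ 2 + (1 + 1 / t) * ‖y‖ ^ 2 := by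
  have h1 : ‖x + y‖ ^ 2 ≤ (‖x‖ + ‖y‖) ^ 2 :=
    pow_le_pow_left₀ (norm_nonneg _) (norm_add_le x y) 2
  have h2 : (1 + t) * ‖x‖ ^ 2 + (1 + 1 / t) * ‖y‖ ^ 2 - (‖x‖ + ‖y‖) ^ 2
      = (t * ‖x‖ - ‖y‖) ^ 2 / t := by
    field_simp
    ring
  have h3 : 0 ≤ (t * ‖x‖ - ‖y‖) ^ 2 / t := by positivity
  linarith

theorem norm_add_sq_le_two (x y : E) : ‖x + y‖ ^ 2 ≤ 2 * ‖x‖ ^ 2 + 2 * ‖y‖ ^ 2 := by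
  have := norm_add_sq_le_young one_pos x y
  norm_num at this
  linarith

variable [InnerProductSpace ℝ E]

theorem norm_convex_sq_le {t : ℝ} (h0 : 0 ≤ t) (h1 : t ≤ 1) (x y : E) :
    ‖(1 - t) • x + t • y‖ ^ 2 ≤ (1 - t) * ‖x‖ ^ 2 + t * ‖y‖ ^ 2 := by
  have h2 : ‖(1 - t) • x + t • y‖ ≤ (1 - t) * ‖x‖ + t * ‖y‖ := by
    refine (norm_add_le _ _).trans_eq ?_
    rw [norm_smul, norm_smul, Real.norm_of_nonneg h0, Real.norm_of_nonneg (sub_nonneg.2 h1)]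
  have h3 := pow_le_pow_left₀ (norm_nonneg _) h2 2
  nlinarith [mul_nonneg (mul_nonneg h0 (sub_nonneg.2 h1)) (sq_nonneg (‖x‖ - ‖y‖))]

variable {η : ℝ}

/-- The local iterate follows a moving target. -/
theorem norm_momentum_sq_le (hη : 0 < η) (hη1 : η ≤ 1) (a δ b : E) :
    ‖(1 - η) • (a - δ) + η • b‖ ^ 2
      ≤ (1 - η / 2) * ‖a‖ ^ 2 + (3 / η * ‖δ‖ ^ 2 + η * ‖b‖ ^ 2) := by
  have h1 := norm_convex_sq_le hη.le hη1 (a - δ) b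
  -- The parameter η/2 gives away half of the contraction, since (1 − η)(1 + η/2) ≤ 1 − η/2.
  have h2 := norm_add_sq_le_young (half_pos hη) a (-δ)
  rw [norm_neg, ← sub_eq_add_neg] at h2
  have h3 := mul_le_mul_of_nonneg_left h2 (sub_nonneg.2 hη1)
  have h4 : (1 - η) * (1 + η / 2) ≤ 1 - η / 2 := by nlinarith
  have h5 : (1 - η) * (1 + 1 / (η / 2)) ≤ 3 / η := by
    rw [le_div_iff₀ hη]
    field_simp
    nlinarith
  have h6 := mul_le_mul_of_nonneg_right h4 (sq_nonneg ‖a‖)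
  have h7 := mul_le_mul_of_nonneg_right h5 (sq_nonneg ‖δ‖)
  linarith

/-- The gradient estimator follows a moving target. -/
theorem norm_estimator_sq_le (hη : 0 < η) (hη1 : η ≤ 1) (a δ q : E) :
    ‖(1 - η) • (a + δ) + η • q‖ ^ 2
      ≤ (1 - η) * ‖a‖ ^ 2 + (2 / η * ‖δ‖ ^ 2 + 4 * η * ‖q‖ ^ 2) := by
  have h0 : 0 ≤ 1 - η := sub_nonneg.2 hη1
  -- Young's inequality separates the old error from everything else. The weight 1 + 1/η is
  -- affordable for `q`, which already carries η².
  have h1 := norm_add_sq_le_young hη ((1 - η) • a) ((1 - η) • δ + η • q)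
  have h2 := norm_add_sq_le_two ((1 - η) • δ) (η • q)
  rw [← add_assoc, ← smul_add] at h1
  rw [norm_smul, norm_smul, Real.norm_of_nonneg h0, Real.norm_of_nonneg hη.le, mul_pow,
    mul_pow] at h2
  rw [norm_smul (1 - η) a, Real.norm_of_nonneg h0, mul_pow] at h1
  have h3 := mul_le_mul_of_nonneg_left h2 (show 0 ≤ 1 + 1 / η by positivity)
  have h4 : (1 + η) * (1 - η) ^ 2 ≤ 1 - η := by nlinarith [mul_nonneg hη.le h0]
  have h5 : (1 + 1 / η) * (2 * (1 - η) ^ 2) ≤ 2 / η := by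
    rw [le_div_iff₀ hη]
    have : (1 + 1 / η) * (2 * (1 - η) ^ 2) * η = 2 * ((1 + η) * (1 - η) ^ 2) := by
      field_simp
      ring
    rw [this]
    linarith
  have h6 : (1 + 1 / η) * (2 * η ^ 2) ≤ 4 * η := by
    have : (1 + 1 / η) * (2 * η ^ 2) = 2 * η ^ 2 + 2 * η := by
      field_simp
    rw [this]
    nlinarith
  have h7 := mul_le_mul_of_nonneg_right h4 (sq_nonneg ‖a‖)
  have h8 := mul_le_mul_of_nonneg_right h5 (sq_nonneg ‖δ‖)
  have h9 := mul_le_mul_of_nonneg_right h6 (sq_nonneg ‖q‖)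
  linarith

/-- Applied with δ the change of the worker's gradient between successive local iterates. It has
norm at most Lη‖w_i − y_i‖, so the weight 1/η leaves a term of order η. -/
theorem norm_worker_sq_le (hη : 0 < η) (hη1 : η ≤ 1) (a δ : E) :
    ‖(1 - η) • (a + δ)‖ ^ 2 ≤ (1 - η) * ‖a‖ ^ 2 + 1 / η * ‖δ‖ ^ 2 := by
  have h0 : 0 ≤ 1 - η := sub_nonneg.2 hη1
  rw [norm_smul, Real.norm_of_nonneg h0, mul_pow]
  have h1 := mul_le_mul_of_nonneg_left (norm_add_sq_le_young hη a δ) (sq_nonneg (1 - η))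
  have h4 : (1 - η) ^ 2 * (1 + η) ≤ 1 - η := by nlinarith [mul_nonneg hη.le h0]
  have h5 : (1 - η) ^ 2 * (1 + 1 / η) ≤ 1 / η := by
    rw [le_div_iff₀ hη]
    have : (1 - η) ^ 2 * (1 + 1 / η) * η = (1 - η) ^ 2 * (1 + η) := by
      field_simp
      ring
    rw [this]
    linarith
  have h7 := mul_le_mul_of_nonneg_right h4 (sq_nonneg ‖a‖)
  have h8 := mul_le_mul_of_nonneg_right h5 (sq_nonneg ‖δ‖)
  linarith

/-- The displacement of the shifted model, in expectation over the coin. -/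
theorem coin_displacement_le (hη : 0 < η) (p : ℝ) (z u δ : E) :
    p * ‖z + δ - u‖ ^ 2 + (1 - p) * ‖z + δ‖ ^ 2
      ≤ (1 + η) * ‖z‖ ^ 2 + ((1 + 1 / η) * (2 * ‖δ‖ ^ 2 + 2 * p ^ 2 * ‖u‖ ^ 2)
        + p * ‖u‖ ^ 2) := by
  -- Mean and variance over the coin: the displacement equals z + δ − u with probability p and z + δ
  -- otherwise, hence has mean z + δ − p u and variance p(1 − p)‖u‖². Only the mean passes through
  -- Young's inequality.
  have h1 : p * ‖z + δ - u‖ ^ 2 + (1 - p) * ‖z + δ‖ ^ 2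
      = ‖z + (δ - p • u)‖ ^ 2 + p * (1 - p) * ‖u‖ ^ 2 := by
    rw [← add_sub_assoc, norm_sub_sq_real, norm_sub_sq_real, inner_smul_right, norm_smul, mul_pow,
      Real.norm_eq_abs, sq_abs]
    ring
  have h2 := norm_add_sq_le_young hη z (δ - p • u)
  have h3 := norm_add_sq_le_two δ (-(p • u))
  rw [← sub_eq_add_neg, norm_neg, norm_smul, mul_pow, Real.norm_eq_abs, sq_abs] at h3
  have h4 := mul_le_mul_of_nonneg_left h3 (show 0 ≤ 1 + 1 / η by positivity)
  have h5 : 0 ≤ p ^ 2 * ‖u‖ ^ 2 := by positivity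
  linarith

end Vectors

/-! ### Smooth objectives -/

section Objective

variable {n d : ℕ} {f : Fin n → Vec d → ℝ} {L : ℝ}

theorem IsSmooth.continuous_gradient {f : Vec d → ℝ} (hf : IsSmooth f L) :
    Continuous fun x => ∇ f x := by
  refine (LipschitzWith.of_dist_le_mul (K := L.toNNReal) fun x y => ?_).continuous
  rw [dist_eq_norm, dist_eq_norm]
  exact (hf.2 x y).trans (mul_le_mul_of_nonneg_right (Real.le_coe_toNNReal L) (norm_nonneg _))

theorem IsSmooth.mono {f : Vec d → ℝ} {L' : ℝ} (hf : IsSmooth f L) (h : L ≤ L') :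
    IsSmooth f L' :=
  ⟨hf.1, fun x y => (hf.2 x y).trans (mul_le_mul_of_nonneg_right h (norm_nonneg _))⟩

theorem hasGradientAt_objective (hf : ∀ i, Differentiable ℝ (f i)) (x : Vec d) :
    HasGradientAt (objective f) (mean fun i => ∇ (f i) x) x := by
  rw [hasGradientAt_iff_hasFDerivAt]
  have h : HasFDerivAt (fun x => ∑ i, f i x)
      (∑ i, InnerProductSpace.toDual ℝ (Vec d) (∇ (f i) x)) x :=
    HasFDerivAt.fun_sum fun i _ => ((hf i x).hasGradientAt).hasFDerivAt
  have h2 := h.const_smul (n : ℝ)⁻¹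
  have e : InnerProductSpace.toDual ℝ (Vec d) (mean fun i => ∇ (f i) x)
      = (n : ℝ)⁻¹ • ∑ i, InnerProductSpace.toDual ℝ (Vec d) (∇ (f i) x) := by
    simp [mean, map_sum]
  rw [e]
  exact h2

theorem gradient_objective (hf : ∀ i, Differentiable ℝ (f i)) (x : Vec d) :
    ∇ (objective f) x = mean fun i => ∇ (f i) x :=
  (hasGradientAt_objective hf x).gradient

theorem norm_mean_le {V : Type*} [NormedAddCommGroup V] [NormedSpace ℝ V] (u : Fin n → V) :
    ‖mean u‖ ≤ mean fun i => ‖u i‖ := by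
  rw [mean, norm_smul, norm_inv, Real.norm_natCast]
  exact mul_le_mul_of_nonneg_left (norm_sum_le _ _) (by positivity)

theorem isSmooth_objective (hn : 0 < n) (hf : ∀ i, IsSmooth (f i) L) :
    IsSmooth (objective f) L := by
  have hd := fun i => (hf i).1
  refine ⟨fun x => (hasGradientAt_objective hd x).differentiableAt, fun x y => ?_⟩
  rw [gradient_objective hd, gradient_objective hd, ← mean_sub]
  exact (norm_mean_le _).trans
    ((mean_mono fun i => (hf i).2 x y).trans_eq (mean_const hn _))

theorem IsSmooth.le_quadratic {f : Vec d → ℝ} (hf : IsSmooth f L) (x v : Vec d) :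
    f (x + v) ≤ f x + inner ℝ (∇ f x) v + L / 2 * ‖v‖ ^ 2 := by
  -- The claim is φ(1) ≤ φ(0), and φ' ≤ 0 on the open unit interval by the Lipschitz bound; no
  -- integral along the segment is needed.
  set φ : ℝ → ℝ := fun t => f (x + t • v) - t * inner ℝ (∇ f x) v - L / 2 * ‖v‖ ^ 2 * t ^ 2 with hφ
  have hder : ∀ t, HasDerivAt φ (inner ℝ (∇ f (x + t • v)) v - inner ℝ (∇ f x) v
      - L / 2 * ‖v‖ ^ 2 * (2 * t)) t := fun t => by
    have h1 : HasDerivAt (fun t : ℝ => x + t • v) v t := by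
      simpa using ((hasDerivAt_id t).smul_const v).const_add x
    have h2 : HasFDerivAt f (InnerProductSpace.toDual ℝ (Vec d) (∇ f (x + t • v))) (x + t • v) :=
      ((hf.1 _).hasGradientAt).hasFDerivAt
    have h3 := h2.comp_hasDerivAt t h1
    have h4 := (hasDerivAt_id t).mul_const (inner ℝ (∇ f x) v)
    have h5 := (hasDerivAt_pow 2 t).const_mul (L / 2 * ‖v‖ ^ 2)
    have h6 := (h3.sub h4).sub h5
    refine h6.congr_deriv ?_
    rw [InnerProductSpace.toDual_apply_apply]
    norm_num
  have hanti : AntitoneOn φ (Set.Icc 0 1) := by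
    refine antitoneOn_of_deriv_nonpos (convex_Icc 0 1)
      (fun t _ => (hder t).continuousAt.continuousWithinAt)
      (fun t _ => (hder t).differentiableAt.differentiableWithinAt) fun t ht => ?_
    rw [interior_Icc] at ht
    rw [(hder t).deriv, ← inner_sub_left]
    have h1 := real_inner_le_norm (∇ f (x + t • v) - ∇ f x) v
    have h2 := hf.2 (x + t • v) x
    rw [add_sub_cancel_left, norm_smul, Real.norm_of_nonneg ht.1.le] at h2
    have h3 := mul_le_mul_of_nonneg_right h2 (norm_nonneg v)
    linarith
  have h := hanti (Set.left_mem_Icc.2 zero_le_one) (Set.right_mem_Icc.2 zero_le_one) zero_le_one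
  simp only [hφ, one_smul, zero_smul, add_zero] at h
  linarith

/-- A gradient step of length 1/L lowers f by ‖∇f‖²/(2L), and the result is still at least m. -/
theorem IsSmooth.norm_gradient_sq_le {f : Vec d → ℝ} (hf : IsSmooth f L) (hL : 0 < L) {m : ℝ}
    (hm : ∀ x, m ≤ f x) (x : Vec d) : ‖∇ f x‖ ^ 2 ≤ 2 * L * (f x - m) := by
  have h := hf.le_quadratic x (-(1 / L) • ∇ f x)
  rw [inner_smul_right, real_inner_self_eq_norm_sq, norm_smul, mul_pow, norm_neg,
    Real.norm_of_nonneg (by positivity)] at h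
  have h2 := (hm _).trans h
  have h3 : f x + -(1 / L) * ‖∇ f x‖ ^ 2 + L / 2 * ((1 / L) ^ 2 * ‖∇ f x‖ ^ 2)
      = f x - ‖∇ f x‖ ^ 2 / (2 * L) := by
    field_simp
    ring
  rw [h3] at h2
  have h4 : ‖∇ f x‖ ^ 2 / (2 * L) ≤ f x - m := by linarith
  rw [div_le_iff₀ (by positivity)] at h4
  linarith

/-- One step with an inexact gradient. -/
theorem IsSmooth.descent {f : Vec d → ℝ} (hf : IsSmooth f L) {γ : ℝ} (hγ : 0 < γ) (x g v : Vec d) :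
    f (x - γ • g) + γ / 2 * ‖∇ f x‖ ^ 2 + (1 / (2 * γ) - L / 2) * ‖γ • g‖ ^ 2
      ≤ f x + γ * (‖g - v‖ ^ 2 + ‖v - ∇ f x‖ ^ 2) := by
  have h := hf.le_quadratic x (-(γ • g))
  rw [← sub_eq_add_neg, norm_neg, inner_neg_right, inner_smul_right] at h
  have h1 := norm_add_sq_le_two (g - v) (v - ∇ f x)
  -- Expanding ‖g − ∇f‖² expresses −γ⟨∇f, g⟩ through −(γ/2)‖g‖², −(γ/2)‖∇f‖² and the error of g. The
  -- term in ‖g‖² is kept as the negative multiple of the squared step.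
  rw [sub_add_sub_cancel, norm_sub_sq_real, real_inner_comm] at h1
  have h2 : ‖γ • g‖ ^ 2 = γ ^ 2 * ‖g‖ ^ 2 := by
    rw [norm_smul, mul_pow, Real.norm_eq_abs, sq_abs]
  have h3 : 1 / (2 * γ) * ‖γ • g‖ ^ 2 = γ / 2 * ‖g‖ ^ 2 := by
    rw [h2]
    field_simp
  have h4 := mul_le_mul_of_nonneg_left h1 (half_pos hγ).le
  linarith

end Objective

/-! ### The successive stages of an iteration -/

section Stages

variable {n d : ℕ} {Ξ : Type*}

/-- The components of `step` as functions of their own randomness, so that the server's draws, the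
samples and the workers' draws can be integrated out one after the other. -/
noncomputable def nextX (θ : Params) (s : State n d) : Vec d := s.x - θ.γ • s.g

noncomputable def nextW (θ : Params) (s : State n d) (S : Fin n → Finset (Fin d)) (c : Bool) : Fin n → Vec d :=
  fun i => if c then nextX θ s else s.w i + randK θ.kDown (S i) (nextX θ s - s.x)

noncomputable def nextY (θ : Params) (s : State n d) (w : Fin n → Vec d) : Fin n → Vec d :=
  fun i => (1 - θ.μ) • s.y i + θ.μ • w i

noncomputable def nextV (G : Fin n → Vec d → Ξ → Vec d) (θ : Params) (s : State n d) (w : Fin n → Vec d)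
    (ξ : Fin n → ℕ → Ξ) : Fin n → Vec d :=
  fun i => (1 - θ.ν) • s.v i + θ.ν • miniBatch (G i) θ.b (nextY θ s w i) (ξ i)

noncomputable def nextG (θ : Params) (s : State n d) (v : Fin n → Vec d) (S : Fin n → Finset (Fin d))
    (c : Bool) : Vec d :=
  if c then mean v else s.g + mean fun i => randK θ.kUp (S i) (v i - s.v i)

/-- Pulled back from the product, so a map into states is measurable as soon as its five components
are. -/
instance instMeasurableSpaceState : MeasurableSpace (State n d) :=
  MeasurableSpace.comap (fun s => (s.x, s.w, s.y, s.v, s.g)) inferInstance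

theorem measurable_state_tuple :
    Measurable fun s : State n d => (s.x, s.w, s.y, s.v, s.g) := comap_measurable _

@[fun_prop]
theorem measurable_state_x : Measurable fun s : State n d => s.x := measurable_state_tuple.fst

@[fun_prop]
theorem measurable_state_w : Measurable fun s : State n d => s.w :=
  measurable_state_tuple.snd.fst

@[fun_prop]
theorem measurable_state_y : Measurable fun s : State n d => s.y :=
  measurable_state_tuple.snd.snd.fst

@[fun_prop]
theorem measurable_state_v : Measurable fun s : State n d => s.v :=
  measurable_state_tuple.snd.snd.snd.fst

@[fun_prop]
theorem measurable_state_g : Measurable fun s : State n d => s.g :=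
  measurable_state_tuple.snd.snd.snd.snd

theorem measurable_state_mk {α : Type*} [MeasurableSpace α] {x g : α → Vec d}
    {w y v : α → Fin n → Vec d} (hx : Measurable x) (hw : Measurable w) (hy : Measurable y)
    (hv : Measurable v) (hg : Measurable g) :
    Measurable fun a => State.mk (x a) (w a) (y a) (v a) (g a) :=
  measurable_comap_iff.2 (hx.prodMk (hw.prodMk (hy.prodMk (hv.prodMk hg))))

theorem continuous_randK (K : ℕ) (A : Finset (Fin d)) : Continuous (randK (d := d) K A) := by
  have h : ∀ j : Fin d, Continuous fun x : Vec d => EuclideanSpace.single j (x j) := fun j => by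
    have : (fun x : Vec d => EuclideanSpace.single j (x j))
        = fun x : Vec d => x j • EuclideanSpace.single j (1 : ℝ) := by
      funext x
      ext i
      by_cases h : i = j <;> simp [h]
    rw [this]
    fun_prop
  have h2 : Continuous fun x : Vec d => ∑ j ∈ A, EuclideanSpace.single j (x j) :=
    continuous_finsetSum A fun j _ => h j
  exact h2.const_smul ((d : ℝ) / K)

theorem measurable_randK_uncurry (K : ℕ) :
    Measurable fun q : Finset (Fin d) × Vec d => randK K q.1 q.2 :=
  measurable_from_prod_countable_right fun A => (continuous_randK K A).measurable

theorem measurable_randK {α : Type*} [MeasurableSpace α] {K : ℕ} {S : α → Finset (Fin d)}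
    {x : α → Vec d} (hS : Measurable S) (hx : Measurable x) :
    Measurable fun a => randK K (S a) (x a) := by
  have h := (measurable_randK_uncurry K).comp (hS.prodMk hx)
  exact h

theorem measurable_miniBatch {α : Type*} [MeasurableSpace α] [MeasurableSpace Ξ]
    {H : Vec d → Ξ → Vec d} (hH : Measurable fun q : Vec d × Ξ => H q.1 q.2) (m : ℕ)
    {y : α → Vec d} {ξ : α → ℕ → Ξ} (hy : Measurable y) (hξ : Measurable ξ) :
    Measurable fun a => miniBatch H m (y a) (ξ a) := by
  have h : Measurable fun a => ∑ r ∈ Finset.range m, H (y a) (ξ a r) :=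
    Finset.measurable_fun_sum _ fun r _ => hH.comp (hy.prodMk ((measurable_pi_apply r).comp hξ))
  exact h.const_smul (m : ℝ)⁻¹

variable {α : Type*} [MeasurableSpace α] {θ : Params} {s : α → State n d}

@[fun_prop]
theorem measurable_nextX (hs : Measurable s) : Measurable fun a => nextX θ (s a) := by
  unfold nextX
  fun_prop

@[fun_prop]
theorem measurable_nextW {S : α → Fin n → Finset (Fin d)} {c : α → Bool} (hs : Measurable s)
    (hS : Measurable S) (hc : Measurable c) : Measurable fun a => nextW θ (s a) (S a) (c a) := by
  refine measurable_pi_lambda _ fun i => ?_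
  unfold nextW
  have h : Measurable fun a => randK θ.kDown (S a i) (nextX θ (s a) - (s a).x) :=
    measurable_randK (by fun_prop) (by fun_prop)
  exact Measurable.ite (hc (measurableSet_singleton true)) (by fun_prop) (by fun_prop)

@[fun_prop]
theorem measurable_nextY {w : α → Fin n → Vec d} (hs : Measurable s) (hw : Measurable w) :
    Measurable fun a => nextY θ (s a) (w a) := by
  refine measurable_pi_lambda _ fun i => ?_
  unfold nextY
  fun_prop

theorem measurable_nextV [MeasurableSpace Ξ] {G : Fin n → Vec d → Ξ → Vec d}
    (hG : ∀ i, Measurable fun q : Vec d × Ξ => G i q.1 q.2) {w : α → Fin n → Vec d}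
    {ξ : α → Fin n → ℕ → Ξ} (hs : Measurable s) (hw : Measurable w) (hξ : Measurable ξ) :
    Measurable fun a => nextV G θ (s a) (w a) (ξ a) := by
  refine measurable_pi_lambda _ fun i => ?_
  unfold nextV
  have := measurable_miniBatch (hG i) θ.b (y := fun a => nextY θ (s a) (w a) i)
    (ξ := fun a => ξ a i) (by fun_prop) (by fun_prop)
  fun_prop

@[fun_prop]
theorem measurable_nextG {v : α → Fin n → Vec d} {S : α → Fin n → Finset (Fin d)} {c : α → Bool}
    (hs : Measurable s) (hv : Measurable v) (hS : Measurable S) (hc : Measurable c) :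
    Measurable fun a => nextG θ (s a) (v a) (S a) (c a) := by
  unfold nextG
  refine Measurable.ite (hc (measurableSet_singleton true)) ?_ ?_
  · exact measurable_mean fun i => by fun_prop
  · exact (measurable_state_g.comp hs).add
      (measurable_mean fun i => measurable_randK (by fun_prop) (by fun_prop))

end Stages

/-! ### The past and the fresh draws -/

section Past

variable {Ω Ξ : Type*} {n d : ℕ}

/-- The position of a draw in the order in which the draws are used. -/
def DrawIndex.rank : DrawIndex n → ℕ
  | .sample 0 _ _ => 0
  -- Round k + 1 of sampling belongs to iteration k. Iteration k occupies the ranks 5k+1 to 5k+5, so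
  -- the state before it depends on ranks below 5k+1 only. Draws of equal rank are integrated out
  -- together.
  | .sample (k + 1) _ _ => 5 * k + 3
  | .downSet k _ => 5 * k + 1
  | .downCoin k => 5 * k + 2
  | .upSet k _ => 5 * k + 4
  | .upCoin k => 5 * k + 5

/-- The shifted models sent by the server in iteration `k`. -/
noncomputable def wNext (G : Fin n → Vec d → Ξ → Vec d) (θ : Params) (x₀ : Vec d) (R : Draws Ω Ξ n d) (k : ℕ)
    (a : Ω) : Fin n → Vec d :=
  nextW θ (run G θ x₀ R k a) (fun i => R.downSet k i a) (R.downCoin k a)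

/-- The gradient estimators of the workers in iteration `k`. -/
noncomputable def vNext (G : Fin n → Vec d → Ξ → Vec d) (θ : Params) (x₀ : Vec d) (R : Draws Ω Ξ n d) (k : ℕ)
    (a : Ω) : Fin n → Vec d :=
  nextV G θ (run G θ x₀ R k a) (wNext G θ x₀ R k a) fun i r => R.sample (k + 1) i r a

variable {G : Fin n → Vec d → Ξ → Vec d} {θ : Params} {x₀ : Vec d} {R : Draws Ω Ξ n d}

theorem run_succ (k : ℕ) (a : Ω) : run G θ x₀ R (k + 1) a =
    { x := nextX θ (run G θ x₀ R k a)
      w := wNext G θ x₀ R k a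
      y := nextY θ (run G θ x₀ R k a) (wNext G θ x₀ R k a)
      v := vNext G θ x₀ R k a
      g := nextG θ (run G θ x₀ R k a) (vNext G θ x₀ R k a) (fun i => R.upSet k i a)
        (R.upCoin k a) } := rfl

variable [MeasurableSpace Ξ]

/-- The σ-algebra of the draws of rank less than `j`. -/
@[reducible]
def Draws.past (R : Draws Ω Ξ n d) (j : ℕ) : MeasurableSpace Ω :=
  ⨆ i ∈ {i : DrawIndex n | i.rank < j}, R.sigma i

/-- The σ-algebra of the draws of rank `j`. -/
@[reducible]
def Draws.fresh (R : Draws Ω Ξ n d) (j : ℕ) : MeasurableSpace Ω :=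
  ⨆ i ∈ {i : DrawIndex n | i.rank = j}, R.sigma i

theorem Draws.past_mono (R : Draws Ω Ξ n d) {j l : ℕ} (h : j ≤ l) : R.past j ≤ R.past l :=
  biSup_mono fun _ hi => lt_of_lt_of_le hi h

theorem Draws.fresh_le_past (R : Draws Ω Ξ n d) {j l : ℕ} (h : j < l) : R.fresh j ≤ R.past l :=
  biSup_mono fun i hi => by
    simp only [Set.mem_ofPred_eq] at hi ⊢
    omega

theorem Draws.sigma_le_fresh (R : Draws Ω Ξ n d) (i : DrawIndex n) :
    R.sigma i ≤ R.fresh i.rank :=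
  le_iSup₂_of_le i rfl le_rfl

theorem Draws.measurable_downSets (R : Draws Ω Ξ n d) (k : ℕ) :
    Measurable[R.fresh (5 * k + 1)] fun a i => R.downSet k i a :=
  @measurable_pi_lambda _ _ _ (R.fresh (5 * k + 1)) _ _ fun i =>
    (comap_measurable (R.downSet k i)).mono (R.sigma_le_fresh (.downSet k i)) le_rfl

theorem Draws.measurable_downCoin (R : Draws Ω Ξ n d) (k : ℕ) :
    Measurable[R.fresh (5 * k + 2)] (R.downCoin k) :=
  (comap_measurable (R.downCoin k)).mono (R.sigma_le_fresh (.downCoin k)) le_rfl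

theorem Draws.measurable_samples (R : Draws Ω Ξ n d) (k : ℕ) :
    Measurable[R.fresh (5 * k + 3)] fun a i r => R.sample (k + 1) i r a :=
  @measurable_pi_lambda _ _ _ (R.fresh (5 * k + 3)) _ _ fun i =>
    @measurable_pi_lambda _ _ _ (R.fresh (5 * k + 3)) _ _ fun r =>
      (comap_measurable (R.sample (k + 1) i r)).mono
        (R.sigma_le_fresh (.sample (k + 1) i r)) le_rfl

theorem Draws.measurable_upSets (R : Draws Ω Ξ n d) (k : ℕ) :
    Measurable[R.fresh (5 * k + 4)] fun a i => R.upSet k i a :=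
  @measurable_pi_lambda _ _ _ (R.fresh (5 * k + 4)) _ _ fun i =>
    (comap_measurable (R.upSet k i)).mono (R.sigma_le_fresh (.upSet k i)) le_rfl

theorem Draws.measurable_upCoin (R : Draws Ω Ξ n d) (k : ℕ) :
    Measurable[R.fresh (5 * k + 5)] (R.upCoin k) :=
  (comap_measurable (R.upCoin k)).mono (R.sigma_le_fresh (.upCoin k)) le_rfl

/-- The σ-algebra on Ω is passed explicitly here and below: independence needs measurability for the
past, which is stronger than measurability for the ambient σ-algebra. -/
theorem measurable_wNext {k : ℕ}
    (h : Measurable[R.past (5 * k + 1)] (run G θ x₀ R k)) :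
    Measurable[R.past (5 * k + 3)] (wNext G θ x₀ R k) :=
  @measurable_nextW _ _ _ (R.past (5 * k + 3)) _ _ _ _
    (h.mono (R.past_mono (by omega)) le_rfl)
    ((R.measurable_downSets k).mono (R.fresh_le_past (by omega)) le_rfl)
    ((R.measurable_downCoin k).mono (R.fresh_le_past (by omega)) le_rfl)

theorem measurable_vNext (hG : ∀ i, Measurable fun q : Vec d × Ξ => G i q.1 q.2) {k : ℕ}
    (h : Measurable[R.past (5 * k + 1)] (run G θ x₀ R k)) :
    Measurable[R.past (5 * k + 4)] (vNext G θ x₀ R k) :=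
  @measurable_nextV _ _ _ _ (R.past (5 * k + 4)) _ _ _ _ hG _ _
    (h.mono (R.past_mono (by omega)) le_rfl)
    ((measurable_wNext h).mono (R.past_mono (by omega)) le_rfl)
    ((R.measurable_samples k).mono (R.fresh_le_past (by omega)) le_rfl)

theorem measurable_run_past (hG : ∀ i, Measurable fun q : Vec d × Ξ => G i q.1 q.2) (k : ℕ) :
    Measurable[R.past (5 * k + 1)] (run G θ x₀ R k) := by
  induction k with
  | zero =>
    have hv : ∀ i, Measurable[R.past 1] fun a =>
        miniBatch (G i) θ.bInit x₀ fun r => R.sample 0 i r a := fun i =>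
      @measurable_miniBatch _ _ _ (R.past 1) _ _ (hG i) _ _ _ (@measurable_const _ _ _ (R.past 1) _)
        (@measurable_pi_lambda _ _ _ (R.past 1) _ _ fun r =>
          (comap_measurable (R.sample 0 i r)).mono
            ((R.sigma_le_fresh (.sample 0 i r)).trans (R.fresh_le_past Nat.zero_lt_one)) le_rfl)
    exact @measurable_state_mk _ _ _ (R.past 1) _ _ _ _ _ (@measurable_const _ _ _ (R.past 1) _)
      (@measurable_const _ _ _ (R.past 1) _) (@measurable_const _ _ _ (R.past 1) _)
      (@measurable_pi_lambda _ _ _ (R.past 1) _ _ hv) (@measurable_mean _ _ _ (R.past 1) _ _ _ _ _ _ hv)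
  | succ k ih =>
    have h1 := ih.mono (R.past_mono (show 5 * k + 1 ≤ 5 * (k + 1) + 1 by omega)) le_rfl
    have h2 := (measurable_wNext ih).mono
      (R.past_mono (show 5 * k + 3 ≤ 5 * (k + 1) + 1 by omega)) le_rfl
    have h3 := (measurable_vNext hG ih).mono
      (R.past_mono (show 5 * k + 4 ≤ 5 * (k + 1) + 1 by omega)) le_rfl
    exact @measurable_state_mk _ _ _ (R.past (5 * (k + 1) + 1)) _ _ _ _ _
      (@measurable_nextX _ _ _ (R.past (5 * (k + 1) + 1)) _ _ h1) h2
      (@measurable_nextY _ _ _ (R.past (5 * (k + 1) + 1)) _ _ _ h1 h2) h3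
      (@measurable_nextG _ _ _ (R.past (5 * (k + 1) + 1)) _ _ _ _ _ h1 h3
        ((R.measurable_upSets k).mono (R.fresh_le_past (by omega)) le_rfl)
        ((R.measurable_upCoin k).mono (R.fresh_le_past (by omega)) le_rfl))

namespace Draws.IsAdmissible

variable [mΩ : MeasurableSpace Ω] {P : Measure Ω} {D : Fin n → Measure Ξ}

theorem sigma_le (hR : R.IsAdmissible P D θ) (i : DrawIndex n) : R.sigma i ≤ mΩ := by
  cases i with
  | sample k i r => exact (hR.sample_measurable k i r).comap_le
  | downSet k i => exact (hR.downSet_law k i).measurable.comap_le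
  | upSet k i => exact (hR.upSet_law k i).measurable.comap_le
  | downCoin k => exact (hR.downCoin_law k).1.comap_le
  | upCoin k => exact (hR.upCoin_law k).1.comap_le

theorem past_le (hR : R.IsAdmissible P D θ) (j : ℕ) : R.past j ≤ mΩ :=
  iSup₂_le fun i _ => hR.sigma_le i

theorem fresh_le (hR : R.IsAdmissible P D θ) (j : ℕ) : R.fresh j ≤ mΩ :=
  iSup₂_le fun i _ => hR.sigma_le i

/-- Disjoint subfamilies of an independent family of σ-algebras generate independent σ-algebras;
ranks below j and rank j are disjoint. -/
theorem indepFun_past_fresh (hR : R.IsAdmissible P D θ) {j : ℕ} {α β : Type*}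
    [MeasurableSpace α] [MeasurableSpace β] {X : Ω → α} {U : Ω → β}
    (hX : Measurable[R.past j] X) (hU : Measurable[R.fresh j] U) : IndepFun X U P := by
  have h := indep_iSup_of_disjoint hR.sigma_le hR.indep
    (S := {i : DrawIndex n | i.rank < j}) (T := {i | i.rank = j})
    (Set.disjoint_left.2 fun i h1 h2 => (ne_of_lt h1) h2)
  exact indep_of_indep_of_le_left (indep_of_indep_of_le_right h hU.comap_le) hX.comap_le

theorem indepFun_draws (hR : R.IsAdmissible P D θ) {i j : DrawIndex n} (hij : i ≠ j)
    {α β : Type*} [MeasurableSpace α] [MeasurableSpace β] {X : Ω → α} {U : Ω → β}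
    (hX : Measurable[R.sigma i] X) (hU : Measurable[R.sigma j] U) : IndepFun X U P :=
  indep_of_indep_of_le_left (indep_of_indep_of_le_right (hR.indep.indep hij) hU.comap_le)
    hX.comap_le

theorem indepFun_downSet (hR : R.IsAdmissible P D θ) (k : ℕ) (i j : Fin n) (h : i ≠ j) :
    IndepFun (R.downSet k i) (R.downSet k j) P :=
  hR.indepFun_draws (i := .downSet k i) (j := .downSet k j) (by simpa using h)
    (comap_measurable _) (comap_measurable _)

theorem indepFun_upSet (hR : R.IsAdmissible P D θ) (k : ℕ) (i j : Fin n) (h : i ≠ j) :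
    IndepFun (R.upSet k i) (R.upSet k j) P :=
  hR.indepFun_draws (i := .upSet k i) (j := .upSet k j) (by simpa using h)
    (comap_measurable _) (comap_measurable _)

theorem indepFun_sample (hR : R.IsAdmissible P D θ) (k : ℕ) (i j : Fin n) (r t : ℕ)
    (h : (i, r) ≠ (j, t)) : IndepFun (R.sample k i r) (R.sample k j t) P :=
  hR.indepFun_draws (i := .sample k i r) (j := .sample k j t) (by simpa using h)
    (comap_measurable _) (comap_measurable _)

theorem measurable_run (hR : R.IsAdmissible P D θ)
    (hG : ∀ i, Measurable fun q : Vec d × Ξ => G i q.1 q.2) (k : ℕ) :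
    Measurable (run G θ x₀ R k) :=
  (measurable_run_past hG k).mono (hR.past_le _) le_rfl

end Draws.IsAdmissible

end Past

/-! ### Energies of a state -/

section Energies

variable {n d : ℕ}

noncomputable def enX (θ : Params) (s : State n d) : ℝ := ‖nextX θ s - s.x‖ ^ 2

noncomputable def enW (s : State n d) : ℝ := mean fun i => ‖s.w i - s.x‖ ^ 2

/-- Distinguished from `enW` because the server's compressors are independent across workers: this
energy receives only ω_s/n per step. It feeds `enYb`, the factor of L_B² in the similarity bound. -/
noncomputable def enWb (s : State n d) : ℝ := ‖mean s.w - s.x‖ ^ 2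

noncomputable def enY (s : State n d) : ℝ := mean fun i => ‖s.y i - s.x‖ ^ 2

noncomputable def enYb (s : State n d) : ℝ := ‖mean s.y - s.x‖ ^ 2

noncomputable def enZ (s : State n d) : ℝ := mean fun i => ‖s.w i - s.y i‖ ^ 2

/-- Evaluated at the new w and the old local iterates, this is η⁻² times the mean squared move of
the local iterates, hence controls the change of the workers' gradients. -/
noncomputable def enQ (s : State n d) (w : Fin n → Vec d) : ℝ := mean fun i => ‖w i - s.y i‖ ^ 2

noncomputable def ene (f : Fin n → Vec d → ℝ) (s : State n d) : ℝ :=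
  ‖mean s.v - ∇ (objective f) s.x‖ ^ 2

noncomputable def enE (f : Fin n → Vec d → ℝ) (s : State n d) : ℝ :=
  mean fun i => ‖s.v i - ∇ (f i) (s.y i)‖ ^ 2

noncomputable def enV (s : State n d) (v : Fin n → Vec d) : ℝ := mean fun i => ‖v i - s.v i‖ ^ 2

noncomputable def enG (s : State n d) : ℝ := ‖s.g - mean s.v‖ ^ 2

noncomputable def enN (f : Fin n → Vec d → ℝ) (s : State n d) : ℝ := ‖∇ (objective f) s.x‖ ^ 2

noncomputable def enF (f : Fin n → Vec d → ℝ) (fstar : ℝ) (s : State n d) : ℝ :=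
  objective f s.x - fstar

theorem mean_sq_nonneg (u : Fin n → Vec d) : 0 ≤ mean fun i => ‖u i‖ ^ 2 :=
  mean_nonneg fun _ => sq_nonneg _

variable {α : Type*} [MeasurableSpace α] {θ : Params} {s : α → State n d}

theorem measurable_mean_sq {u : α → Fin n → Vec d} (hu : Measurable u) :
    Measurable fun a => mean fun i => ‖u a i‖ ^ 2 :=
  measurable_mean fun i => by fun_prop

theorem measurable_mean_pi {u : α → Fin n → Vec d} (hu : Measurable u) :
    Measurable fun a => mean (u a) :=
  measurable_mean (u := fun i a => u a i) fun i => by fun_prop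

end Energies

/-- The objects of a run of M4 with momentum `η`, together with their assumptions. -/
structure Setting {Ω Ξ : Type*} [MeasurableSpace Ω] [MeasurableSpace Ξ] {n d : ℕ}
    (P : Measure Ω) (D : Fin n → Measure Ξ) (f : Fin n → Vec d → ℝ)
    (G : Fin n → Vec d → Ξ → Vec d) (R : Draws Ω Ξ n d) (θ : Params)
    (η L LA LB σ fstar : ℝ) : Prop where
  n_pos : 0 < n
  smooth : ∀ i, IsSmooth (f i) L
  lower : ∀ x, fstar ≤ objective f x
  grad : StochasticGradients f D G σ
  sim : Similarity f LA LB
  adm : R.IsAdmissible P D θ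
  γ_pos : 0 < θ.γ
  η_pos : 0 < η
  η_le : η ≤ 1
  μ_eq : θ.μ = η
  ν_eq : θ.ν = η
  b_pos : 0 < θ.b
  bInit_pos : 0 < θ.bInit
  kDown_pos : 0 < θ.kDown
  kDown_le : θ.kDown ≤ d
  kUp_pos : 0 < θ.kUp
  kUp_le : θ.kUp ≤ d
  pDown_eq : θ.pDown = 1 / (omega d θ.kDown + 1)
  pUp_eq : θ.pUp = 1 / (omega d θ.kUp + 1)

theorem omega_nonneg {d K : ℕ} (hK : 0 < K) (hKd : K ≤ d) : 0 ≤ omega d K := by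
  have h1 : (0 : ℝ) < K := by exact_mod_cast hK
  have h2 : (K : ℝ) ≤ d := by exact_mod_cast hKd
  rw [omega, sub_nonneg, le_div_iff₀ h1]
  linarith

/-! ### Expectation over the stages of an iteration -/

namespace Setting

variable {Ω Ξ : Type*} [MeasurableSpace Ω] [MeasurableSpace Ξ] {n d : ℕ} {P : Measure Ω}
  {D : Fin n → Measure Ξ} {f : Fin n → Vec d → ℝ}
  {G : Fin n → Vec d → Ξ → Vec d} {R : Draws Ω Ξ n d} {θ : Params} {η L LA LB σ fstar : ℝ}
  {x₀ : Vec d}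

theorem pDown_mem (h : Setting P D f G R θ η L LA LB σ fstar) : 0 ≤ θ.pDown ∧ θ.pDown ≤ 1 := by
  have := omega_nonneg h.kDown_pos h.kDown_le
  rw [h.pDown_eq]
  exact ⟨by positivity, by rw [div_le_one (by positivity)]; linarith⟩

theorem pUp_mem (h : Setting P D f G R θ η L LA LB σ fstar) : 0 ≤ θ.pUp ∧ θ.pUp ≤ 1 := by
  have := omega_nonneg h.kUp_pos h.kUp_le
  rw [h.pUp_eq]
  exact ⟨by positivity, by rw [div_le_one (by positivity)]; linarith⟩

variable [IsProbabilityMeasure P]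

/-- The expectation over the coin and the compressors of the server. -/
theorem down_stage (h : Setting P D f G R θ η L LA LB σ fstar) (k : ℕ)
    {Φ : State n d → (Fin n → Vec d) → ℝ} {φ : State n d → ℝ}
    (hΦ : Measurable (Function.uncurry Φ)) (h0 : ∀ s w, 0 ≤ Φ s w)
    (hle : ∀ s, Integrable (fun a => Φ s (nextW θ s (fun i => R.downSet k i a) false)) P ∧
      θ.pDown * Φ s (fun _ => nextX θ s)
        + (1 - θ.pDown) * ∫ a, Φ s (nextW θ s (fun i => R.downSet k i a) false) ∂P ≤ φ s)
    (hφ : Integrable (fun a => φ (run G θ x₀ R k a)) P) :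
    Integrable (fun a => Φ (run G θ x₀ R k a) (wNext G θ x₀ R k a)) P ∧
      ∫ a, Φ (run G θ x₀ R k a) (wNext G θ x₀ R k a) ∂P ≤ ∫ a, φ (run G θ x₀ R k a) ∂P := by
  obtain ⟨hp0, hp1⟩ := h.pDown_mem
  have hrun := measurable_run_past (θ := θ) (x₀ := x₀) (R := R) h.grad.measurable k
  have hsets := R.measurable_downSets k
  -- The average over the coin with frozen coordinate sets. Integrating the sets out of Ψ comes
  -- first because it supplies the integrability needed for integrating out the coin, conditionally
  -- on the past and the sets.
  set Ψ : State n d → (Fin n → Finset (Fin d)) → ℝ := fun s S =>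
    θ.pDown * Φ s (fun _ => nextX θ s) + (1 - θ.pDown) * Φ s (nextW θ s S false) with hΨ
  have mx : Measurable fun s : State n d => nextX θ s := measurable_nextX measurable_id
  have hΨm : Measurable (Function.uncurry Ψ) := by
    have m1 : Measurable fun q : State n d × (Fin n → Finset (Fin d)) =>
        Function.uncurry Φ (q.1, fun _ => nextX θ q.1) :=
      hΦ.comp (measurable_fst.prodMk (measurable_pi_lambda _ fun _ => mx.comp measurable_fst))
    have m2 : Measurable fun q : State n d × (Fin n → Finset (Fin d)) =>
        Function.uncurry Φ (q.1, nextW θ q.1 q.2 false) :=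
      hΦ.comp (measurable_fst.prodMk (measurable_nextW measurable_fst measurable_snd
        measurable_const))
    exact (m1.const_mul _).add (m2.const_mul _)
  have hΨ0 : ∀ s S, 0 ≤ Ψ s S := fun s S =>
    add_nonneg (mul_nonneg hp0 (h0 _ _)) (mul_nonneg (sub_nonneg.2 hp1) (h0 _ _))
  have step1 := integrable_and_integral_le_of_indepFun (P := P)
    (h.adm.measurable_run h.grad.measurable k) (hsets.mono (h.adm.fresh_le _) le_rfl)
    (h.adm.indepFun_past_fresh hrun hsets) (Φ := Ψ) (φ := φ) hΨm hΨ0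
    (fun s => (integrable_const _).add ((hle s).1.const_mul _))
    (fun s => by
      simp only [hΨ]
      rw [integral_add (integrable_const _) ((hle s).1.const_mul _), integral_const,
        integral_const_mul]
      simpa using (hle s).2) hφ
  have hX : Measurable[R.past (5 * k + 2)] fun a =>
      (run G θ x₀ R k a, fun i => R.downSet k i a) :=
    Measurable.prodMk (hrun.mono (R.past_mono (by omega)) le_rfl)
      (hsets.mono (R.fresh_le_past (by omega)) le_rfl)
  have hc := R.measurable_downCoin k
  have step2 := integrable_and_integral_le_of_indepFun (P := P)
    (hX.mono (h.adm.past_le _) le_rfl) (hc.mono (h.adm.fresh_le _) le_rfl)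
    (h.adm.indepFun_past_fresh hX hc)
    (Φ := fun q c => Φ q.1 (nextW θ q.1 q.2 c)) (φ := fun q => Ψ q.1 q.2)
    (hΦ.comp (Measurable.prodMk (by fun_prop) (measurable_nextW (by fun_prop) (by fun_prop)
      (by fun_prop)))) (fun _ _ => h0 _ _)
    (fun q => by
      refine ((h.adm.downCoin_law k).integral_ite (Φ q.1 (nextW θ q.1 q.2 true))
        (Φ q.1 (nextW θ q.1 q.2 false))).1.congr (Filter.Eventually.of_forall fun a => ?_)
      dsimp only
      cases R.downCoin k a <;> rfl)
    (fun q => by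
      have e := ((h.adm.downCoin_law k).integral_ite (Φ q.1 (nextW θ q.1 q.2 true))
        (Φ q.1 (nextW θ q.1 q.2 false))).2
      refine le_of_eq (Eq.trans (integral_congr_ae (Filter.Eventually.of_forall fun a => ?_)) e)
      dsimp only
      cases R.downCoin k a <;> rfl) step1.1
  exact ⟨step2.1, step2.2.trans step1.2⟩

/-- The expectation over the samples of an iteration. -/
theorem sample_stage (h : Setting P D f G R θ η L LA LB σ fstar) (k : ℕ)
    {Φ : State n d × (Fin n → Vec d) → (Fin n → Vec d) → ℝ}
    {φ : State n d × (Fin n → Vec d) → ℝ}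
    (hΦ : Measurable (Function.uncurry Φ)) (h0 : ∀ q v, 0 ≤ Φ q v)
    (hle : ∀ q, Integrable (fun a => Φ q (nextV G θ q.1 q.2 fun i r => R.sample (k + 1) i r a)) P ∧
      ∫ a, Φ q (nextV G θ q.1 q.2 fun i r => R.sample (k + 1) i r a) ∂P ≤ φ q)
    (hφ : Integrable (fun a => φ (run G θ x₀ R k a, wNext G θ x₀ R k a)) P) :
    Integrable (fun a => Φ (run G θ x₀ R k a, wNext G θ x₀ R k a) (vNext G θ x₀ R k a)) P ∧
      ∫ a, Φ (run G θ x₀ R k a, wNext G θ x₀ R k a) (vNext G θ x₀ R k a) ∂P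
        ≤ ∫ a, φ (run G θ x₀ R k a, wNext G θ x₀ R k a) ∂P := by
  have hrun := measurable_run_past (θ := θ) (x₀ := x₀) (R := R) h.grad.measurable k
  have hs := R.measurable_samples k
  have hX : Measurable[R.past (5 * k + 3)] fun a =>
      (run G θ x₀ R k a, wNext G θ x₀ R k a) :=
    Measurable.prodMk (hrun.mono (R.past_mono (by omega)) le_rfl) (measurable_wNext hrun)
  exact integrable_and_integral_le_of_indepFun (P := P)
    (hX.mono (h.adm.past_le _) le_rfl) (hs.mono (h.adm.fresh_le _) le_rfl)
    (h.adm.indepFun_past_fresh hX hs) (Φ := fun q ξ => Φ q (nextV G θ q.1 q.2 ξ)) (φ := φ)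
    (hΦ.comp (measurable_fst.prodMk (measurable_nextV h.grad.measurable (by fun_prop)
      (by fun_prop) measurable_snd))) (fun _ _ => h0 _ _) (fun q => (hle q).1)
    (fun q => (hle q).2) hφ

/-- The expectation over the coin and the compressors of the workers. -/
theorem up_stage (h : Setting P D f G R θ η L LA LB σ fstar) (k : ℕ)
    {Φ : State n d × (Fin n → Vec d) → Vec d → ℝ} {φ : State n d × (Fin n → Vec d) → ℝ}
    (hΦ : Measurable (Function.uncurry Φ)) (h0 : ∀ q g, 0 ≤ Φ q g)
    (hle : ∀ q, Integrable (fun a => Φ q (nextG θ q.1 q.2 (fun i => R.upSet k i a) false)) P ∧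
      θ.pUp * Φ q (mean q.2)
        + (1 - θ.pUp) * ∫ a, Φ q (nextG θ q.1 q.2 (fun i => R.upSet k i a) false) ∂P ≤ φ q)
    (hφ : Integrable (fun a => φ (run G θ x₀ R k a, vNext G θ x₀ R k a)) P) :
    Integrable (fun a => Φ (run G θ x₀ R k a, vNext G θ x₀ R k a) (run G θ x₀ R (k + 1) a).g) P ∧
      ∫ a, Φ (run G θ x₀ R k a, vNext G θ x₀ R k a) (run G θ x₀ R (k + 1) a).g ∂P
        ≤ ∫ a, φ (run G θ x₀ R k a, vNext G θ x₀ R k a) ∂P := by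
  obtain ⟨hp0, hp1⟩ := h.pUp_mem
  have hrun := measurable_run_past (θ := θ) (x₀ := x₀) (R := R) h.grad.measurable k
  have hY : Measurable[R.past (5 * k + 4)] fun a =>
      (run G θ x₀ R k a, vNext G θ x₀ R k a) :=
    Measurable.prodMk (hrun.mono (R.past_mono (by omega)) le_rfl)
      (measurable_vNext h.grad.measurable hrun)
  have hsets := R.measurable_upSets k
  -- As for the server: the average over the coin for frozen sets, with the sets integrated out
  -- before the coin.
  set Ψ : State n d × (Fin n → Vec d) → (Fin n → Finset (Fin d)) → ℝ := fun q S =>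
    θ.pUp * Φ q (mean q.2) + (1 - θ.pUp) * Φ q (nextG θ q.1 q.2 S false) with hΨ
  have hΨm : Measurable (Function.uncurry Ψ) := by
    have m1 : Measurable fun q : (State n d × (Fin n → Vec d)) × (Fin n → Finset (Fin d)) =>
        Function.uncurry Φ (q.1, mean q.1.2) :=
      hΦ.comp (measurable_fst.prodMk (measurable_mean_pi (by fun_prop)))
    have m2 : Measurable fun q : (State n d × (Fin n → Vec d)) × (Fin n → Finset (Fin d)) =>
        Function.uncurry Φ (q.1, nextG θ q.1.1 q.1.2 q.2 false) :=
      hΦ.comp (measurable_fst.prodMk (measurable_nextG (by fun_prop) (by fun_prop)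
        measurable_snd measurable_const))
    exact (m1.const_mul _).add (m2.const_mul _)
  have hΨ0 : ∀ s S, 0 ≤ Ψ s S := fun s S =>
    add_nonneg (mul_nonneg hp0 (h0 _ _)) (mul_nonneg (sub_nonneg.2 hp1) (h0 _ _))
  have step1 := integrable_and_integral_le_of_indepFun (P := P)
    (hY.mono (h.adm.past_le _) le_rfl) (hsets.mono (h.adm.fresh_le _) le_rfl)
    (h.adm.indepFun_past_fresh hY hsets) (Φ := Ψ) (φ := φ) hΨm hΨ0
    (fun s => (integrable_const _).add ((hle s).1.const_mul _))
    (fun s => by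
      simp only [hΨ]
      rw [integral_add (integrable_const _) ((hle s).1.const_mul _), integral_const,
        integral_const_mul]
      simpa using (hle s).2) hφ
  have hX : Measurable[R.past (5 * k + 5)] fun a =>
      ((run G θ x₀ R k a, vNext G θ x₀ R k a), fun i => R.upSet k i a) :=
    Measurable.prodMk (hY.mono (R.past_mono (by omega)) le_rfl)
      (hsets.mono (R.fresh_le_past (by omega)) le_rfl)
  have hc := R.measurable_upCoin k
  have step2 := integrable_and_integral_le_of_indepFun (P := P)
    (hX.mono (h.adm.past_le _) le_rfl) (hc.mono (h.adm.fresh_le _) le_rfl)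
    (h.adm.indepFun_past_fresh hX hc)
    (Φ := fun q c => Φ q.1 (nextG θ q.1.1 q.1.2 q.2 c)) (φ := fun q => Ψ q.1 q.2)
    (hΦ.comp (Measurable.prodMk (by fun_prop) (measurable_nextG (by fun_prop) (by fun_prop)
      (by fun_prop) (by fun_prop)))) (fun _ _ => h0 _ _)
    (fun q => by
      refine ((h.adm.upCoin_law k).integral_ite (Φ q.1 (nextG θ q.1.1 q.1.2 q.2 true))
        (Φ q.1 (nextG θ q.1.1 q.1.2 q.2 false))).1.congr (Filter.Eventually.of_forall fun a => ?_)
      dsimp only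
      cases R.upCoin k a <;> rfl)
    (fun q => by
      have e := ((h.adm.upCoin_law k).integral_ite (Φ q.1 (nextG θ q.1.1 q.1.2 q.2 true))
        (Φ q.1 (nextG θ q.1.1 q.1.2 q.2 false))).2
      refine le_of_eq (Eq.trans (integral_congr_ae (Filter.Eventually.of_forall fun a => ?_)) e)
      dsimp only
      cases R.upCoin k a <;> rfl) step1.1
  exact ⟨step2.1, step2.2.trans step1.2⟩

end Setting

/-! ### One-step inequalities for the energies -/

namespace Setting

variable {Ω Ξ : Type*} [MeasurableSpace Ω] [MeasurableSpace Ξ] {n d : ℕ} {P : Measure Ω}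
  {D : Fin n → Measure Ξ} {f : Fin n → Vec d → ℝ}
  {G : Fin n → Vec d → Ξ → Vec d} {R : Draws Ω Ξ n d} {θ : Params} {η L LA LB σ fstar : ℝ}
  {x₀ : Vec d}

theorem measurable_gradient_objective (h : Setting P D f G R θ η L LA LB σ fstar) :
    Measurable fun x => ∇ (objective f) x :=
  (isSmooth_objective h.n_pos h.smooth).continuous_gradient.measurable

theorem measurable_gradient (h : Setting P D f G R θ η L LA LB σ fstar) (i : Fin n) :
    Measurable fun x => ∇ (f i) x :=
  (h.smooth i).continuous_gradient.measurable

/-- The energies of the local iterates, along every path. -/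
theorem enY_succ_le (h : Setting P D f G R θ η L LA LB σ fstar) (k : ℕ) (a : Ω) :
    enY (run G θ x₀ R (k + 1) a) ≤ (1 - η / 2) * enY (run G θ x₀ R k a)
      + (3 / η * enX θ (run G θ x₀ R k a) + η * enW (run G θ x₀ R (k + 1) a)) := by
  rw [run_succ]
  simp only [enY, enW, enX, nextY, h.μ_eq]
  set s := run G θ x₀ R k a
  set w := wNext G θ x₀ R k a
  have h1 := mean_mono fun i => norm_momentum_sq_le h.η_pos h.η_le (s.y i - s.x)
    (nextX θ s - s.x) (w i - nextX θ s)
  simp only [mean_add, mean_mul, mean_const h.n_pos] at h1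
  refine le_of_eq_of_le ?_ h1
  congr 1
  funext i
  congr 2
  module

theorem enYb_succ_le (h : Setting P D f G R θ η L LA LB σ fstar) (k : ℕ) (a : Ω) :
    enYb (run G θ x₀ R (k + 1) a) ≤ (1 - η / 2) * enYb (run G θ x₀ R k a)
      + (3 / η * enX θ (run G θ x₀ R k a) + η * enWb (run G θ x₀ R (k + 1) a)) := by
  rw [run_succ]
  simp only [enYb, enWb, enX]
  set s := run G θ x₀ R k a
  set w := wNext G θ x₀ R k a
  have h1 := norm_momentum_sq_le h.η_pos h.η_le (mean s.y - s.x)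
    (nextX θ s - s.x) (mean w - nextX θ s)
  refine le_of_eq_of_le ?_ h1
  congr 2
  have : mean (nextY θ s w) = (1 - η) • mean s.y + η • mean w := by
    unfold nextY
    rw [h.μ_eq, mean_add, mean_smul, mean_smul]
  rw [this]
  module

theorem enZ_succ_eq (h : Setting P D f G R θ η L LA LB σ fstar) (k : ℕ) (a : Ω) :
    enZ (run G θ x₀ R (k + 1) a)
      = (1 - η) ^ 2 * enQ (run G θ x₀ R k a) (wNext G θ x₀ R k a) := by
  rw [run_succ]
  simp only [enZ, enQ, nextY, h.μ_eq]
  rw [← mean_mul]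
  congr 1
  funext i
  rw [← sq_abs (1 - η), ← Real.norm_eq_abs, ← mul_pow, ← norm_smul]
  congr 2
  module

theorem nextV_eq (h : Setting P D f G R θ η L LA LB σ fstar) (s : State n d)
    (w : Fin n → Vec d) (ξ : Fin n → ℕ → Ξ) (i : Fin n) :
    nextV G θ s w ξ i = (1 - η) • s.v i + η • ∇ (f i) (nextY θ s w i)
      + η • (miniBatch (G i) θ.b (nextY θ s w i) (ξ i) - ∇ (f i) (nextY θ s w i)) := by
  simp only [nextV, h.ν_eq]
  module

theorem mean_nextV_eq (h : Setting P D f G R θ η L LA LB σ fstar) (s : State n d)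
    (w : Fin n → Vec d) (ξ : Fin n → ℕ → Ξ) :
    mean (nextV G θ s w ξ) = (1 - η) • mean s.v + η • (mean fun i => ∇ (f i) (nextY θ s w i))
      + η • mean (fun i => miniBatch (G i) θ.b (nextY θ s w i) (ξ i)
        - ∇ (f i) (nextY θ s w i)) := by
  have : nextV G θ s w ξ = fun i => (1 - η) • s.v i + η • ∇ (f i) (nextY θ s w i)
      + η • (miniBatch (G i) θ.b (nextY θ s w i) (ξ i) - ∇ (f i) (nextY θ s w i)) :=
    funext fun i => h.nextV_eq s w ξ i
  rw [this, mean_add, mean_add, mean_smul, mean_smul, mean_smul]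

variable [IsProbabilityMeasure P]

theorem integral_affine {A B C : Ω → ℝ} (hA : Integrable A P) (hB : Integrable B P)
    (hC : Integrable C P) (c₀ c₁ c₂ c₃ : ℝ) :
    Integrable (fun a => c₀ + c₁ * A a + c₂ * B a + c₃ * C a) P ∧
      ∫ a, (c₀ + c₁ * A a + c₂ * B a + c₃ * C a) ∂P
        = c₀ + c₁ * ∫ a, A a ∂P + c₂ * ∫ a, B a ∂P + c₃ * ∫ a, C a ∂P := by
  have i1 : Integrable (fun a => c₀ + c₁ * A a) P := (integrable_const _).add (hA.const_mul _)
  have i2 : Integrable (fun a => c₀ + c₁ * A a + c₂ * B a) P := i1.add (hB.const_mul _)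
  refine ⟨i2.add (hC.const_mul _), ?_⟩
  rw [integral_add i2 (hC.const_mul _), integral_add i1 (hB.const_mul _),
    integral_add (integrable_const _) (hA.const_mul _), integral_const_mul, integral_const_mul,
    integral_const_mul]
  simp

/-- The coin resets the lag to zero; otherwise the old lag persists and acquires a centred
compression error of second moment ω_s‖x^{k+1} − x^k‖². -/
theorem W_stage (h : Setting P D f G R θ η L LA LB σ fstar) (k : ℕ)
    (hW : Integrable (fun a => enW (run G θ x₀ R k a)) P)
    (hX : Integrable (fun a => enX θ (run G θ x₀ R k a)) P) :
    Integrable (fun a => enW (run G θ x₀ R (k + 1) a)) P ∧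
      ∫ a, enW (run G θ x₀ R (k + 1) a) ∂P ≤ (1 - 1 / (omega d θ.kDown + 1)) *
        (∫ a, enW (run G θ x₀ R k a) ∂P + omega d θ.kDown * ∫ a, enX θ (run G θ x₀ R k a) ∂P) := by
  have key := h.down_stage (x₀ := x₀) k
    (Φ := fun s w => mean fun i => ‖w i - nextX θ s‖ ^ 2)
    (φ := fun s => (1 - θ.pDown) * (enW s + omega d θ.kDown * enX θ s))
    (measurable_mean fun i => by fun_prop) (fun s w => mean_sq_nonneg _)
    (fun s => by
      have e : ∀ a i, nextW θ s (fun i => R.downSet k i a) false i - nextX θ s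
          = (s.w i - s.x) + (randK θ.kDown (R.downSet k i a) (nextX θ s - s.x)
            - (nextX θ s - s.x)) := fun a i => by
        simp only [nextW, Bool.false_eq_true, if_false]
        abel
      have h1 := integral_mean_norm_add_randK_sq (P := P) (fun i => h.adm.downSet_law k i)
        h.kDown_pos h.kDown_le h.n_pos (fun i => s.w i - s.x) (nextX θ s - s.x)
      simp only [e]
      refine ⟨h1.1, ?_⟩
      rw [h1.2]
      simp [mean, enW, enX])
    ((hW.add (hX.const_mul _)).const_mul _)
  refine ⟨key.1, key.2.trans_eq ?_⟩
  rw [integral_const_mul, integral_add hW (hX.const_mul _), integral_const_mul, h.pDown_eq]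

/-- As for `W_stage`, with the compression error averaged over independent compressors. -/
theorem Wb_stage (h : Setting P D f G R θ η L LA LB σ fstar) (k : ℕ)
    (hW : Integrable (fun a => enWb (run G θ x₀ R k a)) P)
    (hX : Integrable (fun a => enX θ (run G θ x₀ R k a)) P) :
    Integrable (fun a => enWb (run G θ x₀ R (k + 1) a)) P ∧
      ∫ a, enWb (run G θ x₀ R (k + 1) a) ∂P ≤ (1 - 1 / (omega d θ.kDown + 1)) *
        (∫ a, enWb (run G θ x₀ R k a) ∂P
          + omega d θ.kDown / n * ∫ a, enX θ (run G θ x₀ R k a) ∂P) := by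
  have key := h.down_stage (x₀ := x₀) k
    (Φ := fun s w => ‖mean w - nextX θ s‖ ^ 2)
    (φ := fun s => (1 - θ.pDown) * (enWb s + omega d θ.kDown / n * enX θ s))
    (((measurable_mean_pi measurable_snd).sub
      (measurable_nextX measurable_fst)).norm.pow_const 2) (fun s w => sq_nonneg _)
    (fun s => by
      have e : ∀ a, mean (nextW θ s (fun i => R.downSet k i a) false) - nextX θ s
          = (mean s.w - s.x) + mean fun i => randK θ.kDown (R.downSet k i a) (nextX θ s - s.x)
            - (nextX θ s - s.x) := fun a => by
        have e1 : nextW θ s (fun i => R.downSet k i a) false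
            = fun i => s.w i + randK θ.kDown (R.downSet k i a) (nextX θ s - s.x) := rfl
        rw [e1, mean_add, mean_sub, mean_const h.n_pos]
        abel
      have h1 := integral_norm_add_mean_randK_sq (P := P) (fun i => h.adm.downSet_law k i)
        (fun i j hij => h.adm.indepFun_downSet k i j hij)
        h.kDown_pos h.kDown_le (mean s.w - s.x) fun _ => (nextX θ s - s.x)
      simp only [e]
      refine ⟨h1.1, ?_⟩
      rw [h1.2, mean_const h.n_pos, mean_const h.n_pos]
      simp [enWb, enX])
    ((hW.add (hX.const_mul _)).const_mul _)
  refine ⟨key.1, key.2.trans_eq ?_⟩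
  rw [integral_const_mul, integral_add hW (hX.const_mul _), integral_const_mul, h.pDown_eq]

/-- The compression error is centred and adds its variance; the coin is handled by
`coin_displacement_le` with z = w_i − y_i and u = w_i − x. -/
theorem Q_stage (h : Setting P D f G R θ η L LA LB σ fstar) (k : ℕ)
    (hW : Integrable (fun a => enW (run G θ x₀ R k a)) P)
    (hZ : Integrable (fun a => enZ (run G θ x₀ R k a)) P)
    (hX : Integrable (fun a => enX θ (run G θ x₀ R k a)) P) :
    Integrable (fun a => enQ (run G θ x₀ R k a) (wNext G θ x₀ R k a)) P ∧
      ∫ a, enQ (run G θ x₀ R k a) (wNext G θ x₀ R k a) ∂P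
        ≤ (1 + η) * ∫ a, enZ (run G θ x₀ R k a) ∂P
          + ((1 + 1 / η) * (2 * ∫ a, enX θ (run G θ x₀ R k a) ∂P
              + 2 * (1 / (omega d θ.kDown + 1)) ^ 2 * ∫ a, enW (run G θ x₀ R k a) ∂P)
            + 1 / (omega d θ.kDown + 1) * ∫ a, enW (run G θ x₀ R k a) ∂P
            + omega d θ.kDown * ∫ a, enX θ (run G θ x₀ R k a) ∂P) := by
  obtain ⟨hp0, hp1⟩ := h.pDown_mem
  have hω := omega_nonneg h.kDown_pos h.kDown_le
  have lin := integral_affine hZ hX hW 0 (1 + η) (2 * (1 + 1 / η) + omega d θ.kDown)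
    (2 * (1 + 1 / η) * θ.pDown ^ 2 + θ.pDown)
  have e0 : (fun a => 0 + (1 + η) * enZ (run G θ x₀ R k a)
      + (2 * (1 + 1 / η) + omega d θ.kDown) * enX θ (run G θ x₀ R k a)
      + (2 * (1 + 1 / η) * θ.pDown ^ 2 + θ.pDown) * enW (run G θ x₀ R k a))
      = fun a => (1 + η) * enZ (run G θ x₀ R k a) + ((1 + 1 / η) * (2 * enX θ (run G θ x₀ R k a)
        + 2 * θ.pDown ^ 2 * enW (run G θ x₀ R k a)) + θ.pDown * enW (run G θ x₀ R k a)
        + omega d θ.kDown * enX θ (run G θ x₀ R k a)) := by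
    funext a
    ring
  rw [e0] at lin
  have key := h.down_stage (x₀ := x₀) k (Φ := enQ)
    (φ := fun s => (1 + η) * enZ s + ((1 + 1 / η) * (2 * enX θ s + 2 * θ.pDown ^ 2 * enW s)
      + θ.pDown * enW s + omega d θ.kDown * enX θ s))
    (measurable_mean fun i => by fun_prop) (fun s w => mean_sq_nonneg _)
    (fun s => by
      have e : ∀ a i, nextW θ s (fun i => R.downSet k i a) false i - s.y i
          = (s.w i - s.y i + (nextX θ s - s.x)) + (randK θ.kDown (R.downSet k i a)
            (nextX θ s - s.x) - (nextX θ s - s.x)) := fun a i => by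
        simp only [nextW, Bool.false_eq_true, if_false]
        abel
      have h1 := integral_mean_norm_add_randK_sq (P := P) (fun i => h.adm.downSet_law k i)
        h.kDown_pos h.kDown_le h.n_pos (fun i => s.w i - s.y i + (nextX θ s - s.x))
        (nextX θ s - s.x)
      simp only [enQ, e]
      refine ⟨h1.1, ?_⟩
      rw [h1.2]
      have h2 := mean_mono fun i => coin_displacement_le h.η_pos θ.pDown (s.w i - s.y i)
        (s.w i - s.x) (nextX θ s - s.x)
      simp only [mean_add, mean_mul, mean_const h.n_pos] at h2
      have e2 : ∀ i, s.w i - s.y i + (nextX θ s - s.x) - (s.w i - s.x) = nextX θ s - s.y i :=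
        fun i => by abel
      simp only [e2] at h2
      have h3 : 0 ≤ θ.pDown * (omega d θ.kDown * ‖nextX θ s - s.x‖ ^ 2) := by positivity
      simp only [enW, enX, enZ]
      linarith)
    lin.1
  refine ⟨key.1, key.2.trans_eq (lin.2.trans ?_)⟩
  rw [h.pDown_eq]
  ring

/-- The new error is a convex combination of the old one, displaced by the change of ∇f, and of the
mean of ∇f_i(y_i) − ∇f_i(x), plus fresh centred noise. The second component is the only place where
the similarity inequality enters. -/
theorem e_stage (h : Setting P D f G R θ η L LA LB σ fstar) (k : ℕ)
    (he : Integrable (fun a => ene f (run G θ x₀ R k a)) P)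
    (hX : Integrable (fun a => enX θ (run G θ x₀ R k a)) P)
    (hY : Integrable (fun a => enY (run G θ x₀ R (k + 1) a)) P)
    (hYb : Integrable (fun a => enYb (run G θ x₀ R (k + 1) a)) P) :
    Integrable (fun a => ene f (run G θ x₀ R (k + 1) a)) P ∧
      ∫ a, ene f (run G θ x₀ R (k + 1) a) ∂P ≤ (1 - η) * ∫ a, ene f (run G θ x₀ R k a) ∂P
        + (2 / η * L ^ 2 * ∫ a, enX θ (run G θ x₀ R k a) ∂P
          + 4 * η * (LA ^ 2 * ∫ a, enY (run G θ x₀ R (k + 1) a) ∂P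
            + LB ^ 2 * ∫ a, enYb (run G θ x₀ R (k + 1) a) ∂P) + η ^ 2 * (σ ^ 2 / θ.b) / n) := by
  have hobj := isSmooth_objective h.n_pos h.smooth
  have hη := h.η_pos
  have lin1 := integral_affine hX hY hYb (η ^ 2 * (σ ^ 2 / θ.b) / n) (2 / η * L ^ 2)
    (4 * η * LA ^ 2) (4 * η * LB ^ 2)
  have lin := integral_affine he lin1.1 lin1.1 0 (1 - η) 1 0
  rw [lin1.2] at lin
  have e0 : (fun a => (1 - η) * ene f (run G θ x₀ R k a)
      + (2 / η * L ^ 2 * enX θ (run G θ x₀ R k a) + 4 * η * (LA ^ 2 * enY (run G θ x₀ R (k + 1) a)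
        + LB ^ 2 * enYb (run G θ x₀ R (k + 1) a)) + η ^ 2 * (σ ^ 2 / θ.b) / n))
      = fun a => 0 + (1 - η) * ene f (run G θ x₀ R k a) + 1 * (η ^ 2 * (σ ^ 2 / θ.b) / n
        + 2 / η * L ^ 2 * enX θ (run G θ x₀ R k a) + 4 * η * LA ^ 2 * enY (run G θ x₀ R (k + 1) a)
        + 4 * η * LB ^ 2 * enYb (run G θ x₀ R (k + 1) a)) + 0 * (η ^ 2 * (σ ^ 2 / θ.b) / n
        + 2 / η * L ^ 2 * enX θ (run G θ x₀ R k a) + 4 * η * LA ^ 2 * enY (run G θ x₀ R (k + 1) a)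
        + 4 * η * LB ^ 2 * enYb (run G θ x₀ R (k + 1) a)) := by
    funext a
    ring
  rw [← e0] at lin
  have key := h.sample_stage (x₀ := x₀) k
    (Φ := fun q v => ‖mean v - ∇ (objective f) (nextX θ q.1)‖ ^ 2)
    (φ := fun q => (1 - η) * ene f q.1 + (2 / η * L ^ 2 * enX θ q.1
      + 4 * η * (LA ^ 2 * (mean fun i => ‖nextY θ q.1 q.2 i - nextX θ q.1‖ ^ 2)
        + LB ^ 2 * ‖mean (nextY θ q.1 q.2) - nextX θ q.1‖ ^ 2) + η ^ 2 * (σ ^ 2 / θ.b) / n))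
    (((measurable_mean_pi measurable_snd).sub (h.measurable_gradient_objective.comp
      (measurable_nextX (by fun_prop)))).norm.pow_const 2) (fun q v => sq_nonneg _)
    (fun q => by
      obtain ⟨s, w⟩ := q
      dsimp only
      have h1 := integral_norm_add_mean_miniBatch_sq (P := P) h.grad
        (fun i r => h.adm.sample_measurable (k + 1) i r)
        (fun i r => h.adm.sample_law (k + 1) i r)
        (fun i j r t hij => h.adm.indepFun_sample (k + 1) i j r t hij) h.b_pos h.n_pos
        ((1 - η) • ((mean s.v - ∇ (objective f) s.x)
          + (∇ (objective f) s.x - ∇ (objective f) (nextX θ s)))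
          + η • (mean fun i => ∇ (f i) (nextX θ s + (nextY θ s w i - nextX θ s))
            - ∇ (f i) (nextX θ s))) (nextY θ s w) η
      have e : ∀ a, mean (nextV G θ s w fun i r => R.sample (k + 1) i r a)
          - ∇ (objective f) (nextX θ s)
          = ((1 - η) • ((mean s.v - ∇ (objective f) s.x)
          + (∇ (objective f) s.x - ∇ (objective f) (nextX θ s)))
          + η • (mean fun i => ∇ (f i) (nextX θ s + (nextY θ s w i - nextX θ s))
            - ∇ (f i) (nextX θ s))) + η • mean (fun i => miniBatch (G i) θ.b (nextY θ s w i)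
              (fun r => R.sample (k + 1) i r a) - ∇ (f i) (nextY θ s w i)) := fun a => by
        rw [h.mean_nextV_eq, mean_sub (fun i => ∇ (f i) (nextX θ s + (nextY θ s w i - nextX θ s))),
          ← gradient_objective fun i => (h.smooth i).1]
        simp only [add_sub_cancel]
        module
      simp only [e]
      refine ⟨h1.1, h1.2.trans ?_⟩
      have h2 := norm_estimator_sq_le hη h.η_le (mean s.v - ∇ (objective f) s.x)
        (∇ (objective f) s.x - ∇ (objective f) (nextX θ s))
        (mean fun i => ∇ (f i) (nextX θ s + (nextY θ s w i - nextX θ s)) - ∇ (f i) (nextX θ s))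
      have h3 := h.sim.2.2 (nextX θ s) fun i => nextY θ s w i - nextX θ s
      have e3 : mean (fun i => nextY θ s w i - nextX θ s) = mean (nextY θ s w) - nextX θ s := by
        rw [mean_sub, mean_const h.n_pos]
      rw [e3] at h3
      have h4 := pow_le_pow_left₀ (norm_nonneg _) (hobj.2 s.x (nextX θ s)) 2
      rw [mul_pow, norm_sub_rev s.x] at h4
      have h5 := mul_le_mul_of_nonneg_left h4 (show 0 ≤ 2 / η by positivity)
      have h6 := mul_le_mul_of_nonneg_left h3 (show 0 ≤ 4 * η by positivity)
      simp only [ene, enX]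
      linarith)
    lin.1
  refine ⟨key.1, key.2.trans_eq (lin.2.trans ?_)⟩
  ring

/-- Each v_i is compared with the gradient at its own local iterate, whose move is η(w_i − y_i);
only the smoothness of f_i is needed. -/
theorem E_stage (h : Setting P D f G R θ η L LA LB σ fstar) (k : ℕ)
    (hE : Integrable (fun a => enE f (run G θ x₀ R k a)) P)
    (hQ : Integrable (fun a => enQ (run G θ x₀ R k a) (wNext G θ x₀ R k a)) P) :
    Integrable (fun a => enE f (run G θ x₀ R (k + 1) a)) P ∧
      ∫ a, enE f (run G θ x₀ R (k + 1) a) ∂P ≤ (1 - η) * ∫ a, enE f (run G θ x₀ R k a) ∂P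
        + (η * L ^ 2 * ∫ a, enQ (run G θ x₀ R k a) (wNext G θ x₀ R k a) ∂P
          + η ^ 2 * (σ ^ 2 / θ.b)) := by
  have hη := h.η_pos
  have lin := integral_affine hE hQ hQ (η ^ 2 * (σ ^ 2 / θ.b)) (1 - η) (η * L ^ 2) 0
  have e0 : (fun a => η ^ 2 * (σ ^ 2 / θ.b) + (1 - η) * enE f (run G θ x₀ R k a)
      + η * L ^ 2 * enQ (run G θ x₀ R k a) (wNext G θ x₀ R k a)
      + 0 * enQ (run G θ x₀ R k a) (wNext G θ x₀ R k a))
      = fun a => (1 - η) * enE f (run G θ x₀ R k a)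
        + (η * L ^ 2 * enQ (run G θ x₀ R k a) (wNext G θ x₀ R k a) + η ^ 2 * (σ ^ 2 / θ.b)) := by
    funext a
    ring
  rw [e0] at lin
  have key := h.sample_stage (x₀ := x₀) k
    (Φ := fun q v => mean fun i => ‖v i - ∇ (f i) (nextY θ q.1 q.2 i)‖ ^ 2)
    (φ := fun q => (1 - η) * enE f q.1 + (η * L ^ 2 * enQ q.1 q.2 + η ^ 2 * (σ ^ 2 / θ.b)))
    (measurable_mean fun i => by
      have m1 : Measurable fun q : (State n d × (Fin n → Vec d)) × (Fin n → Vec d) =>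
          ∇ (f i) (nextY θ q.1.1 q.1.2 i) :=
        (h.measurable_gradient i).comp ((measurable_pi_apply i).comp
          (measurable_nextY (by fun_prop) (by fun_prop)))
      fun_prop) (fun q v => mean_sq_nonneg _)
    (fun q => by
      obtain ⟨s, w⟩ := q
      dsimp only
      have h1 := integral_mean_norm_add_miniBatch_sq (P := P) h.grad
        (fun i r => h.adm.sample_measurable (k + 1) i r)
        (fun i r => h.adm.sample_law (k + 1) i r)
        (fun i j r t hij => h.adm.indepFun_sample (k + 1) i j r t hij) h.b_pos h.n_pos
        (fun i => (1 - η) • ((s.v i - ∇ (f i) (s.y i))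
          + (∇ (f i) (s.y i) - ∇ (f i) (nextY θ s w i)))) (nextY θ s w) η
      have e : ∀ a i, nextV G θ s w (fun i r => R.sample (k + 1) i r a) i
          - ∇ (f i) (nextY θ s w i)
          = (1 - η) • ((s.v i - ∇ (f i) (s.y i)) + (∇ (f i) (s.y i) - ∇ (f i) (nextY θ s w i)))
            + η • (miniBatch (G i) θ.b (nextY θ s w i)
              (fun r => R.sample (k + 1) i r a) - ∇ (f i) (nextY θ s w i)) := fun a i => by
        rw [h.nextV_eq]
        module
      simp only [e]
      refine ⟨h1.1, h1.2.trans ?_⟩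
      have h2 : ∀ i, ‖(1 - η) • ((s.v i - ∇ (f i) (s.y i))
          + (∇ (f i) (s.y i) - ∇ (f i) (nextY θ s w i)))‖ ^ 2
          ≤ (1 - η) * ‖s.v i - ∇ (f i) (s.y i)‖ ^ 2 + η * L ^ 2 * ‖w i - s.y i‖ ^ 2 := fun i => by
        have h3 := norm_worker_sq_le hη h.η_le (s.v i - ∇ (f i) (s.y i))
          (∇ (f i) (s.y i) - ∇ (f i) (nextY θ s w i))
        have h4 := pow_le_pow_left₀ (norm_nonneg _) ((h.smooth i).2 (s.y i) (nextY θ s w i)) 2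
        have e4 : s.y i - nextY θ s w i = -(η • (w i - s.y i)) := by
          simp only [nextY, h.μ_eq]
          module
        rw [e4, norm_neg, norm_smul, Real.norm_of_nonneg hη.le] at h4
        have h5 := mul_le_mul_of_nonneg_left h4 (show 0 ≤ 1 / η by positivity)
        have e5 : 1 / η * (L * (η * ‖w i - s.y i‖)) ^ 2 = η * L ^ 2 * ‖w i - s.y i‖ ^ 2 := by
          field_simp
        linarith
      have h3 := mean_mono h2
      simp only [mean_add, mean_mul] at h3
      simp only [enE, enQ]
      linarith)
    lin.1
  refine ⟨key.1, key.2.trans_eq (lin.2.trans ?_)⟩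
  ring

/-- The increment of v_i is η times the old error plus the gradient change, up to sign, and fresh
noise; hence the factor η² throughout. -/
theorem V_stage (h : Setting P D f G R θ η L LA LB σ fstar) (k : ℕ)
    (hE : Integrable (fun a => enE f (run G θ x₀ R k a)) P)
    (hQ : Integrable (fun a => enQ (run G θ x₀ R k a) (wNext G θ x₀ R k a)) P) :
    Integrable (fun a => enV (run G θ x₀ R k a) (vNext G θ x₀ R k a)) P ∧
      ∫ a, enV (run G θ x₀ R k a) (vNext G θ x₀ R k a) ∂P ≤ η ^ 2 * (σ ^ 2 / θ.b)
        + 2 * η ^ 2 * ∫ a, enE f (run G θ x₀ R k a) ∂P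
        + 2 * η ^ 4 * L ^ 2 * ∫ a, enQ (run G θ x₀ R k a) (wNext G θ x₀ R k a) ∂P := by
  have hη := h.η_pos
  have lin := integral_affine hE hQ hQ (η ^ 2 * (σ ^ 2 / θ.b)) (2 * η ^ 2) (2 * η ^ 4 * L ^ 2) 0
  simp only [zero_mul, add_zero] at lin
  have key := h.sample_stage (x₀ := x₀) k
    (Φ := fun q v => enV q.1 v)
    (φ := fun q => η ^ 2 * (σ ^ 2 / θ.b) + 2 * η ^ 2 * enE f q.1
      + 2 * η ^ 4 * L ^ 2 * enQ q.1 q.2)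
    (measurable_mean fun i => by fun_prop) (fun q v => mean_sq_nonneg _)
    (fun q => by
      obtain ⟨s, w⟩ := q
      dsimp only
      have h1 := integral_mean_norm_add_miniBatch_sq (P := P) h.grad
        (fun i r => h.adm.sample_measurable (k + 1) i r)
        (fun i r => h.adm.sample_law (k + 1) i r)
        (fun i j r t hij => h.adm.indepFun_sample (k + 1) i j r t hij) h.b_pos h.n_pos
        (fun i => -(η • ((s.v i - ∇ (f i) (s.y i))
          + (∇ (f i) (s.y i) - ∇ (f i) (nextY θ s w i))))) (nextY θ s w) η
      have e : ∀ a i, nextV G θ s w (fun i r => R.sample (k + 1) i r a) i - s.v i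
          = -(η • ((s.v i - ∇ (f i) (s.y i)) + (∇ (f i) (s.y i) - ∇ (f i) (nextY θ s w i))))
            + η • (miniBatch (G i) θ.b (nextY θ s w i)
              (fun r => R.sample (k + 1) i r a) - ∇ (f i) (nextY θ s w i)) := fun a i => by
        rw [h.nextV_eq]
        module
      simp only [enV, e]
      refine ⟨h1.1, h1.2.trans ?_⟩
      have h2 : ∀ i, ‖-(η • ((s.v i - ∇ (f i) (s.y i))
          + (∇ (f i) (s.y i) - ∇ (f i) (nextY θ s w i))))‖ ^ 2
          ≤ 2 * η ^ 2 * ‖s.v i - ∇ (f i) (s.y i)‖ ^ 2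
            + 2 * η ^ 4 * L ^ 2 * ‖w i - s.y i‖ ^ 2 := fun i => by
        have h3 := norm_add_sq_le_two (s.v i - ∇ (f i) (s.y i))
          (∇ (f i) (s.y i) - ∇ (f i) (nextY θ s w i))
        have h4 := pow_le_pow_left₀ (norm_nonneg _) ((h.smooth i).2 (s.y i) (nextY θ s w i)) 2
        have e4 : s.y i - nextY θ s w i = -(η • (w i - s.y i)) := by
          simp only [nextY, h.μ_eq]
          module
        rw [e4, norm_neg, norm_smul, Real.norm_of_nonneg hη.le] at h4
        rw [norm_neg, norm_smul, Real.norm_of_nonneg hη.le, mul_pow]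
        have h5 := mul_le_mul_of_nonneg_left (h3.trans (add_le_add le_rfl
          (mul_le_mul_of_nonneg_left h4 zero_le_two))) (sq_nonneg η)
        linarith
      have h3 := mean_mono h2
      simp only [mean_add, mean_mul] at h3
      simp only [enE, enQ]
      linarith)
    lin.1
  exact ⟨key.1, key.2.trans_eq lin.2⟩

/-- The coin makes g exact; otherwise the old gap persists and independent centred compression
errors of the increments are added. -/
theorem G_stage (h : Setting P D f G R θ η L LA LB σ fstar) (k : ℕ)
    (hG : Integrable (fun a => enG (run G θ x₀ R k a)) P)
    (hV : Integrable (fun a => enV (run G θ x₀ R k a) (vNext G θ x₀ R k a)) P) :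
    Integrable (fun a => enG (run G θ x₀ R (k + 1) a)) P ∧
      ∫ a, enG (run G θ x₀ R (k + 1) a) ∂P ≤ (1 - 1 / (omega d θ.kUp + 1)) *
        (∫ a, enG (run G θ x₀ R k a) ∂P
          + omega d θ.kUp / n * ∫ a, enV (run G θ x₀ R k a) (vNext G θ x₀ R k a) ∂P) := by
  have key := h.up_stage (x₀ := x₀) k
    (Φ := fun q g => ‖g - mean q.2‖ ^ 2)
    (φ := fun q => (1 - θ.pUp) * (enG q.1 + omega d θ.kUp / n * enV q.1 q.2))
    ((measurable_snd.sub (measurable_mean_pi (by fun_prop))).norm.pow_const 2)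
    (fun q g => sq_nonneg _)
    (fun q => by
      obtain ⟨s, v⟩ := q
      have e : ∀ a, nextG θ s v (fun i => R.upSet k i a) false - mean v
          = (s.g - mean s.v) + mean fun i => randK θ.kUp (R.upSet k i a) (v i - s.v i)
            - (v i - s.v i) := fun a => by
        simp only [nextG, Bool.false_eq_true, if_false]
        rw [mean_sub, mean_sub]
        abel
      have h1 := integral_norm_add_mean_randK_sq (P := P) (fun i => h.adm.upSet_law k i)
        (fun i j hij => h.adm.indepFun_upSet k i j hij)
        h.kUp_pos h.kUp_le (s.g - mean s.v) fun i => v i - s.v i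
      simp only [e]
      refine ⟨h1.1, ?_⟩
      rw [h1.2]
      simp [enG, enV])
    ((hG.add (hV.const_mul _)).const_mul _)
  refine ⟨key.1, key.2.trans_eq ?_⟩
  rw [integral_const_mul, integral_add hG (hV.const_mul _), integral_const_mul, h.pUp_eq]

end Setting

/-! ### Integrability and the recursion for the expectations -/

namespace Setting

variable {Ω Ξ : Type*} [MeasurableSpace Ω] [MeasurableSpace Ξ] {n d : ℕ} {P : Measure Ω}
  {D : Fin n → Measure Ξ} {f : Fin n → Vec d → ℝ}
  {G : Fin n → Vec d → Ξ → Vec d} {R : Draws Ω Ξ n d} {θ : Params} {η L LA LB σ fstar : ℝ}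
  {x₀ : Vec d}

theorem enX_le (h : Setting P D f G R θ η L LA LB σ fstar) (s : State n d) :
    enX θ s ≤ θ.γ ^ 2 * (2 * enG s + 4 * ene f s + 4 * enN f s) := by
  have e : nextX θ s - s.x = -(θ.γ • s.g) := by
    simp only [nextX]
    abel
  have h1 := norm_add_sq_le_two (s.g - mean s.v) (mean s.v)
  have h2 := norm_add_sq_le_two (mean s.v - ∇ (objective f) s.x) (∇ (objective f) s.x)
  rw [sub_add_cancel] at h1 h2
  rw [enX, e, norm_neg, norm_smul, mul_pow, Real.norm_of_nonneg h.γ_pos.le]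
  refine mul_le_mul_of_nonneg_left ?_ (sq_nonneg _)
  simp only [enG, ene, enN]
  linarith

/-- Crude growth, needed only to propagate integrability. -/
theorem enN_succ_le (h : Setting P D f G R θ η L LA LB σ fstar) (k : ℕ) (a : Ω) :
    enN f (run G θ x₀ R (k + 1) a)
      ≤ 2 * enN f (run G θ x₀ R k a) + 2 * L ^ 2 * enX θ (run G θ x₀ R k a) := by
  rw [run_succ]
  simp only [enN, enX]
  set s := run G θ x₀ R k a
  have h1 := norm_add_sq_le_two (∇ (objective f) s.x)
    (∇ (objective f) (nextX θ s) - ∇ (objective f) s.x)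
  have h2 := pow_le_pow_left₀ (norm_nonneg _)
    ((isSmooth_objective h.n_pos h.smooth).2 (nextX θ s) s.x) 2
  rw [add_sub_cancel] at h1
  rw [mul_pow] at h2
  linarith

theorem enF_succ_le (h : Setting P D f G R θ η L LA LB σ fstar) (k : ℕ) (a : Ω) :
    enF f fstar (run G θ x₀ R (k + 1) a) + θ.γ / 2 * enN f (run G θ x₀ R k a)
      + (1 / (2 * θ.γ) - L / 2) * enX θ (run G θ x₀ R k a)
      ≤ enF f fstar (run G θ x₀ R k a)
        + θ.γ * (enG (run G θ x₀ R k a) + ene f (run G θ x₀ R k a)) := by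
  rw [run_succ]
  simp only [enF, enN, enX, enG, ene]
  set s := run G θ x₀ R k a
  have e : nextX θ s - s.x = -(θ.γ • s.g) := by
    simp only [nextX]
    abel
  have h1 := (isSmooth_objective h.n_pos h.smooth).descent h.γ_pos s.x s.g (mean s.v)
  rw [e, norm_neg]
  simp only [nextX]
  linarith

theorem measurable_enY : Measurable (enY : State n d → ℝ) := by
  have h : Measurable fun (s : State n d) (i : Fin n) => s.y i - s.x :=
    measurable_pi_lambda _ fun i => by fun_prop
  unfold enY
  exact measurable_mean_sq h

theorem measurable_enYb : Measurable (enYb : State n d → ℝ) := by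
  have h : Measurable fun s : State n d => mean s.y := measurable_mean_pi measurable_state_y
  unfold enYb
  fun_prop

/-- A measurable energy that is dominated by an integrable one is integrable. -/
theorem integrable_energy (h : Setting P D f G R θ η L LA LB σ fstar) {φ : State n d → ℝ}
    (hφ : Measurable φ) (h0 : ∀ s, 0 ≤ φ s) {k : ℕ} {g : Ω → ℝ} (hg : Integrable g P)
    (hle : ∀ a, φ (run G θ x₀ R k a) ≤ g a) : Integrable (fun a => φ (run G θ x₀ R k a)) P :=
  hg.mono' (hφ.comp (h.adm.measurable_run h.grad.measurable k)).aestronglyMeasurable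
    (Filter.Eventually.of_forall fun a => by
      rw [Real.norm_of_nonneg (h0 _)]
      exact hle a)

theorem measurable_enN (h : Setting P D f G R θ η L LA LB σ fstar) :
    Measurable (enN f : State n d → ℝ) :=
  (h.measurable_gradient_objective.comp measurable_state_x).norm.pow_const 2

theorem measurable_enF (h : Setting P D f G R θ η L LA LB σ fstar) :
    Measurable (enF f fstar : State n d → ℝ) :=
  ((isSmooth_objective h.n_pos h.smooth).1.continuous.measurable.comp measurable_state_x).sub_const
    fstar

/-- All energies before iteration `k` are integrable. -/
structure EnergiesIntegrable (P : Measure Ω) (f : Fin n → Vec d → ℝ)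
    (G : Fin n → Vec d → Ξ → Vec d) (R : Draws Ω Ξ n d) (θ : Params) (fstar : ℝ) (x₀ : Vec d)
    (k : ℕ) : Prop where
  W : Integrable (fun a => enW (run G θ x₀ R k a)) P
  Wb : Integrable (fun a => enWb (run G θ x₀ R k a)) P
  Y : Integrable (fun a => enY (run G θ x₀ R k a)) P
  Yb : Integrable (fun a => enYb (run G θ x₀ R k a)) P
  Z : Integrable (fun a => enZ (run G θ x₀ R k a)) P
  e : Integrable (fun a => ene f (run G θ x₀ R k a)) P
  E : Integrable (fun a => enE f (run G θ x₀ R k a)) P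
  Gap : Integrable (fun a => enG (run G θ x₀ R k a)) P
  N : Integrable (fun a => enN f (run G θ x₀ R k a)) P
  F : Integrable (fun a => enF f fstar (run G θ x₀ R k a)) P

theorem run_zero_energies (h : Setting P D f G R θ η L LA LB σ fstar) (a : Ω) :
    enW (run G θ x₀ R 0 a) = 0 ∧ enWb (run G θ x₀ R 0 a) = 0 ∧ enY (run G θ x₀ R 0 a) = 0 ∧
      enYb (run G θ x₀ R 0 a) = 0 ∧ enZ (run G θ x₀ R 0 a) = 0 ∧ enG (run G θ x₀ R 0 a) = 0 := by
  simp only [run, init, enW, enWb, enY, enYb, enZ, enG, mean_const h.n_pos, sub_self, norm_zero]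
  norm_num

variable [IsProbabilityMeasure P]

theorem e_zero (h : Setting P D f G R θ η L LA LB σ fstar) :
    Integrable (fun a => ene f (run G θ x₀ R 0 a)) P ∧
      ∫ a, ene f (run G θ x₀ R 0 a) ∂P ≤ σ ^ 2 / θ.bInit / n := by
  have h1 := integral_norm_add_mean_miniBatch_sq (P := P) h.grad
    (fun i r => h.adm.sample_measurable 0 i r) (fun i r => h.adm.sample_law 0 i r)
    (fun i j r t hij => h.adm.indepFun_sample 0 i j r t hij) h.bInit_pos h.n_pos
    0 (fun _ => x₀) 1
  have e : ∀ a, ene f (run G θ x₀ R 0 a) = ‖0 + (1 : ℝ) • mean fun i =>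
      miniBatch (G i) θ.bInit x₀ (fun r => R.sample 0 i r a) - ∇ (f i) x₀‖ ^ 2 := fun a => by
    rw [mean_sub, ← gradient_objective fun i => (h.smooth i).1, zero_add, one_smul]
    rfl
  simp only [e]
  refine ⟨h1.1, h1.2.trans_eq ?_⟩
  simp

theorem E_zero (h : Setting P D f G R θ η L LA LB σ fstar) :
    Integrable (fun a => enE f (run G θ x₀ R 0 a)) P ∧
      ∫ a, enE f (run G θ x₀ R 0 a) ∂P ≤ σ ^ 2 / θ.bInit := by
  have h1 := integral_mean_norm_add_miniBatch_sq (P := P) h.grad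
    (fun i r => h.adm.sample_measurable 0 i r) (fun i r => h.adm.sample_law 0 i r)
    (fun i j r t hij => h.adm.indepFun_sample 0 i j r t hij) h.bInit_pos h.n_pos
    (fun _ => 0) (fun _ => x₀) 1
  have e : ∀ a, enE f (run G θ x₀ R 0 a) = mean fun i => ‖0 + (1 : ℝ) •
      (miniBatch (G i) θ.bInit x₀ (fun r => R.sample 0 i r a) - ∇ (f i) x₀)‖ ^ 2 := fun a => by
    simp only [zero_add, one_smul]
    rfl
  simp only [e]
  refine ⟨h1.1, h1.2.trans_eq ?_⟩
  simp [mean]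

theorem EnergiesIntegrable.X (h : Setting P D f G R θ η L LA LB σ fstar) {k : ℕ}
    (hk : EnergiesIntegrable P f G R θ fstar x₀ k) :
    Integrable (fun a => enX θ (run G θ x₀ R k a)) P := by
  have lin := integral_affine hk.Gap hk.e hk.N 0 (θ.γ ^ 2 * 2) (θ.γ ^ 2 * 4) (θ.γ ^ 2 * 4)
  have hm : Measurable (enX θ : State n d → ℝ) := by
    unfold enX
    fun_prop
  refine h.integrable_energy hm (fun s => sq_nonneg _) lin.1 fun a => ?_
  have := h.enX_le (run G θ x₀ R k a)
  linarith

/-- The stage lemmas deliver integrability together with their bounds, so induction works once the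
energies are treated in the order in which they drive each other, beginning with the step length. -/
theorem energiesIntegrable (h : Setting P D f G R θ η L LA LB σ fstar) (k : ℕ) :
    EnergiesIntegrable P f G R θ fstar x₀ k := by
  induction k with
  | zero =>
    have h0 := fun a => run_zero_energies (x₀ := x₀) h a
    refine ⟨?_, ?_, ?_, ?_, ?_, h.e_zero.1, h.E_zero.1, ?_, ?_, ?_⟩
    · simpa only [fun a => (h0 a).1] using integrable_const (0 : ℝ)
    · simpa only [fun a => (h0 a).2.1] using integrable_const (0 : ℝ)
    · simpa only [fun a => (h0 a).2.2.1] using integrable_const (0 : ℝ)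
    · simpa only [fun a => (h0 a).2.2.2.1] using integrable_const (0 : ℝ)
    · simpa only [fun a => (h0 a).2.2.2.2.1] using integrable_const (0 : ℝ)
    · simpa only [fun a => (h0 a).2.2.2.2.2] using integrable_const (0 : ℝ)
    · exact integrable_const (‖∇ (objective f) x₀‖ ^ 2)
    · exact integrable_const (objective f x₀ - fstar)
  | succ k hk =>
    have hX := EnergiesIntegrable.X h hk
    have hW := (h.W_stage k hk.W hX).1
    have hWb := (h.Wb_stage k hk.Wb hX).1
    have hQ := (h.Q_stage k hk.W hk.Z hX).1
    have hY : Integrable (fun a => enY (run G θ x₀ R (k + 1) a)) P :=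
      h.integrable_energy measurable_enY (fun s => mean_sq_nonneg _)
        ((hk.Y.const_mul (1 - η / 2)).add ((hX.const_mul (3 / η)).add (hW.const_mul η)))
        fun a => h.enY_succ_le k a
    have hYb : Integrable (fun a => enYb (run G θ x₀ R (k + 1) a)) P :=
      h.integrable_energy measurable_enYb (fun s => sq_nonneg _)
        ((hk.Yb.const_mul (1 - η / 2)).add ((hX.const_mul (3 / η)).add (hWb.const_mul η)))
        fun a => h.enYb_succ_le k a
    refine ⟨hW, hWb, hY, hYb, ?_, (h.e_stage k hk.e hX hY hYb).1, (h.E_stage k hk.E hQ).1,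
      (h.G_stage k hk.Gap (h.V_stage k hk.E hQ).1).1, ?_, ?_⟩
    · simp only [h.enZ_succ_eq]
      exact hQ.const_mul _
    · exact h.integrable_energy h.measurable_enN (fun s => sq_nonneg _)
        ((hk.N.const_mul 2).add (hX.const_mul (2 * L ^ 2))) fun a => h.enN_succ_le k a
    -- The gap is nonnegative and the descent inequality bounds it from above. The absolute value is
    -- there because `Setting` does not fix the sign of L.
    · refine h.integrable_energy h.measurable_enF (fun s => sub_nonneg.2 (h.lower _))
        ((hk.F.add ((hk.Gap.add hk.e).const_mul θ.γ)).add (hX.const_mul (|L| / 2))) fun a => ?_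
      have h1 := h.enF_succ_le (x₀ := x₀) k a
      have h2 : 0 ≤ θ.γ / 2 * enN f (run G θ x₀ R k a) :=
        mul_nonneg (half_pos h.γ_pos).le (sq_nonneg _)
      have hX0 : 0 ≤ enX θ (run G θ x₀ R k a) := sq_nonneg _
      have h3 : 0 ≤ 1 / (2 * θ.γ) * enX θ (run G θ x₀ R k a) :=
        mul_nonneg (by have := h.γ_pos; positivity) hX0
      have h4 := mul_le_mul_of_nonneg_right (le_abs_self L) hX0
      simp only [Pi.add_apply]
      linarith

theorem energyRecursion (h : Setting P D f G R θ η L LA LB σ fstar) :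
    EnergyRecursion n (omega d θ.kUp) (omega d θ.kDown) η θ.γ L LA LB (σ ^ 2 / θ.b)
      (fun k => ∫ a, enX θ (run G θ x₀ R k a) ∂P) (fun k => ∫ a, enN f (run G θ x₀ R k a) ∂P)
      (fun k => ∫ a, enF f fstar (run G θ x₀ R k a) ∂P)
      (fun k => ∫ a, enW (run G θ x₀ R k a) ∂P) (fun k => ∫ a, enWb (run G θ x₀ R k a) ∂P)
      (fun k => ∫ a, enY (run G θ x₀ R k a) ∂P) (fun k => ∫ a, enYb (run G θ x₀ R k a) ∂P)
      (fun k => ∫ a, enQ (run G θ x₀ R k a) (wNext G θ x₀ R k a) ∂P)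
      (fun k => ∫ a, enZ (run G θ x₀ R k a) ∂P) (fun k => ∫ a, ene f (run G θ x₀ R k a) ∂P)
      (fun k => ∫ a, enE f (run G θ x₀ R k a) ∂P)
      (fun k => ∫ a, enV (run G θ x₀ R k a) (vNext G θ x₀ R k a) ∂P)
      (fun k => ∫ a, enG (run G θ x₀ R k a) ∂P) := by
  have hk := fun k => h.energiesIntegrable (x₀ := x₀) k
  have hX := fun k => EnergiesIntegrable.X h (hk k)
  have hQ := fun k => (h.Q_stage k (hk k).W (hk k).Z (hX k)).1
  have hV := fun k => (h.V_stage k (hk k).E (hQ k)).1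
  have h0 := fun a => run_zero_energies (x₀ := x₀) h a
  refine
    { X_nonneg := fun k => integral_nonneg fun a => sq_nonneg _
      W_nonneg := fun k => integral_nonneg fun a => mean_sq_nonneg _
      Wb_nonneg := fun k => integral_nonneg fun a => sq_nonneg _
      Y_nonneg := fun k => integral_nonneg fun a => mean_sq_nonneg _
      Yb_nonneg := fun k => integral_nonneg fun a => sq_nonneg _
      Z_nonneg := fun k => integral_nonneg fun a => mean_sq_nonneg _
      Q_nonneg := fun k => integral_nonneg fun a => mean_sq_nonneg _
      e_nonneg := fun k => integral_nonneg fun a => sq_nonneg _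
      E_nonneg := fun k => integral_nonneg fun a => mean_sq_nonneg _
      F_nonneg := fun k => integral_nonneg fun a => sub_nonneg.2 (h.lower _)
      W_zero := by simp only [fun a => (h0 a).1, integral_zero]
      Wb_zero := by simp only [fun a => (h0 a).2.1, integral_zero]
      Y_zero := by simp only [fun a => (h0 a).2.2.1, integral_zero]
      Yb_zero := by simp only [fun a => (h0 a).2.2.2.1, integral_zero]
      Z_zero := by simp only [fun a => (h0 a).2.2.2.2.1, integral_zero]
      G_zero := by simp only [fun a => (h0 a).2.2.2.2.2, integral_zero]
      W_succ := fun k => (h.W_stage k (hk k).W (hX k)).2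
      Wb_succ := fun k => (h.Wb_stage k (hk k).Wb (hX k)).2
      Y_succ := fun k => ?_
      Yb_succ := fun k => ?_
      Q_le := fun k => (h.Q_stage k (hk k).W (hk k).Z (hX k)).2
      Z_succ := fun k => ?_
      e_succ := fun k => (h.e_stage k (hk k).e (hX k) (hk (k + 1)).Y (hk (k + 1)).Yb).2
      E_succ := fun k => (h.E_stage k (hk k).E (hQ k)).2
      V_le := fun k => (h.V_stage k (hk k).E (hQ k)).2
      G_succ := fun k => (h.G_stage k (hk k).Gap (hV k)).2
      F_succ := fun k => ?_ }
  · have lin := integral_affine (hk k).Y (hX k) (hk (k + 1)).W 0 (1 - η / 2) (3 / η) η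
    have h1 := integral_mono (hk (k + 1)).Y lin.1 fun a => by
      have := h.enY_succ_le (x₀ := x₀) k a
      linarith
    rw [lin.2] at h1
    linarith
  · have lin := integral_affine (hk k).Yb (hX k) (hk (k + 1)).Wb 0 (1 - η / 2) (3 / η) η
    have h1 := integral_mono (hk (k + 1)).Yb lin.1 fun a => by
      have := h.enYb_succ_le (x₀ := x₀) k a
      linarith
    rw [lin.2] at h1
    linarith
  · simp only [h.enZ_succ_eq, integral_const_mul, le_refl]
  · have lin1 := integral_affine (hk (k + 1)).F (hk k).N (hX k) 0 1 (θ.γ / 2)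
      (1 / (2 * θ.γ) - L / 2)
    have lin2 := integral_affine (hk k).F (hk k).Gap (hk k).e 0 1 θ.γ θ.γ
    have h1 := integral_mono lin1.1 lin2.1 fun a => by
      have := h.enF_succ_le (x₀ := x₀) k a
      linarith
    rw [lin1.2, lin2.2] at h1
    linarith

/-- The sum of the expected squared gradient norms along the iterates. -/
theorem sum_integral_gradient_le (h : Setting P D f G R θ η L LA LB σ fstar) (hA : LA ≤ L)
    (hB : LB ≤ L)
    (hcube : omega d θ.kUp * (omega d θ.kUp + 1) * omega d θ.kDown / n * η ^ 3 ≤ 1)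
    (hstep : θ.γ * √(omega d θ.kDown * (omega d θ.kDown + 1) * LA ^ 2
      + omega d θ.kDown / n * (omega d θ.kDown + 1) * LB ^ 2
      + (omega d θ.kUp * (omega d θ.kUp + 1) / n + 1 / η ^ 2) * L ^ 2) ≤ 1 / 20) (K : ℕ) :
    ∑ k ∈ Finset.range K, ∫ a, enN f (run G θ x₀ R k a) ∂P
      ≤ 2 * (objective f x₀ - fstar) / θ.γ
        + 2 * (σ ^ 2 / θ.bInit / n / η + K * (η * (σ ^ 2 / θ.b) / n)
          + K * (2 * omega d θ.kUp / n * η * (σ ^ 2 / θ.bInit))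
          + K * (omega d θ.kUp * (omega d θ.kUp + 1) / n * (3 * η ^ 2 * (σ ^ 2 / θ.b)))) := by
  have hη := h.η_pos
  have hn : (0 : ℝ) < n := by exact_mod_cast h.n_pos
  have hω := omega_nonneg h.kUp_pos h.kUp_le
  have hωs := omega_nonneg h.kDown_pos h.kDown_le
  have h1 := (h.energyRecursion (x₀ := x₀)).sum_N_le hn hω hωs hη h.η_le (by positivity) h.γ_pos
    h.sim.1 h.sim.2.1 hA hB hcube hstep K
  have h2 : ∫ a, enF f fstar (run G θ x₀ R 0 a) ∂P = objective f x₀ - fstar := by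
    simp [enF, run, init]
  rw [h2] at h1
  have h3 := div_le_div_of_nonneg_right (h.e_zero (x₀ := x₀)).2 hη.le
  have h4 := mul_le_mul_of_nonneg_left (h.E_zero (x₀ := x₀)).2
    (show 0 ≤ K * (2 * omega d θ.kUp / n * η) by positivity)
  linarith

end Setting

/-! ### The tuned parameters -/

section Tuning

/-- Rounding t/c ≥ 1 down loses at most a factor 2, so d/K ≤ 2dc/t and ω(ω+1) ≤ (d/K)². If the cap K
= d is active, then ω = 0. -/
theorem coords_spec {d : ℕ} {t c : ℝ} (hd : 0 < d) (hc : 0 < c) (hct : c ≤ t) :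
    0 < coords d t c ∧ coords d t c ≤ d ∧ (coords d t c : ℝ) * c ≤ t ∧
      omega d (coords d t c) * (omega d (coords d t c) + 1) * t ^ 2 ≤ 4 * d ^ 2 * c ^ 2 := by
  have ht : 0 < t := hc.trans_le hct
  have h1 : 1 ≤ t / c := by rwa [le_div_iff₀ hc, one_mul]
  have h2 : 0 < ⌊t / c⌋₊ := Nat.floor_pos.2 h1
  have h3 : 0 < coords d t c := lt_min h2 hd
  have h4 : coords d t c ≤ d := min_le_right _ _
  have h5 : (coords d t c : ℝ) ≤ t / c :=
    (Nat.cast_le.2 (min_le_left _ _)).trans (Nat.floor_le (by positivity))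
  refine ⟨h3, h4, by rwa [le_div_iff₀ hc] at h5, ?_⟩
  by_cases h6 : ⌊t / c⌋₊ ≤ d
  · have h7 : coords d t c = ⌊t / c⌋₊ := min_eq_left h6
    have h8 : t / c < ⌊t / c⌋₊ + 1 := Nat.lt_floor_add_one _
    have h9 : (1 : ℝ) ≤ ⌊t / c⌋₊ := by exact_mod_cast h2
    have h10 : t ≤ 2 * ⌊t / c⌋₊ * c := by
      have : t / c ≤ 2 * ⌊t / c⌋₊ := by linarith
      rwa [div_le_iff₀ hc] at this
    rw [h7, omega, sub_add_cancel]
    set m : ℝ := (⌊t / c⌋₊ : ℝ)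
    have hm : 0 < m := by linarith
    have h11 : (d : ℝ) / m * t ≤ 2 * d * c := by
      rw [div_mul_eq_mul_div, div_le_iff₀ hm]
      have := mul_le_mul_of_nonneg_left h10 (Nat.cast_nonneg (α := ℝ) d)
      linarith
    have h12 : 0 ≤ (d : ℝ) / m * t := by positivity
    have h13 : ((d : ℝ) / m - 1) * ((d : ℝ) / m) * t ^ 2 ≤ ((d : ℝ) / m * t) ^ 2 := by
      have : 0 ≤ (d : ℝ) / m * t ^ 2 := by positivity
      linarith
    have h14 := pow_le_pow_left₀ h12 h11 2
    linarith
  · have h7 : coords d t c = d := min_eq_right (not_le.1 h6).le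
    have h8 : (d : ℝ) ≠ 0 := by exact_mod_cast hd.ne'
    rw [h7, omega, div_self h8, sub_self, zero_mul, zero_mul]
    positivity

theorem batch_spec {t h : ℝ} (hh : 0 < h) (hht : h ≤ t) :
    0 < ⌊t / h⌋₊ ∧ (⌊t / h⌋₊ : ℝ) * h ≤ t ∧ t ≤ 2 * h * ⌊t / h⌋₊ := by
  have h1 : 1 ≤ t / h := by rwa [le_div_iff₀ hh, one_mul]
  have h2 : 0 < ⌊t / h⌋₊ := Nat.floor_pos.2 h1
  have h3 : (⌊t / h⌋₊ : ℝ) ≤ t / h := Nat.floor_le (by linarith)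
  have h4 : t / h < ⌊t / h⌋₊ + 1 := Nat.lt_floor_add_one _
  have h5 : (1 : ℝ) ≤ ⌊t / h⌋₊ := by exact_mod_cast h2
  refine ⟨h2, by rwa [le_div_iff₀ hh] at h3, ?_⟩
  have h6 : t / h ≤ 2 * ⌊t / h⌋₊ := by linarith
  rw [div_le_iff₀ hh] at h6
  linarith

/-- Each of the first three entries of the minimum gives one inequality: the first limits the
sampling noise passed through the workers' compressors, the second the noise of the averaged
estimator, the third the server's effect on `G`. The bound on 1/η replaces a maximum by a sum. -/
theorem momentum_spec {n b : ℕ} {σ ε ω ωs : ℝ} (hn : 0 < n) (hb : 0 < b) (hε : 0 < ε)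
    (hω : 0 ≤ ω) (hωs : 0 ≤ ωs) :
    0 < momentum n b σ ε ω ωs ∧ momentum n b σ ε ω ωs ≤ 1 ∧
      ω * (ω + 1) / n * (momentum n b σ ε ω ωs ^ 2 * (σ ^ 2 / b)) ≤ ε / 36 ∧
      momentum n b σ ε ω ωs * (σ ^ 2 / b) / n ≤ ε / 6 ∧
      ω * (ω + 1) * ωs / n * momentum n b σ ε ω ωs ^ 3 ≤ 1 ∧
      1 / momentum n b σ ε ω ωs ≤ 6 * √(ω * (ω + 1) * σ ^ 2 / (b * n * ε))
        + 6 * σ ^ 2 / (b * n * ε) + (ω * (ω + 1) * ωs / n) ^ (1 / 3 : ℝ) + 1 := by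
  have hn' : (0 : ℝ) < n := by exact_mod_cast hn
  have hb' : (0 : ℝ) < b := by exact_mod_cast hb
  set A₁ := 6 * √(ω * (ω + 1) * σ ^ 2 / (b * n * ε)) with hA₁
  set A₂ := 6 * σ ^ 2 / (b * n * ε) with hA₂
  set A₃ := (ω * (ω + 1) * ωs / n) ^ (1 / 3 : ℝ) with hA₃
  have h1 : 0 ≤ A₁ := by positivity
  have h2 : 0 ≤ A₂ := by positivity
  have h3 : 0 ≤ A₃ := by positivity
  have hη : momentum n b σ ε ω ωs = (max (max A₁ A₂) (max A₃ 1))⁻¹ := rfl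
  set m := max (max A₁ A₂) (max A₃ 1) with hm
  have hm1 : 1 ≤ m := (le_max_right _ _).trans (le_max_right _ _)
  have hmA₁ : A₁ ≤ m := (le_max_left _ _).trans (le_max_left _ _)
  have hmA₂ : A₂ ≤ m := (le_max_right _ _).trans (le_max_left _ _)
  have hmA₃ : A₃ ≤ m := (le_max_left _ _).trans (le_max_right _ _)
  have hm0 : 0 < m := by linarith
  rw [hη]
  refine ⟨inv_pos.2 hm0, inv_le_one_of_one_le₀ hm1, ?_, ?_, ?_, ?_⟩
  · have h4 := pow_le_pow_left₀ h1 hmA₁ 2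
    rw [hA₁, mul_pow, Real.sq_sqrt (by positivity)] at h4
    rw [inv_pow]
    have e : ω * (ω + 1) / n * ((m ^ 2)⁻¹ * (σ ^ 2 / b))
        = ε / 36 * (6 ^ 2 * (ω * (ω + 1) * σ ^ 2 / (b * n * ε)) / m ^ 2) := by
      field_simp
      norm_num
    rw [e]
    exact mul_le_of_le_one_right (by positivity) ((div_le_one (by positivity)).2 h4)
  · have e : m⁻¹ * (σ ^ 2 / b) / n = ε / 6 * (A₂ / m) := by
      rw [hA₂]
      field_simp
    rw [e]
    exact mul_le_of_le_one_right (by positivity) ((div_le_one hm0).2 hmA₂)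
  · have h4 := pow_le_pow_left₀ h3 hmA₃ 3
    have h5 : A₃ ^ 3 = ω * (ω + 1) * ωs / n := by
      rw [hA₃, ← Real.rpow_natCast, ← Real.rpow_mul (by positivity)]
      norm_num
    rw [h5] at h4
    rw [inv_pow, ← div_eq_mul_inv]
    exact (div_le_one (by positivity)).2 h4
  · rw [one_div, inv_inv]
    exact max_le (max_le (by linarith) (by linarith)) (max_le (by linarith) (by linarith))

/-- The maximum in the time complexity. -/
noncomputable def bracket (n d : ℕ) (h τ κ σ ε : ℝ) : ℝ :=
  max (max (max h τ) (max κ (d * κ / √n)))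
      (max (max (d * τ / √n) (((d : ℝ) ^ 3 * τ ^ 2 * κ / n) ^ (1 / 3 : ℝ)))
        (max (((d : ℝ) ^ 2 * τ ^ 2 * h * σ ^ 2 / (n * ε)) ^ (1 / 3 : ℝ)) (σ ^ 2 * h / (n * ε))))

theorem timeBound_eq (n d : ℕ) (h τ κ σ ε Δ LA LM : ℝ) :
    timeBound n d h τ κ σ ε Δ LA LM
      = bracket n d h τ κ σ ε * (LM * Δ / ε) + d * κ * LA * Δ / ε := rfl

theorem bracket_spec (n d : ℕ) (h τ κ σ ε : ℝ) :
    h ≤ bracket n d h τ κ σ ε ∧ d * κ / √n ≤ bracket n d h τ κ σ ε ∧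
      d * τ / √n ≤ bracket n d h τ κ σ ε ∧
      ((d : ℝ) ^ 3 * τ ^ 2 * κ / n) ^ (1 / 3 : ℝ) ≤ bracket n d h τ κ σ ε ∧
      σ ^ 2 * h / (n * ε) ≤ bracket n d h τ κ σ ε ∧
      budget n d h τ κ σ ε ≤ bracket n d h τ κ σ ε := by
  have h1 : h ≤ bracket n d h τ κ σ ε := by simp [bracket]
  have h2 : τ ≤ bracket n d h τ κ σ ε := by simp [bracket]
  have h3 : κ ≤ bracket n d h τ κ σ ε := by simp [bracket]
  have h4 : ((d : ℝ) ^ 2 * τ ^ 2 * h * σ ^ 2 / (n * ε)) ^ (1 / 3 : ℝ) ≤ bracket n d h τ κ σ ε := by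
    simp [bracket]
  exact ⟨h1, by simp [bracket], by simp [bracket], by simp [bracket], by simp [bracket],
    max_le (max_le h1 (max_le h2 h3)) h4⟩

theorem budget_spec {n d : ℕ} {h τ κ σ ε : ℝ} (hh : 0 < h) (hε : 0 < ε) :
    h ≤ budget n d h τ κ σ ε ∧ τ ≤ budget n d h τ κ σ ε ∧ κ ≤ budget n d h τ κ σ ε ∧
      (d : ℝ) ^ 2 * τ ^ 2 * h * σ ^ 2 / (n * ε) ≤ budget n d h τ κ σ ε ^ 3 := by
  refine ⟨by simp [budget], by simp [budget], by simp [budget], ?_⟩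
  have h1 : ((d : ℝ) ^ 2 * τ ^ 2 * h * σ ^ 2 / (n * ε)) ^ (1 / 3 : ℝ)
      ≤ budget n d h τ κ σ ε := le_max_right _ _
  have h2 : 0 ≤ (d : ℝ) ^ 2 * τ ^ 2 * h * σ ^ 2 / (n * ε) := by positivity
  have h3 := pow_le_pow_left₀ (by positivity) h1 3
  rwa [← Real.rpow_natCast, ← Real.rpow_mul h2, show (1 / 3 : ℝ) * ((3 : ℕ) : ℝ) = 1 by norm_num,
    Real.rpow_one] at h3

variable {n d : ℕ} {h τ κ σ ε : ℝ}

/-- The compressed messages do not dominate the minibatches. -/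
theorem omega_noise_le (hn : 0 < n) (hd : 0 < d) (hh : 0 < h) (hτ : 0 < τ) (hε : 0 < ε) {t : ℝ}
    (ht : t = budget n d h τ κ σ ε) :
    omega d (coords d t τ) * (omega d (coords d t τ) + 1) * (σ ^ 2 / (n * ε))
      ≤ 8 * ⌊t / h⌋₊ := by
  obtain ⟨h1, h2, -, h4⟩ := budget_spec (n := n) (d := d) (τ := τ) (κ := κ) (σ := σ) hh hε
  rw [← ht] at h1 h2 h4
  have hn' : (0 : ℝ) < n := by exact_mod_cast hn
  have ht0 : 0 < t := hh.trans_le h1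
  have h5 := (coords_spec hd hτ h2).2.2.2
  have h6 := (batch_spec hh h1).2.2
  set ω := omega d (coords d t τ)
  set s := σ ^ 2 / (n * ε) with hs
  have hs0 : 0 ≤ s := by positivity
  have e : (d : ℝ) ^ 2 * τ ^ 2 * h * σ ^ 2 / (n * ε) = d ^ 2 * τ ^ 2 * h * s := by
    rw [hs]
    ring
  rw [e] at h4
  have h7 := mul_le_mul_of_nonneg_right h5 (show 0 ≤ h * s by positivity)
  have h8 := mul_le_mul_of_nonneg_left h6 (show 0 ≤ t ^ 2 by positivity)
  -- The purpose of the cube root entry of the budget: ω(ω+1)t² ≤ 4d²τ², then d²τ²hs ≤ t³, and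
  -- finally t ≤ 2hb.
  have h9 : h * t ^ 2 * (ω * (ω + 1) * s) ≤ h * t ^ 2 * (8 * ⌊t / h⌋₊) := by
    linarith
  exact le_of_mul_le_mul_left h9 (by positivity)

/-- The budget divided by the momentum. -/
theorem budget_div_momentum_le (hn : 0 < n) (hd : 0 < d) (hh : 0 < h) (hτ : 0 < τ) (hκ : 0 < κ)
    (hε : 0 < ε) {t : ℝ} (ht : t = budget n d h τ κ σ ε) :
    t * (1 / momentum n ⌊t / h⌋₊ σ ε (omega d (coords d t τ)) (omega d (coords d t κ)))
      ≤ 32 * bracket n d h τ κ σ ε := by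
  obtain ⟨h1, h2, h3, h4⟩ := budget_spec (n := n) (d := d) (τ := τ) (κ := κ) (σ := σ) hh hε
  obtain ⟨-, -, -, m4, m5, m6⟩ := bracket_spec n d h τ κ σ ε
  have hnoise := omega_noise_le (κ := κ) (σ := σ) hn hd hh hτ hε ht
  rw [← ht] at h1 h2 h3 h4 m6
  have hn' : (0 : ℝ) < n := by exact_mod_cast hn
  have ht0 : 0 < t := hh.trans_le h1
  obtain ⟨u1, u2, -, u4⟩ := coords_spec hd hτ h2
  obtain ⟨w1, w2, -, w4⟩ := coords_spec hd hκ h3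
  obtain ⟨b1, -, b3⟩ := batch_spec hh h1
  have hω := omega_nonneg u1 u2
  have hωs := omega_nonneg w1 w2
  have hb' : (0 : ℝ) < ⌊t / h⌋₊ := by exact_mod_cast b1
  have hm := (momentum_spec (σ := σ) hn b1 hε hω hωs).2.2.2.2.2
  set ω := omega d (coords d t τ)
  set ωs := omega d (coords d t κ)
  set b : ℝ := (⌊t / h⌋₊ : ℝ)
  set M := bracket n d h τ κ σ ε
  refine (mul_le_mul_of_nonneg_left hm ht0.le).trans ?_
  -- Since 6√8 < 17, this entry never exceeds a constant. The total is 17 + 12 + 2 + 1 = 32.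
  have a1 : 6 * √(ω * (ω + 1) * σ ^ 2 / (b * n * ε)) ≤ 17 := by
    have h5 : ω * (ω + 1) * σ ^ 2 / (b * n * ε) ≤ 8 := by
      have e : ω * (ω + 1) * σ ^ 2 / (b * n * ε) = ω * (ω + 1) * (σ ^ 2 / (n * ε)) / b := by
        field_simp
      rw [e, div_le_iff₀ hb']
      exact hnoise
    have h6 : √(ω * (ω + 1) * σ ^ 2 / (b * n * ε)) ≤ 17 / 6 := by
      rw [Real.sqrt_le_left (by norm_num)]
      exact h5.trans (by norm_num)
    linarith
  have a2 : t * (6 * σ ^ 2 / (b * n * ε)) ≤ 12 * M := by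
    have h5 : t * (6 * σ ^ 2 / (b * n * ε)) ≤ 12 * (σ ^ 2 * h / (n * ε)) := by
      have e : 12 * (σ ^ 2 * h / (n * ε)) = (2 * h * b) * (6 * σ ^ 2 / (b * n * ε)) := by
        field_simp
        ring
      rw [e]
      exact mul_le_mul_of_nonneg_right b3 (by positivity)
    linarith
  have a3 : t * (ω * (ω + 1) * ωs / n) ^ (1 / 3 : ℝ) ≤ 2 * M := by
    have h5 : ωs * t ≤ 2 * d * κ := by
      have h6 : (ωs * t) ^ 2 ≤ (2 * d * κ) ^ 2 := by
        have : 0 ≤ ωs * t ^ 2 := by positivity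
        linarith
      exact le_of_sq_le_sq h6 (by positivity)
    have h6 : t ^ 3 * (ω * (ω + 1) * ωs / n) ≤ 2 ^ 3 * ((d : ℝ) ^ 3 * τ ^ 2 * κ / n) := by
      have h7 : ω * (ω + 1) * t ^ 2 * (ωs * t) ≤ 4 * d ^ 2 * τ ^ 2 * (2 * d * κ) :=
        mul_le_mul u4 h5 (by positivity) (by positivity)
      have h8 := div_le_div_of_nonneg_right h7 hn'.le
      have e1 : t ^ 3 * (ω * (ω + 1) * ωs / n) = ω * (ω + 1) * t ^ 2 * (ωs * t) / n := by ring
      have e2 : 2 ^ 3 * ((d : ℝ) ^ 3 * τ ^ 2 * κ / n)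
          = 4 * d ^ 2 * τ ^ 2 * (2 * d * κ) / n := by ring
      rw [e1, e2]
      exact h8
    have h7 := Real.rpow_le_rpow (by positivity) h6 (show (0 : ℝ) ≤ 1 / 3 by norm_num)
    have e3 : ∀ y : ℝ, 0 ≤ y → (y ^ 3) ^ (1 / 3 : ℝ) = y := fun y hy => by
      rw [← Real.rpow_natCast, ← Real.rpow_mul hy]
      norm_num
    rw [Real.mul_rpow (by positivity) (by positivity), Real.mul_rpow (by positivity)
      (by positivity), e3 t ht0.le, e3 2 zero_le_two] at h7
    linarith
  have h5 := mul_le_mul_of_nonneg_left a1 ht0.le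
  linarith

end Tuning

/-! ### The output and the time of a run -/

/-- As an average of Dirac masses, the uniform index turns an expectation over the product space
into an average over iterations. -/
theorem uniformOn_Iio (K : ℕ) :
    uniformOn (Set.Iio K) = (K : ENNReal)⁻¹ • ∑ k ∈ Finset.range K, Measure.dirac k := by
  refine Measure.ext_of_singleton fun k => ?_
  rw [uniformOn, cond_apply (Set.to_countable _).measurableSet, Measure.smul_apply,
    Measure.finsetSum_apply]
  have h1 : Measure.count (Set.Iio K) = (K : ENNReal) := by
    rw [← Finset.coe_Iio, Measure.count_apply_finset, Nat.card_Iio]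
  rw [h1, smul_eq_mul]
  congr 1
  by_cases hk : k < K
  · rw [Set.inter_eq_self_of_subset_right (by simpa using hk), Measure.count_singleton,
      Finset.sum_eq_single k (fun j _ hj => by simp [hj]) (fun h => absurd (Finset.mem_range.2 hk) h)]
    simp
  · have e : Set.Iio K ∩ {k} = ∅ := by
      ext j
      simp only [Set.mem_inter_iff, Set.mem_Iio, Set.mem_singleton_iff, Set.mem_empty_iff_false,
        iff_false]
      rintro ⟨h2, rfl⟩
      exact hk h2
    rw [e, measure_empty, eq_comm]
    refine Finset.sum_eq_zero fun j hj => ?_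
    have : j ≠ k := fun h => hk (h ▸ Finset.mem_range.1 hj)
    simp [this]

theorem prod_uniformOn_Iio {Ω : Type*} [MeasurableSpace Ω] (P : Measure Ω) [IsProbabilityMeasure P]
    (K : ℕ) : P.prod (uniformOn (Set.Iio K))
      = (K : ENNReal)⁻¹ • ∑ k ∈ Finset.range K, P.map fun a => (a, k) := by
  rw [uniformOn_Iio, Measure.prod_smul_right]
  congr 1
  induction K with
  | zero => simp
  | succ K ih =>
    rw [Finset.sum_range_succ, Finset.sum_range_succ, Measure.prod_add, ih, Measure.prod_dirac]

theorem integral_prod_uniformOn_Iio {Ω : Type*} [MeasurableSpace Ω] (P : Measure Ω)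
    [IsProbabilityMeasure P] {K : ℕ} (hK : 0 < K) {φ : ℕ → Ω → ℝ} (hφm : ∀ k, Measurable (φ k))
    (hφ : ∀ k, Integrable (φ k) P) :
    Integrable (fun q : Ω × ℕ => φ q.2 q.1) (P.prod (uniformOn (Set.Iio K))) ∧
      ∫ q : Ω × ℕ, φ q.2 q.1 ∂(P.prod (uniformOn (Set.Iio K)))
        = (K : ℝ)⁻¹ * ∑ k ∈ Finset.range K, ∫ a, φ k a ∂P := by
  have hm : Measurable fun q : Ω × ℕ => φ q.2 q.1 :=
    measurable_from_prod_countable_left hφm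
  have hk : ∀ k : ℕ, Measurable fun a : Ω => (a, k) := fun k =>
    measurable_id.prodMk measurable_const
  have hi : ∀ k ∈ Finset.range K,
      Integrable (fun q : Ω × ℕ => φ q.2 q.1) (P.map fun a => (a, k)) := fun k _ =>
    (integrable_map_measure hm.aestronglyMeasurable (hk k).aemeasurable).2 (hφ k)
  rw [prod_uniformOn_Iio]
  have hK' : (K : ENNReal)⁻¹ ≠ ⊤ := by
    simpa using hK.ne'
  refine ⟨Integrable.smul_measure (integrable_finsetSum_measure.2 hi) hK', ?_⟩
  rw [integral_smul_measure, integral_finsetSum_measure hi]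
  simp only [ENNReal.toReal_inv, ENNReal.toReal_natCast, smul_eq_mul]
  congr 1
  refine Finset.sum_congr rfl fun k _ => ?_
  rw [integral_map (hk k).aemeasurable hm.aestronglyMeasurable]

/-! ### Expected duration of a run -/

section Time

variable {Ω Ξ : Type*} [MeasurableSpace Ω] {n d : ℕ} {θ : Params}
  {R : Draws Ω Ξ n d} {T : Durations Ω n} {h τ κ : ℝ}

theorem sum_duration {X : ℕ → Ω → ℝ} {c : ℝ} (hX : ∀ r, IsDuration (X r) c) (m : ℕ) :
    IsDuration (fun a => ∑ r ∈ Finset.range m, X r a) (m * c) := by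
  refine ⟨Finset.measurable_fun_sum _ fun r _ => (hX r).1, fun a =>
    ⟨Finset.sum_nonneg fun r _ => ((hX r).2 a).1, ?_⟩⟩
  have := Finset.sum_le_sum fun r (_ : r ∈ Finset.range m) => ((hX r).2 a).2
  simpa using this

theorem measurable_message {X : ℕ → Ω → ℝ} {c : ℝ} (hX : ∀ r, IsDuration (X r) c) {K : ℕ}
    {coin : Ω → Bool} (hcoin : Measurable coin) :
    Measurable fun a => ∑ j ∈ Finset.range (coordsSent d K (coin a)), X j a := by
  have hm : MeasurableSet {a | coin a = true} := hcoin (measurableSet_singleton true)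
  have e : (fun a => ∑ j ∈ Finset.range (coordsSent d K (coin a)), X j a)
      = fun a => if coin a = true then ∑ j ∈ Finset.range d, X j a
        else ∑ j ∈ Finset.range K, X j a := by
    funext a
    by_cases hc : coin a = true <;> simp [coordsSent, hc]
  rw [e]
  exact Measurable.ite hm (sum_duration hX d).1 (sum_duration hX K).1

/-- The expected number of coordinates of a message. -/
theorem integral_coordsSent {P : Measure Ω} [IsProbabilityMeasure P] {K : ℕ} {coin : Ω → Bool}
    (hK : 0 < K) (hKd : K ≤ d) (hc : IsCoin P (1 / (omega d K + 1)) coin) :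
    Integrable (fun a => (coordsSent d K (coin a) : ℝ)) P ∧
      ∫ a, (coordsSent d K (coin a) : ℝ) ∂P ≤ 2 * K := by
  have hK' : (0 : ℝ) < K := by exact_mod_cast hK
  have hd' : (0 : ℝ) < d := by exact_mod_cast hK.trans_le hKd
  have e : (fun a => (coordsSent d K (coin a) : ℝ))
      = fun a => if coin a then (d : ℝ) else (K : ℝ) := by
    funext a
    by_cases hc : coin a = true <;> simp [coordsSent, hc]
  obtain ⟨h1, h2⟩ := hc.integral_ite (d : ℝ) (K : ℝ)
  rw [e]
  refine ⟨h1, h2.le.trans ?_⟩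
  have h3 : 1 / (omega d K + 1) = K / d := by
    rw [omega, sub_add_cancel, one_div_div]
  rw [h3, div_mul_cancel₀ _ hd'.ne']
  -- With p = K/d the expected length is p d + (1 − p)K = 2K − K²/d.
  have : 0 ≤ (K : ℝ) / d * K := by positivity
  linarith

theorem initTime_isDuration (hn : 0 < n) (hT : T.Bounded h τ κ) :
    IsDuration (initTime θ T) (θ.bInit * h) := by
  have : Nonempty (Fin n) := ⟨⟨0, hn⟩⟩
  have h1 : ∀ i, IsDuration (fun a => ∑ r ∈ Finset.range θ.bInit, T.comp 0 i r a)
      (θ.bInit * h) := fun i => sum_duration (fun r => (hT 0 i r).1) _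
  exact ⟨Measurable.iSup fun i => (h1 i).1, fun a => ⟨Real.iSup_nonneg fun i => ((h1 i).2 a).1,
    ciSup_le fun i => ((h1 i).2 a).2⟩⟩

theorem measurable_iterTime (hT : T.Bounded h τ κ) (hdown : ∀ k, Measurable (R.downCoin k))
    (hup : ∀ k, Measurable (R.upCoin k)) (k : ℕ) : Measurable (iterTime θ R T k) :=
  Measurable.iSup fun i =>
    ((measurable_message (fun j => (hT k i j).2.1) (hdown k)).add
      (sum_duration (fun r => (hT (k + 1) i r).1) _).1).add
      (measurable_message (fun j => (hT k i j).2.2) (hup k))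

theorem iterTime_nonneg (hT : T.Bounded h τ κ) (k : ℕ) (a : Ω) : 0 ≤ iterTime θ R T k a :=
  Real.iSup_nonneg fun i => add_nonneg (add_nonneg
    (((sum_duration (fun j => (hT k i j).2.1) _).2 a).1)
    (((sum_duration (fun r => (hT (k + 1) i r).1) _).2 a).1))
    (((sum_duration (fun j => (hT k i j).2.2) _).2 a).1)

theorem iterTime_le (hn : 0 < n) (hT : T.Bounded h τ κ) (k : ℕ) (a : Ω) :
    iterTime θ R T k a ≤ coordsSent d θ.kDown (R.downCoin k a) * κ + θ.b * h
      + coordsSent d θ.kUp (R.upCoin k a) * τ := by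
  have : Nonempty (Fin n) := ⟨⟨0, hn⟩⟩
  exact ciSup_le fun i => add_le_add (add_le_add
    (((sum_duration (fun j => (hT k i j).2.1) _).2 a).2)
    (((sum_duration (fun r => (hT (k + 1) i r).1) _).2 a).2))
    (((sum_duration (fun j => (hT k i j).2.2) _).2 a).2)

theorem integral_iterTime_le {P : Measure Ω} [IsProbabilityMeasure P] (hn : 0 < n)
    (hT : T.Bounded h τ κ) (hτ : 0 ≤ τ) (hκ : 0 ≤ κ)
    (hDown : 0 < θ.kDown) (hDown' : θ.kDown ≤ d) (hUp : 0 < θ.kUp) (hUp' : θ.kUp ≤ d)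
    (hdown : ∀ k, IsCoin P (1 / (omega d θ.kDown + 1)) (R.downCoin k))
    (hup : ∀ k, IsCoin P (1 / (omega d θ.kUp + 1)) (R.upCoin k)) (k : ℕ) :
    Integrable (iterTime θ R T k) P ∧
      ∫ a, iterTime θ R T k a ∂P ≤ 2 * (θ.kDown * κ) + θ.b * h + 2 * (θ.kUp * τ) := by
  obtain ⟨i1, e1⟩ := integral_coordsSent hDown hDown' (hdown k)
  obtain ⟨i2, e2⟩ := integral_coordsSent hUp hUp' (hup k)
  have i3 : Integrable (fun a => (coordsSent d θ.kDown (R.downCoin k a) * κ + θ.b * h : ℝ)) P :=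
    (i1.mul_const κ).add (integrable_const _)
  have i4 : Integrable (fun a => (coordsSent d θ.kDown (R.downCoin k a) * κ + θ.b * h
      + coordsSent d θ.kUp (R.upCoin k a) * τ : ℝ)) P := i3.add (i2.mul_const τ)
  have i5 : Integrable (iterTime θ R T k) P := by
    refine i4.mono' (measurable_iterTime hT (fun k => (hdown k).1)
      (fun k => (hup k).1) k).aestronglyMeasurable (ae_of_all _ fun a => ?_)
    rw [Real.norm_of_nonneg (iterTime_nonneg hT k a)]
    exact iterTime_le hn hT k a
  refine ⟨i5, (integral_mono i5 i4 fun a => iterTime_le hn hT k a).trans ?_⟩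
  rw [integral_add i3 (i2.mul_const τ), integral_add (i1.mul_const κ) (integrable_const _),
    integral_mul_const κ, integral_mul_const τ, integral_const, probReal_univ, one_smul]
  have h1 := mul_le_mul_of_nonneg_right e1 hκ
  have h2 := mul_le_mul_of_nonneg_right e2 hτ
  linarith

theorem integral_totalTime_le {P : Measure Ω} [IsProbabilityMeasure P] (hn : 0 < n)
    (hT : T.Bounded h τ κ) (hτ : 0 ≤ τ) (hκ : 0 ≤ κ)
    (hDown : 0 < θ.kDown) (hDown' : θ.kDown ≤ d) (hUp : 0 < θ.kUp) (hUp' : θ.kUp ≤ d)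
    (hdown : ∀ k, IsCoin P (1 / (omega d θ.kDown + 1)) (R.downCoin k))
    (hup : ∀ k, IsCoin P (1 / (omega d θ.kUp + 1)) (R.upCoin k)) (K : ℕ) :
    Integrable (totalTime θ R T K) P ∧
      ∫ a, totalTime θ R T K a ∂P
        ≤ θ.bInit * h + K * (2 * (θ.kDown * κ) + θ.b * h + 2 * (θ.kUp * τ)) := by
  have h1 := initTime_isDuration (θ := θ) hn hT
  have i1 : Integrable (initTime θ T) P := by
    refine (integrable_const (θ.bInit * h : ℝ)).mono' h1.1.aestronglyMeasurable
      (ae_of_all _ fun a => ?_)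
    rw [Real.norm_of_nonneg (h1.2 a).1]
    exact (h1.2 a).2
  have h2 := integral_iterTime_le hn hT hτ hκ hDown hDown' hUp hUp' hdown hup
  have i2 : Integrable (fun a => ∑ k ∈ Finset.range K, iterTime θ R T k a) P :=
    integrable_finsetSum _ fun k _ => (h2 k).1
  refine ⟨i1.add i2, ?_⟩
  have e : ∫ a, totalTime θ R T K a ∂P
      = ∫ a, initTime θ T a ∂P + ∑ k ∈ Finset.range K, ∫ a, iterTime θ R T k a ∂P := by
    rw [← integral_finsetSum _ fun k _ => (h2 k).1]
    exact integral_add i1 i2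
  rw [e]
  refine add_le_add ?_ ?_
  · have := integral_mono i1 (integrable_const (θ.bInit * h : ℝ)) fun a => (h1.2 a).2
    simpa using this
  · have := Finset.sum_le_sum fun k (_ : k ∈ Finset.range K) => (h2 k).2
    rwa [Finset.sum_const, Finset.card_range, nsmul_eq_mul] at this

end Time

theorem Setting.isStationaryPoint_output {Ω Ξ : Type*} [MeasurableSpace Ω] [MeasurableSpace Ξ]
    {n d : ℕ} {P : Measure Ω} [IsProbabilityMeasure P]
    {D : Fin n → Measure Ξ} {f : Fin n → Vec d → ℝ}
    {G : Fin n → Vec d → Ξ → Vec d} {R : Draws Ω Ξ n d} {θ : Params} {η L LA LB σ fstar ε : ℝ}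
    {x₀ : Vec d} (h : Setting P D f G R θ η L LA LB σ fstar) {K : ℕ} (hK : 0 < K)
    (hsum : ∑ k ∈ Finset.range K, ∫ a, enN f (run G θ x₀ R k a) ∂P ≤ K * ε) :
    IsStationaryPoint (objective f) ε (P.prod (uniformOn (Set.Iio K))) (output G θ x₀ R) := by
  have hrun := h.adm.measurable_run (x₀ := x₀) h.grad.measurable
  obtain ⟨h1, h2⟩ := integral_prod_uniformOn_Iio P hK
    (φ := fun k a => enN f (run G θ x₀ R k a)) (fun k => h.measurable_enN.comp (hrun k))
    fun k => (h.energiesIntegrable k).N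
  have hm : Measurable (output G θ x₀ R) :=
    measurable_from_prod_countable_left fun k => measurable_state_x.comp (hrun k)
  refine ⟨hm.aemeasurable, h1, h2.le.trans ?_⟩
  rw [inv_mul_le_iff₀ (by exact_mod_cast hK)]
  exact hsum

/-! ### The step size, the initial minibatch and the number of iterations -/

section Complexity

variable {n d : ℕ} {h τ κ σ ε : ℝ}

/-- The four terms of t²Λ² are at most (2dκL_A)², 4M²L², 4M²L² and (32M)²L², where M is the bracket.
The last three add up to 1032 M²L² ≤ (33ML)². Only the first is not covered by the bracket, which
gives the separate term of the claim. -/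
theorem budget_mul_invStepScale_le (hn : 0 < n) (hd : 0 < d) (hh : 0 < h) (hτ : 0 < τ)
    (hκ : 0 < κ) (hε : 0 < ε) {LA LB L γ : ℝ} {bInit : ℕ} (hA : 0 ≤ LA) (hB : 0 ≤ LB)
    (hBL : LB ≤ L) :
    budget n d h τ κ σ ε * invStepScale n d LA LB L (tuned n d h τ κ σ ε γ bInit)
      ≤ 2 * (d * κ * LA) + 33 * (bracket n d h τ κ σ ε * L) := by
  have hdiv := budget_div_momentum_le (σ := σ) hn hd hh hτ hκ hε rfl
  have hη : invStepScale n d LA LB L (tuned n d h τ κ σ ε γ bInit)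
      = √(omega d (coords d (budget n d h τ κ σ ε) κ)
          * (omega d (coords d (budget n d h τ κ σ ε) κ) + 1) * LA ^ 2
        + omega d (coords d (budget n d h τ κ σ ε) κ) / n
          * (omega d (coords d (budget n d h τ κ σ ε) κ) + 1) * LB ^ 2
        + (omega d (coords d (budget n d h τ κ σ ε) τ)
          * (omega d (coords d (budget n d h τ κ σ ε) τ) + 1) / n
          + 1 / momentum n ⌊budget n d h τ κ σ ε / h⌋₊ σ ε
            (omega d (coords d (budget n d h τ κ σ ε) τ))
            (omega d (coords d (budget n d h τ κ σ ε) κ)) ^ 2) * L ^ 2) := rfl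
  obtain ⟨h1, h2, h3, -⟩ := budget_spec (n := n) (d := d) (τ := τ) (κ := κ) (σ := σ) hh hε
  obtain ⟨m1, m2, m3, -, -, -⟩ := bracket_spec n d h τ κ σ ε
  obtain ⟨u1, u2, -, u4⟩ := coords_spec hd hτ h2
  obtain ⟨w1, w2, -, w4⟩ := coords_spec hd hκ h3
  obtain ⟨b1, -, -⟩ := batch_spec hh h1
  have hω := omega_nonneg u1 u2
  have hωs := omega_nonneg w1 w2
  have hη0 := (momentum_spec (σ := σ) hn b1 hε hω hωs).1
  rw [hη]
  set t := budget n d h τ κ σ ε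
  set ω := omega d (coords d t τ)
  set ωs := omega d (coords d t κ)
  set η := momentum n ⌊t / h⌋₊ σ ε ω ωs
  set M := bracket n d h τ κ σ ε
  have hn' : (0 : ℝ) < n := by exact_mod_cast hn
  have ht0 : 0 < t := hh.trans_le h1
  have hM : 0 < M := hh.trans_le m1
  have hL : 0 ≤ L := hB.trans hBL
  have sq_div : ∀ c : ℝ, 0 ≤ c → d * c / √n ≤ M → 4 * (d : ℝ) ^ 2 * c ^ 2 / n ≤ 4 * M ^ 2 := by
    intro c hc hcM
    have := pow_le_pow_left₀ (by positivity) hcM 2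
    rw [div_pow, Real.sq_sqrt hn'.le, mul_pow] at this
    have e : 4 * (d : ℝ) ^ 2 * c ^ 2 / n = 4 * (d ^ 2 * c ^ 2 / n) := by ring
    rw [e]
    linarith
  have a1 := mul_le_mul_of_nonneg_right w4 (sq_nonneg LA)
  have a2 : ωs * (ωs + 1) * t ^ 2 / n * LB ^ 2 ≤ 4 * M ^ 2 * L ^ 2 :=
    mul_le_mul ((div_le_div_of_nonneg_right w4 hn'.le).trans (sq_div κ hκ.le m2))
      (pow_le_pow_left₀ hB hBL 2) (sq_nonneg _) (by positivity)
  have a3 : ω * (ω + 1) * t ^ 2 / n * L ^ 2 ≤ 4 * M ^ 2 * L ^ 2 :=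
    mul_le_mul_of_nonneg_right ((div_le_div_of_nonneg_right u4 hn'.le).trans (sq_div τ hτ.le m3))
      (sq_nonneg _)
  have a4 : (t * (1 / η)) ^ 2 * L ^ 2 ≤ (32 * M) ^ 2 * L ^ 2 :=
    mul_le_mul_of_nonneg_right (pow_le_pow_left₀ (by positivity) hdiv 2) (sq_nonneg _)
  refine le_of_sq_le_sq ?_ (by positivity)
  rw [mul_pow, Real.sq_sqrt (by positivity)]
  have e : t ^ 2 * (ωs * (ωs + 1) * LA ^ 2 + ωs / n * (ωs + 1) * LB ^ 2
      + (ω * (ω + 1) / n + 1 / η ^ 2) * L ^ 2)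
      = ωs * (ωs + 1) * t ^ 2 * LA ^ 2 + ωs * (ωs + 1) * t ^ 2 / n * LB ^ 2
        + ω * (ω + 1) * t ^ 2 / n * L ^ 2 + (t * (1 / η)) ^ 2 * L ^ 2 := by
    ring
  rw [e]
  have hx : 0 ≤ (d * κ * LA) * (M * L) := by positivity
  have hy : 0 ≤ M ^ 2 * L ^ 2 := by positivity
  linarith

/-- The square factors as (bh)(1/η)(h + σ²h/(nε)) ≤ 32M · 2M = (8M)², with M the bracket. -/
theorem mul_initBatchScale_le (hn : 0 < n) (hd : 0 < d) (hh : 0 < h) (hτ : 0 < τ) (hκ : 0 < κ)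
    (hε : 0 < ε) {γ : ℝ} {bInit : ℕ} :
    h * initBatchScale n σ ε (tuned n d h τ κ σ ε γ bInit) ≤ 8 * bracket n d h τ κ σ ε := by
  have hdiv := budget_div_momentum_le (σ := σ) hn hd hh hτ hκ hε rfl
  have hη : initBatchScale n σ ε (tuned n d h τ κ σ ε γ bInit)
      = √((⌊budget n d h τ κ σ ε / h⌋₊ : ℝ) / momentum n ⌊budget n d h τ κ σ ε / h⌋₊ σ ε
            (omega d (coords d (budget n d h τ κ σ ε) τ))
            (omega d (coords d (budget n d h τ κ σ ε) κ)) * (1 + σ ^ 2 / (n * ε))) := rfl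
  obtain ⟨h1, h2, h3, -⟩ := budget_spec (n := n) (d := d) (τ := τ) (κ := κ) (σ := σ) hh hε
  obtain ⟨m1, -, -, -, m5, -⟩ := bracket_spec n d h τ κ σ ε
  obtain ⟨u1, u2, -, -⟩ := coords_spec hd hτ h2
  obtain ⟨w1, w2, -, -⟩ := coords_spec hd hκ h3
  obtain ⟨b1, b2, -⟩ := batch_spec hh h1
  have hη0 := (momentum_spec (σ := σ) hn b1 hε (omega_nonneg u1 u2) (omega_nonneg w1 w2)).1
  rw [hη]
  set t := budget n d h τ κ σ ε
  set η := momentum n ⌊t / h⌋₊ σ ε (omega d (coords d t τ)) (omega d (coords d t κ))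
  set M := bracket n d h τ κ σ ε
  have hn' : (0 : ℝ) < n := by exact_mod_cast hn
  have hM : 0 < M := hh.trans_le m1
  refine le_of_sq_le_sq ?_ (by positivity)
  rw [mul_pow, Real.sq_sqrt (by positivity)]
  have e : h ^ 2 * ((⌊t / h⌋₊ : ℝ) / η * (1 + σ ^ 2 / (n * ε)))
      = (⌊t / h⌋₊ * h) * (1 / η) * (h + σ ^ 2 * h / (n * ε)) := by
    ring
  rw [e]
  have h4 : (⌊t / h⌋₊ * h) * (1 / η) ≤ 32 * M :=
    (mul_le_mul_of_nonneg_right b2 (by positivity)).trans hdiv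
  have h5 : (⌊t / h⌋₊ * h) * (1 / η) * (h + σ ^ 2 * h / (n * ε)) ≤ 32 * M * (M + M) :=
    mul_le_mul h4 (add_le_add m1 m5) (by positivity) (by positivity)
  linarith

/-- With s = σ²/(nε), the second entry of η gives 6s ≤ b/η, and `omega_noise_le` gives ω²s ≤ 8b ≤
8b/η. Hence (32ωs)² ≤ 8192 (b/η)s, which 100² covers; the bound s ≤ 5 b_init has ample room. -/
theorem initBatch_spec (hn : 0 < n) (hd : 0 < d) (hh : 0 < h) (hτ : 0 < τ) (hκ : 0 < κ)
    (hε : 0 < ε) {γ : ℝ} {bInit : ℕ}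
    (hb : 100 * initBatchScale n σ ε (tuned n d h τ κ σ ε γ bInit) ≤ bInit) :
    0 < bInit ∧ σ ^ 2 / (n * ε) ≤ 5 * bInit ∧
      32 * (omega d (coords d (budget n d h τ κ σ ε) τ) * (σ ^ 2 / (n * ε))) ≤ bInit := by
  have hη : initBatchScale n σ ε (tuned n d h τ κ σ ε γ bInit)
      = √((⌊budget n d h τ κ σ ε / h⌋₊ : ℝ) / momentum n ⌊budget n d h τ κ σ ε / h⌋₊ σ ε
            (omega d (coords d (budget n d h τ κ σ ε) τ))
            (omega d (coords d (budget n d h τ κ σ ε) κ)) * (1 + σ ^ 2 / (n * ε))) := rfl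
  obtain ⟨h1, h2, h3, -⟩ := budget_spec (n := n) (d := d) (τ := τ) (κ := κ) (σ := σ) hh hε
  obtain ⟨u1, u2, -, -⟩ := coords_spec hd hτ h2
  obtain ⟨w1, w2, -, -⟩ := coords_spec hd hκ h3
  obtain ⟨b1, -, -⟩ := batch_spec hh h1
  have hω := omega_nonneg u1 u2
  have hnoise := omega_noise_le (κ := κ) (σ := σ) hn hd hh hτ hε rfl
  obtain ⟨hη0, hη1, -, hq, -, -⟩ := momentum_spec (σ := σ) hn b1 hε hω (omega_nonneg w1 w2)
  rw [hη] at hb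
  set t := budget n d h τ κ σ ε
  set ω := omega d (coords d t τ)
  set η := momentum n ⌊t / h⌋₊ σ ε ω (omega d (coords d t κ))
  set b : ℝ := (⌊t / h⌋₊ : ℝ) with hb_def
  have hb' : 0 < b := by
    rw [hb_def]
    exact_mod_cast b1
  have hn' : (0 : ℝ) < n := by exact_mod_cast hn
  set s := σ ^ 2 / (n * ε) with hs
  have hs0 : 0 ≤ s := by positivity
  have c1 : 6 * s ≤ b / η := by
    have e : η * (σ ^ 2 / b) / n = η * s / b * ε := by
      rw [hs]
      field_simp
    rw [e] at hq
    have : η * s / b ≤ 1 / 6 := le_of_mul_le_mul_right (by linarith) hε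
    rw [div_le_iff₀ hb'] at this
    rw [le_div_iff₀ hη0]
    linarith
  have c2 : b ≤ b / η := by
    rw [le_div_iff₀ hη0]
    exact mul_le_of_le_one_right hb'.le hη1
  have c3 := pow_le_pow_left₀ (by positivity) hb 2
  rw [mul_pow, Real.sq_sqrt (by positivity)] at c3
  have c4 : 0 < 100 * √(b / η * (1 + s)) := by positivity
  have c5 : (0 : ℝ) < bInit := c4.trans_le hb
  have c6 : 0 < b / η := by positivity
  refine ⟨by exact_mod_cast c5, le_of_sq_le_sq ?_ (by positivity), le_of_sq_le_sq ?_ c5.le⟩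
  · have := mul_le_mul_of_nonneg_right c1 hs0
    nlinarith
  · have d1 : ω ^ 2 * s ≤ 8 * b := by
      have : 0 ≤ ω * s := by positivity
      linarith
    have d2 := mul_le_mul_of_nonneg_right (d1.trans (by linarith : 8 * b ≤ 8 * (b / η))) hs0
    nlinarith

/-- The number of iterations for the target accuracy `ε`. -/
noncomputable def numIterations (γ ε Δ : ℝ) : ℕ := ⌈8 * Δ / (γ * ε)⌉₊ + 1

theorem numIterations_pos (γ ε Δ : ℝ) : 0 < numIterations γ ε Δ := Nat.succ_pos _

theorem le_numIterations (γ ε Δ : ℝ) : 8 * Δ / (γ * ε) ≤ numIterations γ ε Δ := by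
  have := Nat.le_ceil (8 * Δ / (γ * ε))
  rw [numIterations]
  push_cast
  linarith

theorem numIterations_le {γ ε Δ : ℝ} (h : 0 ≤ 8 * Δ / (γ * ε)) :
    numIterations γ ε Δ ≤ 8 * Δ / (γ * ε) + 2 := by
  have := Nat.ceil_lt_add_one h
  rw [numIterations]
  push_cast
  linarith

/-- The allowance Kε is spent exactly: 1/4 on 2Δ/γ, and 2·(1/16 + 1/6 + 1/16 + 3/36) = 3/4 on the
four noise terms. -/
theorem noise_le {n b bInit K : ℕ} {ω η γ Δ L : ℝ} (hn : 0 < n) (hbInit : 0 < bInit)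
    (hε : 0 < ε) (hγ : 0 < γ) (hL : 0 < L) (hη : 0 < η) (hη1 : η ≤ 1) (hΔ : 1 / 2 ≤ L * Δ / ε)
    (h1 : ω * (ω + 1) / n * (η ^ 2 * (σ ^ 2 / b)) ≤ ε / 36) (h2 : η * (σ ^ 2 / b) / n ≤ ε / 6)
    (h3 : σ ^ 2 / (n * ε) ≤ 5 * bInit) (h4 : 32 * (ω * (σ ^ 2 / (n * ε))) ≤ bInit)
    (hstep : γ * (L / η) ≤ 1 / 20) (hK : 8 * Δ / (γ * ε) ≤ K) :
    2 * Δ / γ + 2 * (σ ^ 2 / bInit / n / η + K * (η * (σ ^ 2 / b) / n)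
      + K * (2 * ω / n * η * (σ ^ 2 / bInit))
      + K * (ω * (ω + 1) / n * (3 * η ^ 2 * (σ ^ 2 / b)))) ≤ K * ε := by
  have hn' : (0 : ℝ) < n := by exact_mod_cast hn
  have hI : (0 : ℝ) < bInit := by exact_mod_cast hbInit
  have hK0 : (0 : ℝ) ≤ K := Nat.cast_nonneg K
  have a1 : 2 * Δ / γ ≤ K * ε / 4 := by
    have := mul_le_mul_of_nonneg_right hK hε.le
    have e : 8 * Δ / (γ * ε) * ε = 4 * (2 * Δ / γ) := by
      field_simp
      ring
    linarith
  -- From LΔ/ε ≥ 1/2 and γL/η ≤ 1/20: 8 · (1/2) · 20 = 80. The run is thus long enough for the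
  -- initial error, which is forgotten at rate η, to average out.
  have a2 : 80 / η ≤ K := by
    refine le_trans ?_ hK
    have e : 8 * Δ / (γ * ε) = 8 * (L * Δ / ε) / (γ * (L / η)) / η := by
      field_simp
    rw [e]
    refine div_le_div_of_nonneg_right ?_ hη.le
    rw [le_div_iff₀ (by positivity)]
    linarith
  have a3 : σ ^ 2 / bInit / n / η ≤ K * ε / 16 := by
    have e : σ ^ 2 / bInit / n / η = σ ^ 2 / (n * ε) / bInit * (ε / 80) * (80 / η) := by
      field_simp
    have h5 : σ ^ 2 / (n * ε) / bInit ≤ 5 := by rwa [div_le_iff₀ hI]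
    have h6 : σ ^ 2 / (n * ε) / bInit * (ε / 80) ≤ 5 * (ε / 80) :=
      mul_le_mul_of_nonneg_right h5 (by positivity)
    have h7 := mul_le_mul h6 a2 (by positivity) (by positivity)
    rw [e]
    linarith
  have a4 : 2 * ω / n * η * (σ ^ 2 / bInit) ≤ ε / 16 := by
    have e : 2 * ω / n * η * (σ ^ 2 / bInit)
        = 32 * (ω * (σ ^ 2 / (n * ε))) / bInit * (ε / 16) * η := by
      field_simp
      ring
    rw [e]
    have h5 : 32 * (ω * (σ ^ 2 / (n * ε))) / bInit ≤ 1 := (div_le_one hI).2 h4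
    have h6 : 32 * (ω * (σ ^ 2 / (n * ε))) / bInit * (ε / 16) ≤ 1 * (ε / 16) :=
      mul_le_mul_of_nonneg_right h5 (by positivity)
    have h7 := mul_le_mul h6 hη1 hη.le (by positivity)
    linarith
  have b2 := mul_le_mul_of_nonneg_left h2 hK0
  have b4 := mul_le_mul_of_nonneg_left a4 hK0
  have b1 := mul_le_mul_of_nonneg_left h1 hK0
  linarith

end Complexity

theorem le_invStepScale {n d : ℕ} {LA LB L : ℝ} {θ : Params}
    (hω : 0 ≤ omega d θ.kUp) (hωs : 0 ≤ omega d θ.kDown) :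
    L / θ.ν ≤ invStepScale n d LA LB L θ := by
  refine Real.le_sqrt_of_sq_le ?_
  have h1 : 0 ≤ omega d θ.kDown * (omega d θ.kDown + 1) * LA ^ 2
      + omega d θ.kDown / n * (omega d θ.kDown + 1) * LB ^ 2
      + omega d θ.kUp * (omega d θ.kUp + 1) / n * L ^ 2 := by positivity
  have e : (L / θ.ν) ^ 2 = 1 / θ.ν ^ 2 * L ^ 2 := by
    rw [div_pow]
    ring
  rw [e]
  linarith

theorem le_Lmax {n : ℕ} (Ls : Fin n → ℝ) (LA LB : ℝ) (i : Fin n) : Ls i ≤ Lmax Ls LA LB :=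
  (le_ciSup (Set.finite_range Ls).bddAbove i).trans (le_max_left _ _)

theorem invStepScale_zero {n d : ℕ} {θ : Params} : invStepScale n d 0 0 0 θ = 0 := by
  simp [invStepScale]

/-- With `γ` of order `1 / Λ`, the expected time is of the claimed order. -/
theorem time_le {n d : ℕ} {h τ κ σ ε Δ LA LB L γ aγ ab : ℝ} {bInit K : ℕ}
    (hn : 0 < n) (hd : 0 < d) (hh : 0 < h) (hτ : 0 < τ) (hκ : 0 < κ) (hε : 0 < ε) (hγ : 0 < γ)
    (haγ : 0 < aγ) (hab : 0 < ab) (hA : 0 ≤ LA) (hB : 0 ≤ LB) (hBL : LB ≤ L) (hΔ0 : 0 ≤ Δ)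
    (hΔ : 1 / 2 ≤ L * Δ / ε)
    (hstep : aγ ≤ γ * invStepScale n d LA LB L (tuned n d h τ κ σ ε γ bInit))
    (hinit : bInit ≤ ab * initBatchScale n σ ε (tuned n d h τ κ σ ε γ bInit))
    (hK : K ≤ 8 * Δ / (γ * ε) + 2) :
    bInit * h + K * (5 * budget n d h τ κ σ ε)
      ≤ (1320 / aγ + 20 + 16 * ab) * timeBound n d h τ κ σ ε Δ LA L := by
  have h1 := budget_mul_invStepScale_le (σ := σ) (γ := γ) (bInit := bInit) hn hd hh hτ hκ hε
    hA hB hBL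
  have h2 := mul_initBatchScale_le (σ := σ) (γ := γ) (bInit := bInit) hn hd hh hτ hκ hε
  obtain ⟨m1, -, -, -, -, m6⟩ := bracket_spec n d h τ κ σ ε
  have t1 := (budget_spec (n := n) (d := d) (τ := τ) (κ := κ) (σ := σ) hh hε).1
  rw [timeBound_eq]
  set t := budget n d h τ κ σ ε
  set M := bracket n d h τ κ σ ε
  set Λ := invStepScale n d LA LB L (tuned n d h τ κ σ ε γ bInit)
  set B := initBatchScale n σ ε (tuned n d h τ κ σ ε γ bInit)
  have ht : 0 < t := hh.trans_le t1
  have hM : 0 < M := hh.trans_le m1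
  set X := M * (L * Δ / ε) with hX
  set Y := d * κ * LA * Δ / ε with hY
  -- This absorbs everything that is paid only once: the initial minibatches and the two iterations
  -- added by rounding.
  have hX0 : M ≤ 2 * X := by
    have := mul_le_mul_of_nonneg_left hΔ hM.le
    linarith
  have hY0 : 0 ≤ Y := by positivity
  have i1 : bInit * h ≤ 16 * ab * X := by
    have := mul_le_mul_of_nonneg_right hinit hh.le
    have := mul_le_mul_of_nonneg_left h2 hab.le
    have := mul_le_mul_of_nonneg_left hX0 hab.le
    linarith
  have i2 : 1 / γ ≤ Λ / aγ := by
    rw [div_le_div_iff₀ hγ haγ]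
    linarith
  have i3 : K * (5 * t) ≤ 40 * (Δ / ε) * (t * (1 / γ)) + 10 * t := by
    have := mul_le_mul_of_nonneg_right hK (show 0 ≤ 5 * t by positivity)
    have e : (8 * Δ / (γ * ε) + 2) * (5 * t) = 40 * (Δ / ε) * (t * (1 / γ)) + 10 * t := by
      field_simp
      ring
    linarith
  have i4 : t * (1 / γ) ≤ (2 * (d * κ * LA) + 33 * (M * L)) / aγ := by
    have := mul_le_mul_of_nonneg_left i2 ht.le
    refine this.trans ?_
    rw [← mul_div_assoc]
    exact div_le_div_of_nonneg_right h1 haγ.le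
  have i5 := mul_le_mul_of_nonneg_left i4 (show 0 ≤ 40 * (Δ / ε) by positivity)
  have e : 40 * (Δ / ε) * ((2 * (d * κ * LA) + 33 * (M * L)) / aγ)
      = 80 / aγ * Y + 1320 / aγ * X := by
    rw [hX, hY]
    ring
  have i6 : 80 / aγ * Y ≤ 1320 / aγ * Y :=
    mul_le_mul_of_nonneg_right (div_le_div_of_nonneg_right (by norm_num) haγ.le) hY0
  have i7 : 0 ≤ ab * Y := by positivity
  linarith

end M4

/-! ### The complexity theorem -/

theorem mainTheorem2 :
    ∃ cγ cb : ℝ, 0 < cγ ∧ 0 < cb ∧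
    ∀ aγ ab : ℝ, 0 < aγ → 0 < ab →
    ∃ C : ℝ, 0 < C ∧
    ∀ (n d : ℕ) (h τ κ σ ε Δ LA LB : ℝ) (Ls : Fin n → ℝ) (γ : ℝ) (bInit : ℕ),
      0 < n → 0 < d → 0 < h → 0 < τ → 0 < κ → 0 < σ → 0 < ε →
      aγ ≤ γ * M4.invStepScale n d LA LB (M4.Lmax Ls LA LB) (M4.tuned n d h τ κ σ ε γ bInit) →
      γ * M4.invStepScale n d LA LB (M4.Lmax Ls LA LB) (M4.tuned n d h τ κ σ ε γ bInit) ≤ cγ →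
      cb * M4.initBatchScale n σ ε (M4.tuned n d h τ κ σ ε γ bInit) ≤ (bInit : ℝ) →
      (bInit : ℝ) ≤ ab * M4.initBatchScale n σ ε (M4.tuned n d h τ κ σ ε γ bInit) →
      ∃ K : ℕ, 0 < K ∧
      ∀ (Ω Ξ : Type*) [MeasurableSpace Ω] [MeasurableSpace Ξ]
        (P : Measure Ω) [IsProbabilityMeasure P] (D : Fin n → Measure Ξ)
        (f : Fin n → M4.Vec d → ℝ) (G : Fin n → M4.Vec d → Ξ → M4.Vec d)
        (fstar : ℝ) (x₀ : M4.Vec d) (R : M4.Draws Ω Ξ n d) (T : M4.Durations Ω n),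
        (∀ i, M4.IsSmooth (f i) (Ls i)) →
        (∀ x, fstar ≤ M4.objective f x) →
        Δ = M4.objective f x₀ - fstar →
        M4.StochasticGradients f D G σ →
        M4.Similarity f LA LB →
        ε ≤ ‖gradient (M4.objective f) x₀‖ ^ 2 →
        R.IsAdmissible P D (M4.tuned n d h τ κ σ ε γ bInit) →
        T.Bounded h τ κ →
        M4.IsStationaryPoint (M4.objective f) ε (P.prod (uniformOn (Set.Iio K)))
            (M4.output G (M4.tuned n d h τ κ σ ε γ bInit) x₀ R) ∧
          Integrable (M4.totalTime (M4.tuned n d h τ κ σ ε γ bInit) R T K) P ∧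
          ∫ a, M4.totalTime (M4.tuned n d h τ κ σ ε γ bInit) R T K a ∂P
            ≤ C * M4.timeBound n d h τ κ σ ε Δ LA (M4.Lmax Ls LA LB) := by
  refine ⟨1 / 20, 100, by norm_num, by norm_num, fun aγ ab haγ hab =>
    ⟨1320 / aγ + 20 + 16 * ab, by positivity, ?_⟩⟩
  intro n d h τ κ σ ε Δ LA LB Ls γ bInit hn hd hh hτ hκ hσ hε hstep hstep' hinit hinit'
  refine ⟨M4.numIterations γ ε Δ, M4.numIterations_pos γ ε Δ, ?_⟩
  intro Ω Ξ _ _ P _ D f G fstar x₀ R T hsmooth hlower hΔ hG hsim hx₀ hR hT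
  obtain ⟨t1, t2, t3, -⟩ :=
    M4.budget_spec (n := n) (d := d) (τ := τ) (κ := κ) (σ := σ) hh hε
  obtain ⟨u1, u2, u3, -⟩ := M4.coords_spec hd hτ t2
  obtain ⟨w1, w2, w3, -⟩ := M4.coords_spec hd hκ t3
  obtain ⟨b1, b2, -⟩ := M4.batch_spec hh t1
  have hω := M4.omega_nonneg u1 u2
  have hωs := M4.omega_nonneg w1 w2
  obtain ⟨η0, η1, q1, q2, q3, -⟩ := M4.momentum_spec (σ := σ) hn b1 hε hω hωs
  obtain ⟨hI, hI1, hI2⟩ := M4.initBatch_spec (γ := γ) (bInit := bInit) hn hd hh hτ hκ hε hinit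
  set L := M4.Lmax Ls LA LB with hL_def
  have hA := hsim.1
  have hB := hsim.2.1
  have hAL : LA ≤ L := (le_max_left _ _).trans (le_max_right _ _)
  have hBL : LB ≤ L := (le_max_right _ _).trans (le_max_right _ _)
  have hΛ0 : 0 ≤ M4.invStepScale n d LA LB L (M4.tuned n d h τ κ σ ε γ bInit) :=
    Real.sqrt_nonneg _
  have hγ : 0 < γ := pos_of_mul_pos_left (haγ.trans_le hstep) hΛ0
  -- If L were 0, then L_A = L_B = 0 and Λ = 0, contrary to aγ ≤ γΛ.
  have hL : 0 < L := by
    refine (hA.trans hAL).lt_of_ne fun hL0 => ?_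
    rw [← hL0] at hAL hBL hstep
    rw [le_antisymm hAL hA, le_antisymm hBL hB, M4.invStepScale_zero, mul_zero] at hstep
    exact absurd hstep (not_le.2 haγ)
  have hf : ∀ i, M4.IsSmooth (f i) L := fun i => (hsmooth i).mono (M4.le_Lmax Ls LA LB i)
  -- The assumption that x⁰ is not ε-stationary enters here only.
  have hgap : ε ≤ 2 * L * Δ := by
    rw [hΔ]
    exact hx₀.trans ((M4.isSmooth_objective hn hf).norm_gradient_sq_le hL hlower x₀)
  have hΔ0 : 0 ≤ Δ := by
    rw [hΔ]
    exact sub_nonneg.2 (hlower x₀)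
  have hΔε : 1 / 2 ≤ L * Δ / ε := by
    rw [le_div_iff₀ hε]
    linarith
  have hS : M4.Setting P D f G R (M4.tuned n d h τ κ σ ε γ bInit)
      (M4.tuned n d h τ κ σ ε γ bInit).ν L LA LB σ fstar :=
    { n_pos := hn
      smooth := hf
      lower := hlower
      grad := hG
      sim := hsim
      adm := hR
      γ_pos := hγ
      η_pos := η0
      η_le := η1
      μ_eq := rfl
      ν_eq := rfl
      b_pos := b1
      bInit_pos := hI
      kDown_pos := w1
      kDown_le := w2
      kUp_pos := u1
      kUp_le := u2
      pDown_eq := rfl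
      pUp_eq := rfl }
  have hΛ := M4.le_invStepScale (n := n) (LA := LA) (LB := LB) (L := L)
    (θ := M4.tuned n d h τ κ σ ε γ bInit) hω hωs
  refine ⟨hS.isStationaryPoint_output (M4.numIterations_pos γ ε Δ) ?_, ?_⟩
  · refine (hS.sum_integral_gradient_le hAL hBL q3 hstep' _).trans ?_
    rw [← hΔ]
    exact M4.noise_le hn hI hε hγ hL η0 η1 hΔε q1 q2 hI1 hI2
      ((mul_le_mul_of_nonneg_left hΛ hγ.le).trans hstep') (M4.le_numIterations γ ε Δ)
  · obtain ⟨i1, i2⟩ := M4.integral_totalTime_le (R := R)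
      (θ := M4.tuned n d h τ κ σ ε γ bInit) hn hT hτ.le hκ.le w1 w2 u1 u2
      hR.downCoin_law hR.upCoin_law (M4.numIterations γ ε Δ)
    refine ⟨i1, i2.trans (le_trans ?_ (M4.time_le hn hd hh hτ hκ hε hγ haγ hab hA hB hBL hΔ0 hΔε
      hstep hinit' (M4.numIterations_le (by positivity))))⟩
    -- Each of the three phases fits into t for compressed messages. The coins double the two
    -- transmissions, so an iteration takes at most 2t + t + 2t.
    refine add_le_add le_rfl (mul_le_mul_of_nonneg_left ?_ (Nat.cast_nonneg _))
    have e1 : ((M4.tuned n d h τ κ σ ε γ bInit).kDown * κ : ℝ) ≤ M4.budget n d h τ κ σ ε := w3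
    have e2 : ((M4.tuned n d h τ κ σ ε γ bInit).kUp * τ : ℝ) ≤ M4.budget n d h τ κ σ ε := u3
    have e3 : ((M4.tuned n d h τ κ σ ε γ bInit).b * h : ℝ) ≤ M4.budget n d h τ κ σ ε := b2
    linarith
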